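/- Let $(M,g,I,J,K)$ be a compact hyperkähler manifold of complex dimension $2m$: $g$ is a Riemannian metric and $I,J,K$ are integrable complex structures with $IJK=-1$, each of which defines a Kähler metric together with $g$. Let $Y$ be a compact complex manifold and $\varphi:Y\to\mathbb{CP}^1$ a nonconstant holomorphic map. Identify $\mathbb{CP}^1$ with $S^2=\{(a,b,c)\in\mathbb R^3: a^2+b^2+c^2=1\}$ by $$[z_0:z_1]\mapsto \frac{\big(|z_0|^2-|z_1|^2,\ 2\,\mathrm{Re}(\bar z_0z_1),\ 2\,\mathrm{Im}(\bar z_0z_1)\big)}{|z_0|^2+|z_1|^2}.$$ Let $X=\varphi^*Z$ be the pullback by $\varphi$ of the twistor space $Z\to\mathbb{CP}^1$ of $M$; that is, $X$ is the smooth manifold $M\times Y$ with the almost complex structure $$\mathfrak I_{(x,y)}=(aI+bJ+cK)_x\oplus (J_Y)_y,\qquad (a,b,c)=\varphi(y),$$ where $J_Y$ is the complex structure of $Y$. Then $\mathfrak I$ is integrable, so that $X$ is a complex manifold, and: (a) The natural projection $p:X\to Y$ is holomorphic. (b) For every point $x\in M$, the slice $\{x\}\times Y\subset M\times Y=X$ is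 a complex submanifold of $X$. (c) There is an isomorphism of holomorphic line bundles on $X$ $$K_X\cong p^*\big(K_Y\otimes\varphi^*\mathcal O(-2m)\big),$$ where $K_X$ and $K_Y$ are the canonical bundles of $X$ and $Y$, and $\mathcal O(-2m)=\mathcal O(-1)^{\otimes 2m}$ with $\mathcal O(-1)$ the tautological line bundle on $\mathbb{CP}^1$. -/

import Mathlib

open Set Manifold Bundle
open scoped ContDiff Topology TensorProduct LinearAlgebra.Projectivization

noncomputable section

universe u v w

namespace CalabiGray

/-! ### Differential forms on manifolds without boundary -/

section Forms

variable {E : Type*} [NormedAddCommGroup E] [NormedSpace ℝ E]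
  {H : Type*} [TopologicalSpace H] (I : ModelWithCorners ℝ E H)
  {X : Type*} [TopologicalSpace X] [ChartedSpace H X]
  {F : Type*} [NormedAddCommGroup F] [NormedSpace ℝ F] {k : ℕ}

/-- The coordinate expression of the `k`-form `α` in the preferred chart at `x₀`: the pullback of
`α` by the inverse of that chart. -/
def formInChart (α : ∀ x : X, TangentSpace I x [⋀^Fin k]→L[ℝ] F) (x₀ : X) :
    E → E [⋀^Fin k]→L[ℝ] F :=
  fun e => (α ((extChartAt I x₀).symm e)).compContinuousLinearMap
    (mfderiv 𝓘(ℝ, E) I (extChartAt I x₀).symm e)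

/-- Smoothness of a differential form at a point. -/
def FormSmoothAt (α : ∀ x : X, TangentSpace I x [⋀^Fin k]→L[ℝ] F) (x : X) : Prop :=
  ContDiffAt ℝ ∞ (formInChart I α x) (extChartAt I x x)

/-- The exterior derivative of a differential form at `x`, computed in the preferred chart at `x`
(in which the tangent space at `x` is the model space `E`). -/
def formExtDeriv (α : ∀ x : X, TangentSpace I x [⋀^Fin k]→L[ℝ] F) (x : X) :
    TangentSpace I x [⋀^Fin (k + 1)]→L[ℝ] F :=
  (extDeriv (formInChart I α x) (extChartAt I x x) : E [⋀^Fin (k + 1)]→L[ℝ] F)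

end Forms

/-! ### Complex structures, holomorphic functions and maps, complex submanifolds -/

section ComplexStructures

variable {E : Type*} [NormedAddCommGroup E] [NormedSpace ℝ E]
  {H : Type*} [TopologicalSpace H] (I : ModelWithCorners ℝ E H)
  {X : Type*} [TopologicalSpace X] [ChartedSpace H X]

/-- The vanishing of the Nijenhuis tensor
`[JV, JW] - J[JV, W] - J[V, JW] - [V, W]` of a field `J` of endomorphisms of the tangent spaces. -/
def NijenhuisVanishes [IsManifold I 1 X]
    (J : ∀ x : X, TangentSpace I x →L[ℝ] TangentSpace I x) : Prop :=
  ∀ (V W : ∀ x : X, TangentSpace I x) (x : X),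
    ContMDiffAt I I.tangent ∞ (fun y => (⟨y, V y⟩ : TangentBundle I X)) x →
    ContMDiffAt I I.tangent ∞ (fun y => (⟨y, W y⟩ : TangentBundle I X)) x →
    VectorField.mlieBracket I (fun y => J y (V y)) (fun y => J y (W y)) x
      - J x (VectorField.mlieBracket I (fun y => J y (V y)) W x)
      - J x (VectorField.mlieBracket I V (fun y => J y (W y)) x)
      - VectorField.mlieBracket I V W x = 0

/-- `J` is an integrable complex structure on the smooth manifold `X`: a smooth endomorphism field
of the tangent bundle with square `-1` and vanishing Nijenhuis tensor. -/
structure IsComplexStructure [IsManifold I 1 X]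
    (J : ∀ x : X, TangentSpace I x →L[ℝ] TangentSpace I x) : Prop where
  smooth : ContMDiff I (I.prod 𝓘(ℝ, E →L[ℝ] E)) ∞
    (fun x => TotalSpace.mk' (E →L[ℝ] E)
      (E := fun x : X => TangentSpace I x →L[ℝ] TangentSpace I x) x (J x))
  sq_eq : ∀ (x : X) (v : TangentSpace I x), J x (J x v) = -v
  integrable : NijenhuisVanishes I J

/-- The differential at `x` of a complex valued function. -/
def dFun (f : X → ℂ) (x : X) : TangentSpace I x →L[ℝ] ℂ := mfderiv I 𝓘(ℝ, ℂ) f x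

/-- The function `f` is holomorphic on the set `U` (in practice open) with respect to `J`: it is
smooth and satisfies the Cauchy-Riemann equation `df ∘ J = i df`. -/
def IsHolFun (J : ∀ x : X, TangentSpace I x →L[ℝ] TangentSpace I x)
    (U : Set X) (f : X → ℂ) : Prop :=
  ∀ x ∈ U, ContMDiffAt I 𝓘(ℝ, ℂ) ∞ f x ∧
    ∀ v : TangentSpace I x, dFun I f x (J x v) = Complex.I * dFun I f x v

/-- Holomorphic maps: smooth maps with complex linear differentials. -/
def IsHolMap {E' : Type*} [NormedAddCommGroup E'] [NormedSpace ℝ E']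
    {H' : Type*} [TopologicalSpace H'] (I' : ModelWithCorners ℝ E' H')
    {X' : Type*} [TopologicalSpace X'] [ChartedSpace H' X']
    (J : ∀ x : X, TangentSpace I x →L[ℝ] TangentSpace I x)
    (J' : ∀ x : X', TangentSpace I' x →L[ℝ] TangentSpace I' x) (f : X → X') : Prop :=
  ContMDiff I I' ∞ f ∧
    ∀ (x : X) (v : TangentSpace I x), mfderiv I I' f x (J x v) = J' (f x) (mfderiv I I' f x v)

/-- `S` is a complex submanifold of `(X, J)`: near each of its points it is the zero set of a smooth
map to some `ℝᵏ` whose differential along `S` is onto (so `S` is an embedded smooth submanifold)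
and the tangent spaces of `S` (the kernels of these differentials) are `J`-invariant. -/
def IsComplexSubmanifold (J : ∀ x : X, TangentSpace I x →L[ℝ] TangentSpace I x)
    (S : Set X) : Prop :=
  ∀ x ∈ S, ∃ U : Set X, IsOpen U ∧ x ∈ U ∧
    ∃ (k : ℕ) (f : X → EuclideanSpace ℝ (Fin k)),
      ContMDiffOn I 𝓘(ℝ, EuclideanSpace ℝ (Fin k)) ∞ f U ∧
      S ∩ U = {y ∈ U | f y = 0} ∧
      ∀ y ∈ S ∩ U,
        Function.Surjective (mfderiv I 𝓘(ℝ, EuclideanSpace ℝ (Fin k)) f y) ∧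
        ∀ v : TangentSpace I y, mfderiv I 𝓘(ℝ, EuclideanSpace ℝ (Fin k)) f y v = 0 →
          mfderiv I 𝓘(ℝ, EuclideanSpace ℝ (Fin k)) f y (J y v) = 0

end ComplexStructures

/-! ### Holomorphic line bundles, given by fibres and holomorphic local sections

Below `O U f` says that the function `f` is holomorphic on the open set `U`. -/

/-- Fibres over `X` together with the notion of a holomorphic section over an open set. (A section
over `U` is written as a section over `X`, whose values off `U` are irrelevant.) -/
structure BundleData (X : Type u) where
  fiber : X → Type v
  [addCommGroup : ∀ x, AddCommGroup (fiber x)]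
  [module : ∀ x, Module ℂ (fiber x)]
  IsHol : Set X → (∀ x, fiber x) → Prop

attribute [instance] BundleData.addCommGroup BundleData.module

/-- The data `L` is a holomorphic line bundle: the fibres are complex lines, and near every point
there is a nowhere vanishing section `e` such that the holomorphic sections are exactly the
multiples of `e` by holomorphic functions. -/
def IsHolLineBundle {X : Type u} [TopologicalSpace X] (O : Set X → (X → ℂ) → Prop)
    (L : BundleData.{u, v} X) : Prop :=
  (∀ x, Module.finrank ℂ (L.fiber x) = 1) ∧
  ∀ x, ∃ V : Set X, IsOpen V ∧ x ∈ V ∧ ∃ e : ∀ y, L.fiber y, (∀ y ∈ V, e y ≠ 0) ∧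
    ∀ U : Set X, IsOpen U → U ⊆ V → ∀ s : ∀ y, L.fiber y,
      L.IsHol U s ↔ ∃ f : X → ℂ, O U f ∧ ∀ y ∈ U, s y = f y • e y

/-- Isomorphisms of holomorphic bundles over `X`: fibrewise linear isomorphisms which, in both
directions, take holomorphic sections to holomorphic sections. -/
structure BundleIso {X : Type u} [TopologicalSpace X]
    (L : BundleData.{u, v} X) (L' : BundleData.{u, w} X) where
  equiv : ∀ x, L.fiber x ≃ₗ[ℂ] L'.fiber x
  isHol_iff : ∀ U : Set X, IsOpen U → ∀ s : ∀ x, L.fiber x,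
    L.IsHol U s ↔ L'.IsHol U (fun x => equiv x (s x))

/-- The trivial line bundle. -/
def trivialBundle {X : Type u} (O : Set X → (X → ℂ) → Prop) : BundleData.{u, 0} X where
  fiber := fun _ => ℂ
  IsHol := fun U s => O U s

/-- The tensor product of holomorphic line bundles: the holomorphic sections are locally
`g • (e ⊗ e')` with `g` a holomorphic function and `e`, `e'` nowhere vanishing holomorphic
sections of the two factors. -/
def tensorBundle {X : Type u} [TopologicalSpace X] (O : Set X → (X → ℂ) → Prop)
    (L : BundleData.{u, v} X) (L' : BundleData.{u, w} X) : BundleData.{u, max v w} X where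
  fiber := fun x => L.fiber x ⊗[ℂ] L'.fiber x
  IsHol := fun U s => ∀ x ∈ U, ∃ V : Set X, IsOpen V ∧ x ∈ V ∧ V ⊆ U ∧
    ∃ (g : X → ℂ) (e : ∀ y, L.fiber y) (e' : ∀ y, L'.fiber y),
      O V g ∧ L.IsHol V e ∧ L'.IsHol V e' ∧ (∀ y ∈ V, e y ≠ 0) ∧ (∀ y ∈ V, e' y ≠ 0) ∧
      ∀ y ∈ V, s y = g y • (e y ⊗ₜ[ℂ] e' y)

/-- The pullback of a holomorphic line bundle on `Y` by `f : X → Y`: the holomorphic sections are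
locally `g • (e ∘ f)` with `g` a holomorphic function on `X` and `e` a nowhere vanishing
holomorphic section on `Y`. -/
def pullbackBundle {X : Type u} [TopologicalSpace X] (O : Set X → (X → ℂ) → Prop)
    {Y : Type w} [TopologicalSpace Y] (f : X → Y) (L : BundleData.{w, v} Y) :
    BundleData.{u, v} X where
  fiber := fun x => L.fiber (f x)
  IsHol := fun U s => ∀ x ∈ U, ∃ V : Set X, IsOpen V ∧ x ∈ V ∧ V ⊆ U ∧
    ∃ W : Set Y, IsOpen W ∧ MapsTo f V W ∧
    ∃ (g : X → ℂ) (e : ∀ y, L.fiber y),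
      O V g ∧ L.IsHol W e ∧ (∀ y ∈ W, e y ≠ 0) ∧ ∀ y ∈ V, s y = g y • e (f y)

/-- The tensor power `L^{⊗ k}` of a holomorphic line bundle. -/
def tensorPowBundle {X : Type u} [TopologicalSpace X] (O : Set X → (X → ℂ) → Prop)
    (L : BundleData.{u, 0} X) : ℕ → BundleData.{u, 0} X
  | 0 => trivialBundle O
  | k + 1 => tensorBundle O (tensorPowBundle O L k) L

/-! ### The canonical bundle -/

section Canonical

variable {E : Type*} [NormedAddCommGroup E] [NormedSpace ℝ E]
  {H : Type*} [TopologicalSpace H] (I : ModelWithCorners ℝ E H)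
  {X : Type*} [TopologicalSpace X] [ChartedSpace H X]

/-- The complex valued `N`-forms on the tangent space at `x` that are of type `(N, 0)`, that is,
complex linear in each variable for the complex structure `J`. -/
def holForms (J : ∀ x : X, TangentSpace I x →L[ℝ] TangentSpace I x) (N : ℕ) (x : X) :
    Submodule ℂ (TangentSpace I x [⋀^Fin N]→L[ℝ] ℂ) where
  carrier := {α | ∀ (v : Fin N → TangentSpace I x) (i : Fin N),
    α (Function.update v i (J x (v i))) = Complex.I * α v}
  add_mem' := by
    intro a b ha hb v i
    simp only [Set.mem_ofPred_eq] at ha hb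
    simp only [ContinuousAlternatingMap.add_apply, ha, hb, mul_add]
  zero_mem' := by
    intro v i
    simp
  smul_mem' := by
    intro c a ha v i
    simp only [Set.mem_ofPred_eq] at ha
    simp only [ContinuousAlternatingMap.smul_apply, ha, smul_eq_mul]
    ring

/-- The canonical bundle of `(X, J)`: its fibres are the forms of type `(N, 0)`, where
`N = dim_ℝ X / 2` is the complex dimension, and a section over an open set is holomorphic if it is
smooth and `∂̄`-closed; for forms of type `(N, 0)`, `N` being the top degree, the latter means
closed. -/
def canonicalBundle (J : ∀ x : X, TangentSpace I x →L[ℝ] TangentSpace I x) : BundleData X where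
  fiber := fun x => holForms I J (Module.finrank ℝ E / 2) x
  IsHol := fun U s => ∀ x ∈ U,
    FormSmoothAt I (fun y => (s y : TangentSpace I y [⋀^Fin (Module.finrank ℝ E / 2)]→L[ℝ] ℂ)) x ∧
    formExtDeriv I
      (fun y => (s y : TangentSpace I y [⋀^Fin (Module.finrank ℝ E / 2)]→L[ℝ] ℂ)) x = 0

end Canonical

/-! ### Complex manifolds as real manifolds with a complex structure -/

section ComplexManifold

variable {E : Type*} [NormedAddCommGroup E] [NormedSpace ℂ E]
  {Y : Type*} [TopologicalSpace Y] [ChartedSpace E Y]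

/-- A complex manifold is a smooth real manifold. -/
instance realManifold [IsManifold 𝓘(ℂ, E) ω Y] : IsManifold 𝓘(ℝ, E) ∞ Y := by
  apply isManifold_of_contDiffOn
  intro e e' he he'
  have h := HasGroupoid.compatible (G := contDiffGroupoid ω 𝓘(ℂ, E)) he he'
  rw [contDiffGroupoid, mem_groupoid_of_pregroupoid] at h
  exact (h.1.restrict_scalars ℝ).of_le le_top

/-- Multiplication by `i` on the tangent spaces of a complex manifold, which are identified with
the model space by means of a holomorphic chart. -/
def complexMul (y : Y) : TangentSpace 𝓘(ℝ, E) y →L[ℝ] TangentSpace 𝓘(ℝ, E) y :=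
  ((Complex.I • ContinuousLinearMap.id ℂ E).restrictScalars ℝ : E →L[ℝ] E)

end ComplexManifold

/-! ### The complex projective line -/

/-- The complex projective line, the space of lines through the origin in `ℂ²`. -/
abbrev CP1 : Type := ℙ ℂ (Fin 2 → ℂ)

/-- The quotient topology of `ℂ² ∖ {0} → ℂℙ¹`. -/
instance topologicalSpaceCP1 : TopologicalSpace CP1 :=
  inferInstanceAs (TopologicalSpace (Quotient (projectivizationSetoid ℂ (Fin 2 → ℂ))))

/-- The preimage of `U ⊆ ℂℙ¹` in `ℂ² ∖ {0}`. -/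
def coneOver (U : Set CP1) : Set (Fin 2 → ℂ) :=
  {z | ∃ h : z ≠ 0, Projectivization.mk ℂ z h ∈ U}

open Classical in
/-- The function `f` on `ℂℙ¹` is holomorphic on `U`: it is so on the preimage of `U` in
`ℂ² ∖ {0}`. -/
def IsHolFunCP1 (U : Set CP1) (f : CP1 → ℂ) : Prop :=
  DifferentiableOn ℂ
    (fun z : Fin 2 → ℂ => if h : z ≠ 0 then f (Projectivization.mk ℂ z h) else 0) (coneOver U)

open Classical in
/-- The tautological bundle `𝒪(-1)` on `ℂℙ¹`, whose fibre at a line in `ℂ²` is that line. A section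
is holomorphic if it is so as a `ℂ²`-valued map on the preimage of its domain in `ℂ² ∖ {0}`. -/
def tautologicalBundle : BundleData.{0, 0} CP1 where
  fiber := fun l => l.submodule
  IsHol := fun U s => DifferentiableOn ℂ
    (fun z : Fin 2 → ℂ =>
      if h : z ≠ 0 then (s (Projectivization.mk ℂ z h) : Fin 2 → ℂ) else 0) (coneOver U)

/-- The bundle `𝒪(-k) = 𝒪(-1)^{⊗ k}` on `ℂℙ¹`. -/
def bundleONeg (k : ℕ) : BundleData.{0, 0} CP1 :=
  tensorPowBundle IsHolFunCP1 tautologicalBundle k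

/-- Holomorphic maps from a complex manifold to `ℂℙ¹`: locally they are `y ↦ [f₀(y) : f₁(y)]` with
holomorphic functions `f₀`, `f₁` without common zeros. -/
def IsHolMapCP1 {E : Type*} [NormedAddCommGroup E] [NormedSpace ℂ E]
    {Y : Type*} [TopologicalSpace Y] [ChartedSpace E Y] (φ : Y → CP1) : Prop :=
  ∀ y₀ : Y, ∃ U : Set Y, IsOpen U ∧ y₀ ∈ U ∧ ∃ f : Y → Fin 2 → ℂ,
    MDifferentiableOn 𝓘(ℂ, E) 𝓘(ℂ, Fin 2 → ℂ) f U ∧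
    ∀ y ∈ U, ∃ h : f y ≠ 0, φ y = Projectivization.mk ℂ (f y) h

/-- The point of `S² ⊆ ℝ³` attached to homogeneous coordinates `[z₀ : z₁]`. In terms of
`ζ = z₁ / z₀` it is `(1 - |ζ|², 2 Re ζ, 2 Im ζ) / (1 + |ζ|²)`. -/
def sphereCoord (z : Fin 2 → ℂ) : Fin 3 → ℝ :=
  ![(Complex.normSq (z 0) - Complex.normSq (z 1)) / (Complex.normSq (z 0) + Complex.normSq (z 1)),
    2 * (starRingEnd ℂ (z 0) * z 1).re / (Complex.normSq (z 0) + Complex.normSq (z 1)),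
    2 * (starRingEnd ℂ (z 0) * z 1).im / (Complex.normSq (z 0) + Complex.normSq (z 1))]

theorem sphereCoord_smul (c : ℂ) (hc : c ≠ 0) (z : Fin 2 → ℂ) :
    sphereCoord (c • z) = sphereCoord z := by
  have hn : Complex.normSq c ≠ 0 := by simpa using hc
  have h1 : starRingEnd ℂ (c * z 0) * (c * z 1)
      = (Complex.normSq c : ℂ) * (starRingEnd ℂ (z 0) * z 1) := by
    rw [Complex.normSq_eq_conj_mul_self, map_mul]
    ring
  have h2 : Complex.normSq (c * z 0) + Complex.normSq (c * z 1)
      = Complex.normSq c * (Complex.normSq (z 0) + Complex.normSq (z 1)) := by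
    simp only [Complex.normSq_mul]
    ring
  have h3 : Complex.normSq (c * z 0) - Complex.normSq (c * z 1)
      = Complex.normSq c * (Complex.normSq (z 0) - Complex.normSq (z 1)) := by
    simp only [Complex.normSq_mul]
    ring
  simp only [sphereCoord, Pi.smul_apply, smul_eq_mul, h1, h2, h3, Complex.re_ofReal_mul,
    Complex.im_ofReal_mul, mul_left_comm (2 : ℝ), mul_div_mul_left _ _ hn]

/-- The identification `ℂℙ¹ = S²`, `l ↦ (a, b, c)`. It is biholomorphic when `S²` carries its
canonical complex structure `j_u v = u × v`, for which `a I + b J + c K` varies holomorphically. -/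
def toSphere : CP1 → Fin 3 → ℝ :=
  Projectivization.lift (fun z : {z : Fin 2 → ℂ // z ≠ 0} => sphereCoord z) (by
    rintro ⟨a, ha⟩ ⟨b, hb⟩ t h
    obtain rfl : a = t • b := h
    have ht : t ≠ 0 := by
      rintro rfl
      simp at ha
    exact sphereCoord_smul t ht b)

theorem toSphere_mem (l : CP1) : toSphere l 0 ^ 2 + toSphere l 1 ^ 2 + toSphere l 2 ^ 2 = 1 := by
  induction l using Projectivization.ind with
  | h z hz =>
    have hpos : Complex.normSq (z 0) + Complex.normSq (z 1) ≠ 0 := by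
      intro h0
      have h1 := Complex.normSq_nonneg (z 0)
      have h2 := Complex.normSq_nonneg (z 1)
      apply hz
      funext i
      fin_cases i
      · exact Complex.normSq_eq_zero.mp (show Complex.normSq (z 0) = 0 by linarith)
      · exact Complex.normSq_eq_zero.mp (show Complex.normSq (z 1) = 0 by linarith)
    change sphereCoord z 0 ^ 2 + sphereCoord z 1 ^ 2 + sphereCoord z 2 ^ 2 = 1
    simp only [sphereCoord, Matrix.cons_val]
    field_simp
    simp only [Complex.normSq_apply, Complex.mul_re, Complex.mul_im, Complex.conj_re,
      Complex.conj_im]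
    ring

/-! ### Hyperkähler manifolds and greatly generalized Calabi-Gray manifolds -/

section Hyperkahler

variable (E : Type*) [NormedAddCommGroup E] [NormedSpace ℝ E]
  (M : Type*) [TopologicalSpace M] [ChartedSpace E M] [IsManifold 𝓘(ℝ, E) ∞ M]

variable {E M} in
/-- The complex structure `J` and the Riemannian metric `g` define a Kähler metric: `J` is an
integrable complex structure, `g` is `J`-invariant, and the Kähler form `g(J ·, ·)` is closed. -/
def IsKahler
    (g : ContMDiffRiemannianMetric 𝓘(ℝ, E) ∞ E (fun x : M => TangentSpace 𝓘(ℝ, E) x))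
    (J : ∀ x : M, TangentSpace 𝓘(ℝ, E) x →L[ℝ] TangentSpace 𝓘(ℝ, E) x) : Prop :=
  IsComplexStructure 𝓘(ℝ, E) J ∧
  (∀ (x : M) (v w : TangentSpace 𝓘(ℝ, E) x), g.inner x (J x v) (J x w) = g.inner x v w) ∧
  ∃ θ : ∀ x : M, TangentSpace 𝓘(ℝ, E) x [⋀^Fin 2]→L[ℝ] ℝ,
    (∀ (x : M) (v w : TangentSpace 𝓘(ℝ, E) x), θ x ![v, w] = g.inner x (J x v) w) ∧
    ∀ x : M, formExtDeriv 𝓘(ℝ, E) θ x = 0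

/-- A hyperkähler structure on `M`: a Riemannian metric and three complex structures `I`, `J`, `K`
with `IJK = -1` which define Kähler metrics together with it. -/
structure HyperkahlerStructure where
  g : ContMDiffRiemannianMetric 𝓘(ℝ, E) ∞ E (fun x : M => TangentSpace 𝓘(ℝ, E) x)
  I : ∀ x : M, TangentSpace 𝓘(ℝ, E) x →L[ℝ] TangentSpace 𝓘(ℝ, E) x
  J : ∀ x : M, TangentSpace 𝓘(ℝ, E) x →L[ℝ] TangentSpace 𝓘(ℝ, E) x
  K : ∀ x : M, TangentSpace 𝓘(ℝ, E) x →L[ℝ] TangentSpace 𝓘(ℝ, E) x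
  quaternion : ∀ (x : M) (v : TangentSpace 𝓘(ℝ, E) x), I x (J x (K x v)) = -v
  kahler_I : IsKahler g I
  kahler_J : IsKahler g J
  kahler_K : IsKahler g K

end Hyperkahler

section Twisted

variable {EM : Type*} [NormedAddCommGroup EM] [NormedSpace ℝ EM]
  {M : Type*} [TopologicalSpace M] [ChartedSpace EM M] [IsManifold 𝓘(ℝ, EM) ∞ M]
  {EY : Type*} [NormedAddCommGroup EY] [NormedSpace ℂ EY]
  {Y : Type*} [TopologicalSpace Y] [ChartedSpace EY Y]

/-- The complex structure `(a I + b J + c K)_m ⊕ i` on `T_m M ⊕ T_y Y`, where `(a, b, c)` is the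
point `φ(y)` of `S² = ℂℙ¹`; with it, the product `M × Y` is the pullback by `φ : Y → ℂℙ¹` of the
twistor space of `M`. -/
def twistedStructure (h : HyperkahlerStructure EM M) (φ : Y → CP1) (x : M × Y) :
    TangentSpace (𝓘(ℝ, EM).prod 𝓘(ℝ, EY)) x →L[ℝ] TangentSpace (𝓘(ℝ, EM).prod 𝓘(ℝ, EY)) x :=
  (ContinuousLinearMap.prodMap
    (toSphere (φ x.2) 0 • h.I x.1 + toSphere (φ x.2) 1 • h.J x.1 + toSphere (φ x.2) 2 • h.K x.1 :
      EM →L[ℝ] EM)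
    (complexMul x.2 : EY →L[ℝ] EY) : EM × EY →L[ℝ] EM × EY)

end Twisted

end CalabiGray

end

/-! The proof turns on the forms `Ω_z = z₀² (ω_J + i ω_K) - 2 z₀ z₁ ω_I - z₁² (ω_J - i ω_K)` on `M`,
for `z ∈ ℂ² ∖ 0` (`omega`). Such a form is of type `(2, 0)` for the structure `I_z = a I + b J + c
K` attached to `[z]` (`omega_left`), nondegenerate (`omega_nondegenerate`), closed for fixed `z`
(`fderiv_omega_closed`), and quadratic in `z` (`omega_smul`).

Integrability. A closed nondegenerate form of type `(2, 0)` forces the Nijenhuis tensor to vanish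
(`nijenhuis_eq_zero_of_form`), so each `I_z` is integrable on `M`. On `M × Y` the structure also
varies with `y`. The map to the sphere is holomorphic for the rotation `v ↦ u × v`
(`fderiv_sphereCoord`), and the product of orthogonal imaginary quaternions is their cross product
(`mul_combination`). Hence the derivative of `I_{φ(y)}` in the direction `i u` is `I_{φ(y)}`
composed with the derivative in the direction `u`, which is exactly what cancels the mixed terms
(`nijenhuis_twisted`). The projection is holomorphic and the slices are complex because the
structure is block diagonal.

Canonical bundle. For `t` in the line `φ(y)` and `η` in the fibre of `K_Y` at `y`, the form `Ω_t ^ m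
∧ η` (`twistForm`) is of type `(2m + n, 0)`, where `n = dim Y`. It is nonzero when `t` and `η` are,
as a symplectic basis shows (`exists_symplectic`, `powWedge_ne_zero`), and it is homogeneous of
degree `2m` in `t` and linear in `η`. So `Ω_t ^ m ∧ η ↦ η ⊗ t ^ {2m}` is a well defined isomorphism
of lines (`exists_twistForm_equiv`). It is holomorphic because it carries local holomorphic frames
to local holomorphic frames. If `t` and `η` depend holomorphically on `y`, then `Ω_t ^ m ∧ η` is
closed (`extDeriv_powWedge`): derivatives along `M` vanish since `Ω_t` is closed there, and
derivatives along `Y` produce a form with `n + 1` complex linear slots on an `n`-dimensional space.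

Two further facts make this work with holomorphy of top forms defined by closedness. For a closed
nonvanishing `s` of top type, `d(f s) = df ∧ s` vanishes exactly when `df` is complex linear, so
closed nonvanishing sections are frames (`isHolFormAt_smul_iff`). And complex differentiable
functions of several variables are smooth (`contDiffOn_of_differentiableOn`), which is needed since
local lifts of `φ` are only assumed complex differentiable. -/

noncomputable section

namespace CalabiGray

/-! ### Forms of type `(N, 0)` on a real vector space with a complex structure -/

section ComplexLinear

/-- The complex module structure on a real vector space given by an endomorphism of square `-1`. -/
abbrev complexModule {E : Type*} [AddCommGroup E] [Module ℝ E] (J : E →ₗ[ℝ] E)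
    (hJ : J * J = -1) : Module ℂ E :=
  Module.compHom E (Complex.lift ⟨J, hJ⟩ : ℂ →ₐ[ℝ] Module.End ℝ E).toRingHom

variable {E : Type*} [AddCommGroup E] [Module ℝ E]

theorem complexModule_smul (J : E →ₗ[ℝ] E) (hJ : J * J = -1) (c : ℂ) (v : E) :
    letI := complexModule J hJ
    c • v = c.re • v + c.im • J v := by
  let := complexModule J hJ
  change (Complex.lift ⟨J, hJ⟩ : ℂ →ₐ[ℝ] Module.End ℝ E) c v = _
  simp [Complex.lift, Complex.liftAux_apply, Module.algebraMap_end_apply]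

theorem complexModule_isScalarTower (J : E →ₗ[ℝ] E) (hJ : J * J = -1) :
    letI := complexModule J hJ
    IsScalarTower ℝ ℂ E := by
  let := complexModule J hJ
  refine ⟨fun a c v => ?_⟩
  rw [complexModule_smul, complexModule_smul]
  simp [smul_add, mul_smul]

/-- A real alternating map that is complex linear in each variable, as a complex alternating map. -/
def toComplexAlternating {ι : Type*} (J : E →ₗ[ℝ] E) (hJ : J * J = -1)
    (f : E [⋀^ι]→ₗ[ℝ] ℂ)
    (hf : ∀ [DecidableEq ι] (v : ι → E) (i : ι) (w : E),
      f (Function.update v i (J w)) = Complex.I * f (Function.update v i w)) :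
    letI := complexModule J hJ
    E [⋀^ι]→ₗ[ℂ] ℂ :=
  letI := complexModule J hJ
  { toFun := f
    map_update_add' := f.map_update_add'
    map_update_smul' := by
      intro _ v i c x
      rw [complexModule_smul]
      change f _ = c • f _
      rw [f.map_update_add, f.map_update_smul, f.map_update_smul, hf]
      conv_rhs => rw [← Complex.re_add_im c]
      simp only [Complex.real_smul, smul_eq_mul]
      ring
    map_eq_zero_of_eq' := f.map_eq_zero_of_eq' }

theorem finrank_complexModule [FiniteDimensional ℝ E] (J : E →ₗ[ℝ] E) (hJ : J * J = -1) :
    letI := complexModule J hJ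
    Module.finrank ℝ E = 2 * Module.finrank ℂ E := by
  let := complexModule J hJ
  have := complexModule_isScalarTower J hJ
  rw [← Complex.finrank_real_complex]
  exact (Module.finrank_mul_finrank ℝ ℂ E).symm

theorem finite_complexModule [FiniteDimensional ℝ E] (J : E →ₗ[ℝ] E) (hJ : J * J = -1) :
    letI := complexModule J hJ
    FiniteDimensional ℂ E := by
  let := complexModule J hJ
  have := complexModule_isScalarTower J hJ
  exact Module.Finite.right ℝ ℂ E

/-- An alternating map of type `(k, 0)` vanishes if `k` exceeds the complex dimension. -/
theorem alternating_eq_zero_of_finrank_lt [FiniteDimensional ℝ E] {ι : Type*} [Fintype ι]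
    (J : E →ₗ[ℝ] E) (hJ : J * J = -1) (f : E [⋀^ι]→ₗ[ℝ] ℂ)
    (hf : ∀ [DecidableEq ι] (v : ι → E) (i : ι) (w : E),
      f (Function.update v i (J w)) = Complex.I * f (Function.update v i w))
    (hd : Module.finrank ℝ E < 2 * Fintype.card ι) (v : ι → E) : f v = 0 := by
  let := complexModule J hJ
  have := finite_complexModule J hJ
  rw [finrank_complexModule J hJ] at hd
  change toComplexAlternating J hJ f hf v = 0
  apply AlternatingMap.map_linearDependent
  intro hli
  have := hli.fintype_card_le_finrank
  omega

/-- Two alternating maps of type `(N, 0)`, where `N` is the complex dimension, are proportional. -/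
theorem alternating_proportional [FiniteDimensional ℝ E] {ι : Type*} [Fintype ι]
    (J : E →ₗ[ℝ] E) (hJ : J * J = -1) (f g : E [⋀^ι]→ₗ[ℝ] ℂ)
    (hf : ∀ [DecidableEq ι] (v : ι → E) (i : ι) (w : E),
      f (Function.update v i (J w)) = Complex.I * f (Function.update v i w))
    (hg : ∀ [DecidableEq ι] (v : ι → E) (i : ι) (w : E),
      g (Function.update v i (J w)) = Complex.I * g (Function.update v i w))
    (hd : Module.finrank ℝ E = 2 * Fintype.card ι) (hg0 : g ≠ 0) :
    ∃ c : ℂ, ∀ v, f v = c * g v := by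
  classical
  let := complexModule J hJ
  have := finite_complexModule J hJ
  rw [finrank_complexModule J hJ] at hd
  have hd' : Module.finrank ℂ E = Fintype.card ι := by omega
  let b : Module.Basis ι ℂ E := (Module.finBasisOfFinrankEq ℂ E hd').reindex
    (Fintype.equivFin ι).symm
  have h1 := (toComplexAlternating J hJ f hf).eq_smul_basis_det b
  have h2 := (toComplexAlternating J hJ g hg).eq_smul_basis_det b
  have h1' : ∀ v, f v = f b * b.det v := fun v => congrArg (fun h => h v) h1
  have h2' : ∀ v, g v = g b * b.det v := fun v => congrArg (fun h => h v) h2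
  have hgb : g b ≠ 0 := by
    intro h
    apply hg0
    ext v
    rw [h2' v, h, zero_mul]
    rfl
  refine ⟨f b / g b, fun v => ?_⟩
  rw [h1', h2' v]
  field_simp

end ComplexLinear

/-! ### Alternating sums over permutations -/

section AlternatingSums

open Equiv

/-- The alternating sum of the values of a function of vectors under permutations. -/
def altSum {κ E : Type*} [Fintype κ] [DecidableEq κ] (F : (κ → E) → ℂ) (v : κ → E) : ℂ :=
  ∑ σ : Perm κ, ((Perm.sign σ : ℤ) : ℂ) * F (v ∘ σ)

variable {κ E : Type*} [Fintype κ] [DecidableEq κ]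

theorem altSum_add (F G : (κ → E) → ℂ) (v : κ → E) :
    altSum (fun w => F w + G w) v = altSum F v + altSum G v := by
  simp [altSum, mul_add, Finset.sum_add_distrib]

theorem altSum_sum {τ : Type*} (s : Finset τ) (F : τ → (κ → E) → ℂ) (v : κ → E) :
    altSum (fun w => ∑ t ∈ s, F t w) v = ∑ t ∈ s, altSum (F t) v := by
  simp only [altSum, Finset.mul_sum]
  exact Finset.sum_comm

/-- Reindexing the sum by `σ ↦ σ * ρ` costs the sign of `ρ`, which is its own inverse. -/
theorem altSum_comp_perm (F : (κ → E) → ℂ) (v : κ → E) (ρ : Perm κ) :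
    altSum (fun w => F (w ∘ ρ)) v = ((Perm.sign ρ : ℤ) : ℂ) * altSum F v := by
  simp only [altSum, Finset.mul_sum]
  refine Fintype.sum_equiv (Equiv.mulRight ρ) _ _ fun σ => ?_
  have h : (((Perm.sign ρ : ℤˣ) : ℤ) : ℂ) * (((Perm.sign ρ : ℤˣ) : ℤ) : ℂ) = 1 := by
    rcases Int.units_eq_one_or (Perm.sign ρ) with h | h <;> simp [h]
  simp only [Equiv.coe_mulRight, Perm.sign_mul, Units.val_mul, Int.cast_mul, Perm.coe_mul,
    ← Function.comp_assoc]
  linear_combination (-(((Perm.sign σ : ℤˣ) : ℤ) : ℂ) * F ((v ∘ σ) ∘ ρ)) * h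

/-- If the cyclic sum of `F` over three distinct slots vanishes, so does its alternating sum. -/
theorem altSum_eq_zero_of_cyclic (F : (κ → E) → ℂ) (a b c : κ) (hab : a ≠ b) (hbc : b ≠ c)
    (h : ∀ w : κ → E, F w + F (w ∘ (swap a b * swap b c : Perm κ)) +
      F (w ∘ ((swap a b * swap b c) * (swap a b * swap b c) : Perm κ)) = 0) (v : κ → E) :
    altSum F v = 0 := by
  -- A product of two transpositions is even, so by `altSum_comp_perm` the three terms of the cyclic
  -- sum have the same alternating sum.
  set ρ : Perm κ := swap a b * swap b c
  have hρ : Perm.sign ρ = 1 := by simp [ρ, Perm.sign_swap hab, Perm.sign_swap hbc]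
  have h0 : altSum (fun w => F w + F (w ∘ ρ) + F (w ∘ (ρ * ρ : Perm κ))) v = 0 := by
    exact Finset.sum_eq_zero fun σ _ => mul_eq_zero_of_right _ (h _)
  have hρ2 : Perm.sign (ρ * ρ) = 1 := by rw [Perm.sign_mul, hρ, one_mul]
  rw [altSum_add, altSum_add, altSum_comp_perm, altSum_comp_perm, hρ2, hρ] at h0
  simp only [ Units.val_one, Int.cast_one, one_mul] at h0
  linear_combination h0 / 3

/-- If the alternating sum of `F` over a block of slots vanishes, so does the full alternating
sum. -/
theorem altSum_eq_zero_of_block {κ₁ κ₂ : Type*} [Fintype κ₁] [DecidableEq κ₁] [Fintype κ₂]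
    [DecidableEq κ₂] (F : (κ₁ ⊕ κ₂ → E) → ℂ)
    (h : ∀ (u : κ₁ → E) (w : κ₂ → E), altSum (fun w' => F (Sum.elim u w')) w = 0)
    (v : κ₁ ⊕ κ₂ → E) : altSum F v = 0 := by
  -- Compute one double sum in two ways. Summing first over `τ` gives block sums, which vanish.
  -- Summing first over all permutations, each `τ` contributes `sign τ * sign τ = 1` times `altSum F
  -- v`, so the total is the order of `Perm κ₂` times `altSum F v`.
  have h0 : ∑ τ : Perm κ₂, ((Perm.sign τ : ℤ) : ℂ) *
      altSum (fun w => F (w ∘ (Perm.sumCongr 1 τ : Perm (κ₁ ⊕ κ₂)))) v = 0 := by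
    simp only [altSum, Finset.mul_sum]
    rw [Finset.sum_comm]
    refine Finset.sum_eq_zero fun σ _ => ?_
    have := h ((v ∘ σ) ∘ Sum.inl) ((v ∘ σ) ∘ Sum.inr)
    simp only [altSum] at this
    rw [← mul_zero (((Perm.sign σ : ℤˣ) : ℤ) : ℂ), ← this, Finset.mul_sum]
    refine Finset.sum_congr rfl fun τ _ => ?_
    have : (v ∘ σ) ∘ (Perm.sumCongr 1 τ : Perm (κ₁ ⊕ κ₂)) =
        Sum.elim ((v ∘ σ) ∘ Sum.inl) (((v ∘ σ) ∘ Sum.inr) ∘ τ) := by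
      ext x
      cases x <;> simp
    rw [this]
    ring
  simp only [altSum_comp_perm, Perm.sign_sumCongr, Perm.sign_one, one_mul, ← mul_assoc] at h0
  have hs : ∀ τ : Perm κ₂, (((Perm.sign τ : ℤˣ) : ℤ) : ℂ) * (((Perm.sign τ : ℤˣ) : ℤ) : ℂ) = 1 := by
    intro τ
    rcases Int.units_eq_one_or (Perm.sign τ) with h | h <;> simp [h]
  simp only [hs, one_mul, Finset.sum_const, Finset.card_univ, nsmul_eq_mul] at h0
  rcases mul_eq_zero.mp h0 with h1 | h1
  · exact absurd h1 (by exact_mod_cast Fintype.card_ne_zero)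
  · exact h1

/-- The alternating sum, over more slots than the complex dimension, of a function that is complex
linear in each variable vanishes. -/
theorem altSum_eq_zero_of_finrank_lt [AddCommGroup E] [Module ℝ E] [FiniteDimensional ℝ E]
    (J : E →ₗ[ℝ] E) (hJ : J * J = -1) (F : MultilinearMap ℝ (fun _ : κ => E) ℂ)
    (hF : ∀ (v : κ → E) (i : κ) (w : E),
      F (Function.update v i (J w)) = Complex.I * F (Function.update v i w))
    (hd : Module.finrank ℝ E < 2 * Fintype.card κ) (v : κ → E) : altSum F v = 0 := by
  have hA := MultilinearMap.alternatization_apply F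
  have h := alternating_eq_zero_of_finrank_lt J hJ (MultilinearMap.alternatization F) ?_ hd v
  · rw [MultilinearMap.alternatization_apply] at h
    rw [← h, altSum]
    refine Finset.sum_congr rfl fun σ _ => ?_
    rw [MultilinearMap.domDomCongr_apply, Units.smul_def, zsmul_eq_mul]
    rfl
  · intro inst w i x
    rw [hA, hA, Finset.mul_sum]
    refine Finset.sum_congr rfl fun σ _ => ?_
    rw [MultilinearMap.domDomCongr_apply, MultilinearMap.domDomCongr_apply, mul_smul_comm]
    congr 1
    -- After permuting by `σ`, the modified slot `i` sits in position `σ⁻¹ i`.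
    have key : ∀ y : E, (fun j => Function.update w i y (σ j)) =
        Function.update (fun j => w (σ j)) (σ.symm i) y := by
      intro y
      ext j
      by_cases hj : j = σ.symm i
      · subst hj; simp
      · rw [Function.update_of_ne hj, Function.update_of_ne]
        intro h'
        exact hj (by rw [← h']; simp)
    rw [key, key]
    convert hF (fun j => w (σ j)) (σ.symm i) x

end AlternatingSums

/-! ### Smoothness of maps into spaces of alternating maps -/

section Evaluation

variable {E : Type*} [NormedAddCommGroup E] [NormedSpace ℝ E] [FiniteDimensional ℝ E] {k : ℕ}
  {F : Type*} [NormedAddCommGroup F] [NormedSpace ℝ F] [FiniteDimensional ℝ F]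

/-- An alternating map on a finite dimensional space is a linear function of finitely many of its
values. -/
theorem exists_alternating_eq_of_values :
    ∃ (τ : Type) (_ : Fintype τ) (w : τ → Fin k → E) (L : (τ → F) →L[ℝ] E [⋀^Fin k]→L[ℝ] F),
      ∀ α : E [⋀^Fin k]→L[ℝ] F, α = L (fun t => α (w t)) := by
  let b := Module.finBasis ℝ E
  let ev : (E [⋀^Fin k]→L[ℝ] F) →ₗ[ℝ] ((Fin k → Fin (Module.finrank ℝ E)) → F) :=
    { toFun := fun α t => α (fun i => b (t i))
      map_add' := fun _ _ => rfl
      map_smul' := fun _ _ => rfl }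
  have hev : LinearMap.ker ev = ⊥ := by
    rw [LinearMap.ker_eq_bot]
    intro α β h
    apply ContinuousAlternatingMap.toAlternatingMap_injective
    refine Module.Basis.ext_alternating b fun t _ => ?_
    exact congrFun h t
  obtain ⟨L, hL⟩ := LinearMap.exists_leftInverse_of_injective ev hev
  refine ⟨_, inferInstance, fun t i => b (t i), LinearMap.toContinuousLinearMap L, fun α => ?_⟩
  exact (LinearMap.congr_fun hL α).symm

/-- Reduces regularity of a form valued map to that of its scalar values on fixed vectors, since the
form is a fixed linear function of finitely many of them. -/
theorem contDiffAt_alternating {G : Type*} [NormedAddCommGroup G] [NormedSpace ℝ G]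
    {f : G → E [⋀^Fin k]→L[ℝ] F} {x : G} {r : WithTop ℕ∞}
    (h : ∀ v, ContDiffAt ℝ r (fun y => f y v) x) : ContDiffAt ℝ r f x := by
  obtain ⟨τ, _, w, L, hL⟩ := exists_alternating_eq_of_values (E := E) (k := k) (F := F)
  have : f = fun y => L (fun t => f y (w t)) := funext fun y => hL (f y)
  rw [this]
  exact L.contDiff.contDiffAt.comp x (contDiffAt_pi.2 fun t => h (w t))

theorem differentiableAt_alternating {G : Type*} [NormedAddCommGroup G] [NormedSpace ℝ G]
    {f : G → E [⋀^Fin k]→L[ℝ] F} {x : G}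
    (h : ∀ v, DifferentiableAt ℝ (fun y => f y v) x) : DifferentiableAt ℝ f x := by
  obtain ⟨τ, _, w, L, hL⟩ := exists_alternating_eq_of_values (E := E) (k := k) (F := F)
  have : f = fun y => L (fun t => f y (w t)) := funext fun y => hL (f y)
  rw [this]
  exact L.differentiableAt.comp x (differentiableAt_pi.2 fun t => h (w t))

/-- Evaluation of an alternating map on fixed vectors is smooth. -/
theorem contDiffAt_alternating_apply {E' : Type*} [NormedAddCommGroup E'] [NormedSpace ℝ E']
    {G F : Type*} [NormedAddCommGroup G] [NormedSpace ℝ G]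
    [NormedAddCommGroup F] [NormedSpace ℝ F]
    {f : G → E' [⋀^Fin k]→L[ℝ] F} {x : G} {r : WithTop ℕ∞}
    (h : ContDiffAt ℝ r f x) (v : Fin k → E') : ContDiffAt ℝ r (fun y => f y v) x :=
  (ContinuousAlternatingMap.apply ℝ E' F v).contDiff.contDiffAt.comp x h

end Evaluation

/-! ### The alternating product `B ∧ ⋯ ∧ B ∧ η` -/

section PowWedge

open Equiv

variable {EM EY : Type*} [NormedAddCommGroup EM] [NormedSpace ℝ EM]
  [NormedAddCommGroup EY] [NormedSpace ℝ EY] {m n N : ℕ}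

/-- By injectivity of `g`, the slot `(i, a)` enters only the factor `i` of the product. Isolating
that factor reduces multilinearity and complex linearity of the product to those of `B`. -/
theorem prod_update_pair {m : ℕ} {V W : Type*} (B : V → V → ℂ) (f : W → V) {κ : Type*}
    [DecidableEq κ] (g : Fin m × Fin 2 → κ) (hg : Function.Injective g)
    (v : κ → W) (i : Fin m) (a : Fin 2) (x : W) :
    ∏ k, B (f (Function.update v (g (i, a)) x (g (k, 0))))
        (f (Function.update v (g (i, a)) x (g (k, 1)))) =
      B (f (Function.update v (g (i, a)) x (g (i, 0))))
        (f (Function.update v (g (i, a)) x (g (i, 1)))) *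
      ∏ k ∈ Finset.univ.erase i, B (f (v (g (k, 0)))) (f (v (g (k, 1)))) := by
  rw [← Finset.mul_prod_erase _ _ (Finset.mem_univ i)]
  congr 1
  refine Finset.prod_congr rfl fun k hk => ?_
  have hk' : k ≠ i := Finset.ne_of_mem_erase hk
  rw [Function.update_of_ne, Function.update_of_ne]
  all_goals
    intro h
    have := hg h
    simp_all

/-- The multilinear map `B ⊗ ⋯ ⊗ B ⊗ η` on `EM × EY`. -/
def blockMul (B : EM →L[ℝ] EM →L[ℝ] ℂ) (η : EY [⋀^Fin n]→L[ℝ] ℂ) :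
    ContinuousMultilinearMap ℝ (fun _ : (Fin m × Fin 2) ⊕ Fin n => EM × EY) ℂ where
  toFun v := (∏ i, B (v (.inl (i, 0))).1 (v (.inl (i, 1))).1) * η (fun j => (v (.inr j)).2)
  map_update_add' := by
    intro _ v s x y
    have hinr : ∀ (p : Fin m × Fin 2) (z : EM × EY),
        (fun j : Fin n => (Function.update v (.inl p) z (.inr j)).2) = fun j => (v (.inr j)).2 := by
      intro p z; ext j; simp
    have hinr' : ∀ (q : Fin n) (z : EM × EY),
        (fun j : Fin n => (Function.update v (.inr q) z (.inr j)).2) =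
          Function.update (fun j => (v (.inr j)).2) q z.2 := by
      intro q z; ext j
      by_cases h : j = q
      · subst h; simp
      · simp [h]
    rcases s with ⟨i, a⟩ | q
    · simp only [prod_update_pair (fun a b => B a b) Prod.fst Sum.inl Sum.inl_injective, hinr]
      fin_cases a <;> simp [add_mul]
    · simp only [hinr', ne_eq, reduceCtorEq, not_false_eq_true, Function.update_of_ne,
        Prod.snd_add, ContinuousAlternatingMap.map_update_add, mul_add]
  map_update_smul' := by
    intro _ v s c x
    have hinr : ∀ (p : Fin m × Fin 2) (z : EM × EY),
        (fun j : Fin n => (Function.update v (.inl p) z (.inr j)).2) = fun j => (v (.inr j)).2 := by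
      intro p z; ext j; simp
    have hinr' : ∀ (q : Fin n) (z : EM × EY),
        (fun j : Fin n => (Function.update v (.inr q) z (.inr j)).2) =
          Function.update (fun j => (v (.inr j)).2) q z.2 := by
      intro q z; ext j
      by_cases h : j = q
      · subst h; simp
      · simp [h]
    rcases s with ⟨i, a⟩ | q
    · simp only [prod_update_pair (fun a b => B a b) Prod.fst Sum.inl Sum.inl_injective, hinr]
      fin_cases a <;> simp [mul_assoc]
    · simp only [hinr', ne_eq, reduceCtorEq, not_false_eq_true, Function.update_of_ne,
        Prod.smul_snd, ContinuousAlternatingMap.map_update_smul, mul_smul_comm]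
  cont := by
    refine Continuous.mul (continuous_finsetProd _ fun i _ => ?_) (η.cont.comp (by fun_prop))
    exact (B.continuous.comp (by fun_prop)).clm_apply (by fun_prop)

theorem blockMul_apply (B : EM →L[ℝ] EM →L[ℝ] ℂ) (η : EY [⋀^Fin n]→L[ℝ] ℂ)
    (v : (Fin m × Fin 2) ⊕ Fin n → EM × EY) :
    blockMul B η v =
      (∏ i, B (v (.inl (i, 0))).1 (v (.inl (i, 1))).1) * η (fun j => (v (.inr j)).2) := rfl

/-- The form `B ∧ ⋯ ∧ B ∧ η` on `EM × EY`, up to a constant factor. -/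
def powWedge (e : (Fin m × Fin 2) ⊕ Fin n ≃ Fin N) (B : EM →L[ℝ] EM →L[ℝ] ℂ)
    (η : EY [⋀^Fin n]→L[ℝ] ℂ) : (EM × EY) [⋀^Fin N]→L[ℝ] ℂ :=
  ContinuousMultilinearMap.alternatization ((blockMul B η).domDomCongr e)

variable (e : (Fin m × Fin 2) ⊕ Fin n ≃ Fin N)

theorem powWedge_apply (B : EM →L[ℝ] EM →L[ℝ] ℂ) (η : EY [⋀^Fin n]→L[ℝ] ℂ)
    (v : Fin N → EM × EY) :
    powWedge e B η v = altSum (fun w => blockMul B η (w ∘ e)) v := by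
  rw [powWedge, ContinuousMultilinearMap.alternatization_apply_apply, altSum]
  refine Finset.sum_congr rfl fun σ _ => ?_
  rw [Units.smul_def, zsmul_eq_mul]
  rfl

/-- `B` occurs `m` times in each term and `η` once. Combined with the quadratic dependence of `Ω_t`
on `t`, this is the source of the exponent `2m`. -/
theorem powWedge_smul (c d : ℂ) (B : EM →L[ℝ] EM →L[ℝ] ℂ) (η : EY [⋀^Fin n]→L[ℝ] ℂ) :
    powWedge e (c • B) (d • η) = (c ^ m * d) • powWedge e B η := by
  ext v
  rw [ContinuousAlternatingMap.smul_apply, powWedge_apply, powWedge_apply, altSum, altSum,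
    Finset.smul_sum]
  refine Finset.sum_congr rfl fun σ _ => ?_
  simp only [blockMul_apply, _root_.smul_apply, ContinuousAlternatingMap.smul_apply,
    smul_eq_mul, Finset.prod_mul_distrib, Finset.prod_const, Finset.card_univ, Fintype.card_fin]
  ring

/-- Used to pass to charts: the inverse of a product chart has a block diagonal derivative, which
can therefore be absorbed into `B` and `η` separately. -/
theorem powWedge_comp {EM' EY' : Type*} [NormedAddCommGroup EM'] [NormedSpace ℝ EM']
    [NormedAddCommGroup EY'] [NormedSpace ℝ EY'] (B : EM →L[ℝ] EM →L[ℝ] ℂ)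
    (η : EY [⋀^Fin n]→L[ℝ] ℂ) (f : EM' →L[ℝ] EM) (g : EY' →L[ℝ] EY) :
    (powWedge e B η).compContinuousLinearMap (f.prodMap g) =
      powWedge e (B.bilinearComp f f) (η.compContinuousLinearMap g) := by
  ext v
  simp only [ContinuousAlternatingMap.compContinuousLinearMap_apply, powWedge_apply, altSum]
  rfl

/-- The form `B ∧ ⋯ ∧ B ∧ η` is of type `(N, 0)` if `B` and `η` are complex linear. -/
theorem powWedge_update (B : EM →L[ℝ] EM →L[ℝ] ℂ) (η : EY [⋀^Fin n]→L[ℝ] ℂ)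
    (J : EM → EM) (K : EY → EY)
    (hB₁ : ∀ v w, B (J v) w = Complex.I * B v w) (hB₂ : ∀ v w, B v (J w) = Complex.I * B v w)
    (hη : ∀ (v : Fin n → EY) (i : Fin n),
      η (Function.update v i (K (v i))) = Complex.I * η v)
    (v : Fin N → EM × EY) (i : Fin N) :
    powWedge e B η (Function.update v i (J (v i).1, K (v i).2)) = Complex.I * powWedge e B η v := by
  rw [powWedge_apply, powWedge_apply, altSum, altSum, Finset.mul_sum]
  refine Finset.sum_congr rfl fun σ _ => ?_
  rw [mul_left_comm]
  congr 1
  set w : (Fin m × Fin 2) ⊕ Fin n → EM × EY := (v ∘ σ) ∘ e with hw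
  -- In each term of the alternating sum only one slot of `B ⊗ ⋯ ⊗ B ⊗ η` is changed, namely the one
  -- that `i` is moved to.
  have key : (Function.update v i (J (v i).1, K (v i).2) ∘ σ) ∘ e =
      Function.update w (e.symm (σ.symm i))
        (J (w (e.symm (σ.symm i))).1, K (w (e.symm (σ.symm i))).2) := by
    ext1 j
    by_cases hj : j = e.symm (σ.symm i)
    · subst hj; simp [hw]
    · rw [Function.update_of_ne hj, Function.comp_apply, Function.comp_apply,
        Function.update_of_ne]
      · rfl
      · intro h'
        exact hj (by rw [← h']; simp)
  rw [key]
  generalize e.symm (σ.symm i) = s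
  rw [blockMul_apply, blockMul_apply]
  rcases s with ⟨k, a⟩ | q
  · rw [prod_update_pair (fun a b => B a b) Prod.fst Sum.inl Sum.inl_injective,
      ← Finset.mul_prod_erase Finset.univ
        (fun k => B (w (.inl (k, 0))).1 (w (.inl (k, 1))).1) (Finset.mem_univ k)]
    fin_cases a <;> simp [hB₁, hB₂, mul_assoc]
  · have h2 : (fun j : Fin n => (Function.update w (.inr q) (J (w (.inr q)).1, K (w (.inr q)).2)
        (.inr j)).2) = Function.update (fun j => (w (.inr j)).2) q (K (w (.inr q)).2) := by
      ext j
      by_cases h : j = q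
      · subst h; simp
      · simp [h]
    rw [h2, hη (fun j => (w (.inr j)).2) q]
    simp only [ne_eq, reduceCtorEq, not_false_eq_true, Function.update_of_ne]
    ring

theorem altSum_equiv {κ κ' E : Type*} [Fintype κ] [DecidableEq κ] [Fintype κ'] [DecidableEq κ']
    (ε : κ ≃ κ') (F : (κ → E) → ℂ) (v : κ' → E) :
    altSum (fun w => F (w ∘ ε)) v = altSum F (v ∘ ε) := by
  simp only [altSum]
  refine Fintype.sum_equiv (ε.symm.permCongr) _ _ fun σ => ?_
  rw [Equiv.Perm.sign_permCongr]
  congr 2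
  ext x
  simp [Equiv.permCongr_apply]

/-- The alternating sum does not vanish for a symplectic basis of the first factor. -/
theorem powWedge_ne_zero (B : EM →L[ℝ] EM →L[ℝ] ℂ) (η : EY [⋀^Fin n]→L[ℝ] ℂ) (hη : η ≠ 0)
    (b : Fin m × Fin 2 → EM)
    (hb : ∀ p q, B (b p) (b q) = if p.1 = q.1 then ((q.2 : ℕ) : ℂ) - ((p.2 : ℕ) : ℂ) else 0) :
    powWedge e B η ≠ 0 := by
  obtain ⟨y, hy⟩ : ∃ y, η y ≠ 0 := by
    by_contra! h
    exact hη (by ext v; exact h v)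
  -- The test vectors: the symplectic basis in the first factor, followed by vectors of the second
  -- factor on which `η` does not vanish.
  set w : (Fin m × Fin 2) ⊕ Fin n → EM × EY := Sum.elim (fun p => (b p, 0)) (fun j => (0, y j))
    with hw
  -- No cancellation occurs: every signed term is a nonnegative multiple of `η y`, and the identity
  -- contributes `η y` itself. A permutation with a nonzero term must preserve the two blocks and
  -- map symplectic pairs to symplectic pairs, and then its sign equals the sign of the value.
  have key : ∀ σ : Perm ((Fin m × Fin 2) ⊕ Fin n), ∃ r : ℝ, 0 ≤ r ∧
      ((Perm.sign σ : ℤ) : ℂ) * blockMul B η (w ∘ σ) = r * η y ∧ (σ = 1 → r = 1) := by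
    intro σ
    by_cases hT : blockMul B η (w ∘ σ) = 0
    · refine ⟨0, le_rfl, by simp [hT], ?_⟩
      rintro rfl
      exfalso
      rw [blockMul_apply] at hT
      simp [hw, hb, hy] at hT
    · have hT' := hT
      rw [blockMul_apply, mul_eq_zero, not_or] at hT
      obtain ⟨h1, h2⟩ := hT
      -- A basis vector of `EM` placed in a slot of `η` has zero second component and kills the
      -- term.
      have hinr : ∀ j, ∃ k, σ (.inr j) = .inr k := by
        intro j
        rcases hs : σ (.inr j) with p | k
        · exfalso
          apply h2
          refine η.map_coord_zero j ?_
          simp [hs, hw]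
        · exact ⟨k, rfl⟩
      have hmaps : Set.MapsTo σ (Set.range Sum.inl) (Set.range Sum.inl) := by
        rw [Equiv.Perm.perm_mapsTo_inl_iff_mapsTo_inr]
        rintro _ ⟨j, rfl⟩
        obtain ⟨k, hk⟩ := hinr j
        exact ⟨k, hk.symm⟩
      obtain ⟨⟨σ₁, σ₂⟩, hσ⟩ := Equiv.Perm.mem_sumCongrHom_range_of_perm_mapsTo_inl hmaps
      obtain rfl : σ = Perm.sumCongr σ₁ σ₂ := hσ.symm
      have hfac : ∀ i, B (b (σ₁ (i, 0))) (b (σ₁ (i, 1))) ≠ 0 := by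
        intro i
        have := Finset.prod_ne_zero_iff.mp h1 i (Finset.mem_univ i)
        simpa [hw] using this
      have hfst : ∀ i, (σ₁ (i, 0)).1 = (σ₁ (i, 1)).1 := by
        intro i
        by_contra h
        exact hfac i (by rw [hb, if_neg h])
      have hsnd : ∀ i, (σ₁ (i, 0)).2 ≠ (σ₁ (i, 1)).2 := by
        intro i h
        exact hfac i (by rw [hb, if_pos (hfst i), h, sub_self])
      have hfst' : ∀ i a, (σ₁ (i, a)).1 = (σ₁ (i, 0)).1 := by
        intro i a
        fin_cases a
        · rfl
        · exact (hfst i).symm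
      let ρ₁ : Perm (Fin m) := Equiv.ofBijective (fun i => (σ₁ (i, 0)).1) (by
        rw [← Finite.surjective_iff_bijective]
        intro k
        obtain ⟨⟨i, a⟩, hia⟩ := σ₁.surjective (k, 0)
        exact ⟨i, by change (σ₁ (i, 0)).1 = k; rw [← hfst' i a, hia]⟩)
      let τ : Fin m → Perm (Fin 2) := fun i => Equiv.ofBijective (fun a => (σ₁ (i, a)).2) (by
        rw [← Finite.injective_iff_bijective]
        intro a a' h
        have h' : (σ₁ (i, a)).2 = (σ₁ (i, a')).2 := h
        have : σ₁ (i, a) = σ₁ (i, a') := Prod.ext ((hfst' i a).trans (hfst' i a').symm) h'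
        simpa using this)
      -- `ρ₁` permutes the pairs and `τ i` is the possible flip inside the pair `i`.
      have hσ₁ : σ₁ = prodCongrLeft (fun _ => ρ₁) * prodCongrRight τ := by
        ext1 ⟨i, a⟩
        exact Prod.ext (hfst' i a) rfl
      -- The permutation `ρ₁` acts on two copies of `Fin m`, so its sign enters squared.
      have hsign : Perm.sign σ₁ = ∏ i, Perm.sign (τ i) := by
        rw [hσ₁, Perm.sign_mul, Perm.sign_prodCongrLeft, Perm.sign_prodCongrRight,
          Fin.prod_univ_two, Int.units_mul_self, one_mul]
      -- The standard symplectic form on a pair takes the value `1` or `-1` according to the sign of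
      -- the flip.
      have hε : ∀ ρ : Perm (Fin 2),
          (((ρ 1 : Fin 2) : ℕ) : ℤ) - (((ρ 0 : Fin 2) : ℕ) : ℤ) = (Perm.sign ρ : ℤ) := by
        decide
      have hval : ∀ i, B (b (σ₁ (i, 0))) (b (σ₁ (i, 1))) = ((Perm.sign (τ i) : ℤ) : ℂ) := by
        intro i
        rw [hb, if_pos (hfst i), ← hε (τ i)]
        push_cast
        rfl
      refine ⟨1, zero_le_one, ?_, fun _ => rfl⟩
      have hblock : blockMul B η (w ∘ Perm.sumCongr σ₁ σ₂) =
          (∏ i, ((Perm.sign (τ i) : ℤ) : ℂ)) * (((Perm.sign σ₂ : ℤ) : ℂ) * η y) := by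
        rw [blockMul_apply]
        congr 1
        · refine Finset.prod_congr rfl fun i _ => ?_
          rw [← hval]
          simp [hw]
        · have : η (y ∘ σ₂) = ((Perm.sign σ₂ : ℤ) : ℂ) * η y := by
            have := η.toAlternatingMap.map_perm y σ₂
            rw [Units.smul_def, zsmul_eq_mul] at this
            exact this
          rw [← this]
          congr 1
      rw [hblock, Perm.sign_sumCongr, hsign]
      have hsq : ∀ u : ℤˣ, ((u : ℤ) : ℂ) * ((u : ℤ) : ℂ) = 1 := by
        intro u
        rcases Int.units_eq_one_or u with h | h <;> simp [h]
      have hprod : (((∏ i, Perm.sign (τ i) : ℤˣ) : ℤ) : ℂ) = ∏ i, ((Perm.sign (τ i) : ℤ) : ℂ) := by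
        simp
      rw [Units.val_mul, Int.cast_mul, hprod]
      have h3 := hsq (∏ i, Perm.sign (τ i))
      rw [hprod] at h3
      have h4 := hsq (Perm.sign σ₂)
      rw [Complex.ofReal_one, one_mul]
      linear_combination
        (((Perm.sign σ₂ : ℤˣ) : ℤ) : ℂ) * (((Perm.sign σ₂ : ℤˣ) : ℤ) : ℂ) * η y * h3 + η y * h4
  choose r hr0 hr hr1 using key
  intro h0
  have h1 : powWedge e B η (w ∘ e.symm) = ((∑ σ, r σ : ℝ) : ℂ) * η y := by
    rw [powWedge_apply, altSum_equiv e (fun w' => blockMul B η w') (w ∘ e.symm)]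
    have : (w ∘ e.symm) ∘ e = w := by ext1 j; simp
    rw [this, altSum, Complex.ofReal_sum, Finset.sum_mul]
    exact Finset.sum_congr rfl fun σ _ => hr σ
  rw [h0] at h1
  have hpos : 0 < ∑ σ, r σ := by
    refine Finset.sum_pos' (fun σ _ => hr0 σ) ⟨1, Finset.mem_univ _, ?_⟩
    rw [hr1 1 rfl]
    exact one_pos
  refine mul_ne_zero (Complex.ofReal_ne_zero.mpr hpos.ne') hy ?_
  rw [← h1]
  rfl

end PowWedge

/-! ### Closedness of alternating products -/

section Closed

open Equiv

/-- All terms are equal, since the two signs multiply to one. This allows an alternating map to be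
recovered from its alternating sum. -/
theorem altSum_alternating {E : Type*} [NormedAddCommGroup E] [NormedSpace ℝ E] {k : ℕ}
    (α : E [⋀^Fin k]→L[ℝ] ℂ) (v : Fin k → E) :
    altSum (fun w => α w) v = (Fintype.card (Perm (Fin k)) : ℂ) * α v := by
  have hsq : ∀ u : ℤˣ, ((u : ℤ) : ℂ) * ((u : ℤ) : ℂ) = 1 := by
    intro u
    rcases Int.units_eq_one_or u with h | h <;> simp [h]
  rw [altSum, ← nsmul_eq_mul, ← Finset.card_univ, ← Finset.sum_const]
  refine Finset.sum_congr rfl fun σ _ => ?_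
  have := α.toAlternatingMap.map_perm v σ
  rw [Units.smul_def, zsmul_eq_mul] at this
  change α (v ∘ σ) = _ * α v at this
  rw [this, ← mul_assoc, hsq, one_mul]

/-- If the alternating sum of `(u, w) ↦ D u w` vanishes, so does an alternating map which is formed
from the alternating sums of the `D u` like an exterior derivative. -/
theorem alternating_eq_zero_of_altSum {E : Type*} [NormedAddCommGroup E] [NormedSpace ℝ E] {N : ℕ}
    (D : E → (Fin N → E) → ℂ)
    (h : ∀ v : Fin (N + 1) → E, altSum (fun w => D (w 0) (fun j => w j.succ)) v = 0)
    (α : E [⋀^Fin (N + 1)]→L[ℝ] ℂ)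
    (hα : ∀ v, α v = ∑ i : Fin (N + 1), (-1 : ℂ) ^ (i : ℕ) * altSum (D (v i)) (i.removeNth v)) :
        α = 0 := by
  ext v
  have h1 := altSum_alternating α v
  simp only [hα] at h1
  rw [altSum_sum, ← hα] at h1
  -- Alternating the formula for `α` multiplies the left side by `(N + 1)!`; it remains to see that
  -- each summand on the right has zero alternating sum.
  have h2 : ∀ i : Fin (N + 1), altSum (fun w : Fin (N + 1) → E =>
      (-1 : ℂ) ^ (i : ℕ) * altSum (D (w i)) (i.removeNth w)) v = 0 := by
    intro i
    have h3 : ∀ w : Fin (N + 1) → E,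
        (-1 : ℂ) ^ (i : ℕ) * altSum (D (w i)) (i.removeNth w) =
        ∑ σ : Perm (Fin N), (-1 : ℂ) ^ (i : ℕ) * ((Perm.sign σ : ℤ) : ℂ) *
          D (w i) (i.removeNth w ∘ σ) := by
      intro w
      simp only [altSum, Finset.mul_sum, mul_assoc]
    simp only [h3]
    rw [altSum_sum]
    refine Finset.sum_eq_zero fun σ _ => ?_
    -- `ρ` sends `0` to `i` and `j + 1` to `i.succAbove (σ j)`, so it brings the summand with `i`
    -- differentiated and the others permuted by `σ` into the standard form of the hypothesis.
    let ρ : Perm (Fin (N + 1)) :=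
      ((finSuccEquiv N).trans (optionCongr σ)).trans (finSuccEquiv' i).symm
    have h4 := altSum_comp_perm (fun w : Fin (N + 1) → E => D (w 0) (fun j => w j.succ)) v ρ
    rw [h v, mul_zero] at h4
    have h5 : ∀ w : Fin (N + 1) → E, D (w i) (i.removeNth w ∘ σ) =
        D ((w ∘ ρ) 0) (fun j => (w ∘ ρ) j.succ) := by
      intro w
      congr 1
    simp only [h5]
    simp only [altSum] at h4 ⊢
    rw [← mul_zero ((-1 : ℂ) ^ (i : ℕ) * ((Perm.sign σ : ℤ) : ℂ)), ← h4, Finset.mul_sum]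
    exact Finset.sum_congr rfl fun _ _ => by ring
  rw [Finset.sum_eq_zero fun i _ => h2 i] at h1
  have hc : (Fintype.card (Perm (Fin (N + 1))) : ℂ) ≠ 0 := by
    exact_mod_cast Fintype.card_ne_zero
  exact (mul_eq_zero.mp h1.symm).resolve_left hc

theorem hasFDerivAt_prod {𝕜 E : Type*} [NontriviallyNormedField 𝕜] [NormedAddCommGroup E]
    [NormedSpace 𝕜 E] [NormedAlgebra 𝕜 ℂ] {m : ℕ} {g : Fin m → E → ℂ} {g' : Fin m → E →L[𝕜] ℂ}
    {x : E} (hg : ∀ i ∈ Finset.univ, HasFDerivAt (g i) (g' i) x) :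
    HasFDerivAt (fun y => ∏ i, g i y)
      (∑ i, (∏ k ∈ Finset.univ.erase i, g k x) • g' i) x :=
  HasFDerivAt.finsetProd hg

variable {EM EY : Type*} [NormedAddCommGroup EM] [NormedSpace ℝ EM]
  [NormedAddCommGroup EY] [NormedSpace ℂ EY] {m n N : ℕ}

/-- The alternating sum over `n + 1` slots of a holomorphic derivative of a form of type `(n, 0)`
vanishes if `n` is the complex dimension. -/
theorem altSum_smul_eq_zero [FiniteDimensional ℂ EY] (δ : EY [⋀^Fin n]→L[ℝ] ℂ)
    (hδ : ∀ (v : Fin n → EY) (i : Fin n),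
      δ (Function.update v i (Complex.I • v i)) = Complex.I * δ v)
    (hn : Module.finrank ℂ EY < n + 1) (L : EY →L[ℂ] ℂ) (v : Fin (n + 1) → EY) :
    altSum (fun w : Fin (n + 1) → EY => L (w 0) * δ (fun j => w j.succ)) v = 0 := by
  have : FiniteDimensional ℝ EY := FiniteDimensional.complexToReal EY
  -- `L ⊗ δ` is complex linear in each of `n + 1` slots, more than the complex dimension, so its
  -- alternation must vanish.
  let Φ : EY →L[ℝ] ContinuousMultilinearMap ℝ (fun _ : Fin n => EY) ℂ :=
    (L.restrictScalars ℝ).smulRight δ.toContinuousMultilinearMap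
  let F : ContinuousMultilinearMap ℝ (fun _ : Fin (n + 1) => EY) ℂ := Φ.uncurryLeft
  have hF : ∀ w, F w = L (w 0) * δ (fun j => w j.succ) := fun w => rfl
  have hJ : (Complex.I • (LinearMap.id : EY →ₗ[ℂ] EY)).restrictScalars ℝ *
      (Complex.I • (LinearMap.id : EY →ₗ[ℂ] EY)).restrictScalars ℝ = -1 := by
    ext x
    simp [smul_smul]
  have h := altSum_eq_zero_of_finrank_lt _ hJ F.toMultilinearMap ?_ ?_ v
  · exact h
  · intro w i x
    have hx : ((Complex.I • (LinearMap.id : EY →ₗ[ℂ] EY)).restrictScalars ℝ) x = Complex.I • x :=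
      rfl
    rw [hx]
    change F _ = _ * F _
    rw [hF, hF]
    rcases Fin.eq_zero_or_eq_succ i with rfl | ⟨j, rfl⟩
    · simp [mul_assoc]
    · have h1 : ∀ y : EY, (fun k : Fin n => Function.update w j.succ y k.succ) =
          Function.update (fun k => w k.succ) j y := by
        intro y
        ext k
        by_cases hk : k = j
        · subst hk; simp
        · rw [Function.update_of_ne hk, Function.update_of_ne]
          simpa using hk
      have h2 := hδ (Function.update (fun k => w k.succ) j x) j
      simp only [Function.update_self, Function.update_idem] at h2
      rw [h1, h1, h2, Function.update_of_ne (Fin.succ_ne_zero j).symm,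
        Function.update_of_ne (Fin.succ_ne_zero j).symm]
      ring
  · have h1 : Module.finrank ℝ EY = 2 * Module.finrank ℂ EY := finrank_real_of_complex EY
    rw [h1, Fintype.card_fin]
    omega

theorem differentiableAt_blockMul {B : EM × EY → EM →L[ℝ] EM →L[ℝ] ℂ} {x : EM × EY}
    (hB : DifferentiableAt ℝ B x) {h : EY → ℂ} (hh : DifferentiableAt ℂ h x.2)
    (δ : EY [⋀^Fin n]→L[ℝ] ℂ) (w : (Fin m × Fin 2) ⊕ Fin n → EM × EY) :
    DifferentiableAt ℝ (fun y => blockMul (B y) (h y.2 • δ) w) x := by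
  have h1 : DifferentiableAt ℝ (fun y : EM × EY => h y.2) x :=
    (hh.restrictScalars ℝ).comp x differentiableAt_snd
  have h2 : ∀ a b, DifferentiableAt ℝ (fun y => B y a b) x := fun a b =>
    (hB.clm_apply (differentiableAt_const a)).clm_apply (differentiableAt_const b)
  simp only [blockMul_apply, ContinuousAlternatingMap.smul_apply, smul_eq_mul]
  refine DifferentiableAt.mul ?_ (h1.mul (differentiableAt_const _))
  exact (hasFDerivAt_prod fun i _ => (h2 _ _).hasFDerivAt).differentiableAt

variable [FiniteDimensional ℝ EM] [FiniteDimensional ℂ EY]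
  (e : (Fin m × Fin 2) ⊕ Fin n ≃ Fin N)

theorem differentiableAt_powWedge {B : EM × EY → EM →L[ℝ] EM →L[ℝ] ℂ} {x : EM × EY}
    (hB : DifferentiableAt ℝ B x) {h : EY → ℂ} (hh : DifferentiableAt ℂ h x.2)
    (δ : EY [⋀^Fin n]→L[ℝ] ℂ) :
    DifferentiableAt ℝ (fun y => powWedge e (B y) (h y.2 • δ)) x := by
  have : FiniteDimensional ℝ EY := FiniteDimensional.complexToReal EY
  refine differentiableAt_alternating fun v => ?_
  simp only [powWedge_apply, altSum]
  exact DifferentiableAt.fun_sum fun σ _ =>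
    (differentiableAt_blockMul hB hh δ _).const_mul _

/-- The form `B ∧ ⋯ ∧ B ∧ h δ` on `EM × EY` is closed if `B` is closed along `EM` and holomorphic
along `EY`, `h` is holomorphic and `δ` is of type `(n, 0)`, where `n` is the dimension of `EY`. -/
theorem extDeriv_powWedge {B : EM × EY → EM →L[ℝ] EM →L[ℝ] ℂ} {x : EM × EY}
    (hB : DifferentiableAt ℝ B x)
    (hBM : ∀ u v w : EM, fderiv ℝ B x (u, 0) v w + fderiv ℝ B x (v, 0) w u +
      fderiv ℝ B x (w, 0) u v = 0)
    (hBY : ∀ v w : EM, DifferentiableAt ℂ (fun y => B (x.1, y) v w) x.2)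
    {h : EY → ℂ} (hh : DifferentiableAt ℂ h x.2) (δ : EY [⋀^Fin n]→L[ℝ] ℂ)
    (hδ : ∀ (v : Fin n → EY) (i : Fin n),
      δ (Function.update v i (Complex.I • v i)) = Complex.I * δ v)
    (hn : Module.finrank ℂ EY < n + 1) :
    extDeriv (fun y => powWedge e (B y) (h y.2 • δ)) x = 0 := by
  -- `D u w` is the derivative in the direction `u` of the product before alternation. By
  -- `alternating_eq_zero_of_altSum` it suffices to alternate `D` over all `N + 1` slots, the
  -- direction of differentiation being one of them.
  set D : EM × EY → ((Fin m × Fin 2) ⊕ Fin n → EM × EY) → ℂ :=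
    fun u w => fderiv ℝ (fun y => blockMul (B y) (h y.2 • δ) w) x u with hD
  have hdiff := fun w => differentiableAt_blockMul (m := m) hB hh δ w
  refine alternating_eq_zero_of_altSum (fun u w => D u (w ∘ e)) ?_ _ ?_
  swap
  · intro v
    rw [extDeriv_apply (differentiableAt_powWedge e hB hh δ)]
    refine Finset.sum_congr rfl fun i _ => ?_
    rw [zsmul_eq_mul]
    push_cast
    congr 1
    simp only [powWedge_apply, altSum]
    rw [fderiv_fun_sum fun σ _ => (hdiff _).const_mul _, _root_.sum_apply]
    refine Finset.sum_congr rfl fun σ _ => ?_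
    rw [fderiv_const_mul (hdiff _)]
    rfl
  intro v
  -- pass to the slots of the factors, together with one slot for the differentiation
  let ε : (Fin m × Fin 2) ⊕ Fin (n + 1) ≃ Fin (N + 1) :=
    ((sumCongr (Equiv.refl _) (finSuccEquiv n)).trans
      ((sumCongr (Equiv.refl _) (optionEquivSumPUnit.{0} (Fin n))).trans
        (sumAssoc _ _ _).symm)).trans
      ((sumCongr e (Equiv.refl _)).trans
        ((optionEquivSumPUnit.{0} (Fin N)).symm.trans (finSuccEquiv N).symm))
  have hε0 : ε (.inr 0) = 0 := by simp [ε]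
  have hεl : ∀ p, ε (.inl p) = (e (.inl p)).succ := by intro p; simp [ε]
  have hεr : ∀ j : Fin n, ε (.inr j.succ) = (e (.inr j)).succ := by intro j; simp [ε]
  have htrans : ∀ w : Fin (N + 1) → EM × EY,
      D (w 0) ((fun j : Fin N => w j.succ) ∘ e) =
        (fun w' : (Fin m × Fin 2) ⊕ Fin (n + 1) → EM × EY => D (w' (.inr 0))
          (Sum.elim (fun p => w' (.inl p)) (fun j => w' (.inr j.succ)))) (w ∘ ε) := by
    intro w
    simp only [Function.comp_apply, hε0, hεl, hεr]
    congr 1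
    ext1 (p | j) <;> rfl
  simp only [htrans]
  rw [altSum_equiv ε (fun w' : (Fin m × Fin 2) ⊕ Fin (n + 1) → EM × EY => D (w' (.inr 0))
          (Sum.elim (fun p => w' (.inl p)) (fun j => w' (.inr j.succ))))]
  generalize v ∘ ε = v'
  -- separate the derivatives along the two factors
  have hsplit : ∀ (u : EM × EY) w, D u w = D (u.1, 0) w + D (0, u.2) w := by
    intro u w
    simp only [hD]
    rw [← map_add]
    simp
  rw [show (fun w' : (Fin m × Fin 2) ⊕ Fin (n + 1) → EM × EY => D (w' (.inr 0))
      (Sum.elim (fun p => w' (.inl p)) (fun j => w' (.inr j.succ)))) = fun w' =>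
      D ((w' (.inr 0)).1, 0) (Sum.elim (fun p => w' (.inl p)) (fun j => w' (.inr j.succ))) +
      D (0, (w' (.inr 0)).2) (Sum.elim (fun p => w' (.inl p)) (fun j => w' (.inr j.succ)))
    from funext fun w' => hsplit _ _]
  rw [altSum_add (fun w' : (Fin m × Fin 2) ⊕ Fin (n + 1) → EM × EY => D ((w' (.inr 0)).1, 0)
          (Sum.elim (fun p => w' (.inl p)) (fun j => w' (.inr j.succ))))]
  have hBvw : ∀ a b, DifferentiableAt ℝ (fun y => B y a b) x := fun a b =>
    (hB.clm_apply (differentiableAt_const a)).clm_apply (differentiableAt_const b)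
  have hfB : ∀ a b u, fderiv ℝ (fun y => B y a b) x u = fderiv ℝ B x u a b := by
    intro a b u
    have h1 : HasFDerivAt (fun y => B y a b) _ x :=
      (hB.hasFDerivAt.clm_apply (hasFDerivAt_const a x)).clm_apply (hasFDerivAt_const b x)
    rw [h1.fderiv]
    simp
  -- Along `EM` the derivative falls on one factor `B` at a time. For the factor `i`, rotating the
  -- slot of differentiation and the two slots of that factor gives the cyclic sum in `hBM`, while
  -- all other slots stay fixed.
  have hM : altSum (fun w' : (Fin m × Fin 2) ⊕ Fin (n + 1) → EM × EY => D ((w' (.inr 0)).1, 0)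
      (Sum.elim (fun p => w' (.inl p)) (fun j => w' (.inr j.succ)))) v' = 0 := by
    have hval : ∀ w' : (Fin m × Fin 2) ⊕ Fin (n + 1) → EM × EY, D ((w' (.inr 0)).1, 0)
        (Sum.elim (fun p => w' (.inl p)) (fun j => w' (.inr j.succ))) =
        ∑ i, fderiv ℝ B x ((w' (.inr 0)).1, 0) (w' (.inl (i, 0))).1 (w' (.inl (i, 1))).1 *
          ((∏ k ∈ Finset.univ.erase i, B x (w' (.inl (k, 0))).1 (w' (.inl (k, 1))).1) *
            (h x.2 * δ (fun j => (w' (.inr j.succ)).2))) := by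
      intro w'
      have h1 : HasFDerivAt (fun y : EM × EY => ∏ i, B y (w' (.inl (i, 0))).1 (w' (.inl (i, 1))).1)
          _ x := hasFDerivAt_prod 
            (fun i _ => (hBvw (w' (.inl (i, 0))).1 (w' (.inl (i, 1))).1).hasFDerivAt)
      have h2 : HasFDerivAt (fun y : EM × EY => h y.2 * δ (fun j => (w' (.inr j.succ)).2)) _ x :=
        (((hh.restrictScalars ℝ).hasFDerivAt).comp x hasFDerivAt_snd).mul_const _
      have h3 := (h1.mul h2).fderiv
      simp only [hD, blockMul_apply, ContinuousAlternatingMap.smul_apply, smul_eq_mul,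
        Sum.elim_inl, Sum.elim_inr]
      refine (congrArg (fun L => L ((w' (.inr 0)).1, (0 : EY))) h3).trans ?_
      simp [hfB, Finset.mul_sum]
      refine Finset.sum_congr rfl fun i _ => ?_
      ring
    simp only [hval]
    rw [altSum_sum]
    refine Finset.sum_eq_zero fun i _ => ?_
    refine altSum_eq_zero_of_cyclic _ (.inr 0) (.inl (i, 0)) (.inl (i, 1)) (by simp) (by simp)
      (fun w => ?_) v'
    set c : Perm ((Fin m × Fin 2) ⊕ Fin (n + 1)) :=
      swap (.inr 0) (.inl (i, 0)) * swap (.inl (i, 0)) (.inl (i, 1)) with hc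
    have c0 : c (.inr 0) = .inl (i, 0) := by
      simp [hc, swap_apply_of_ne_of_ne]
    have c1 : c (.inl (i, 0)) = .inl (i, 1) := by
      simp [hc, swap_apply_of_ne_of_ne]
    have c2 : c (.inl (i, 1)) = .inr 0 := by
      simp [hc]
    have c3 : ∀ k a, k ≠ i → c (.inl (k, a)) = .inl (k, a) := by
      intro k a hk
      simp [hc, swap_apply_of_ne_of_ne, hk]
    have c4 : ∀ j : Fin n, c (.inr j.succ) = .inr j.succ := by
      intro j
      simp [hc, swap_apply_of_ne_of_ne]
    have hprod : ∀ ρ : Perm ((Fin m × Fin 2) ⊕ Fin (n + 1)),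
        (∀ k a, k ≠ i → ρ (.inl (k, a)) = .inl (k, a)) →
        ∏ k ∈ Finset.univ.erase i, B x ((w ∘ ρ) (.inl (k, 0))).1 ((w ∘ ρ) (.inl (k, 1))).1 =
          ∏ k ∈ Finset.univ.erase i, B x (w (.inl (k, 0))).1 (w (.inl (k, 1))).1 := by
      intro ρ hρ
      refine Finset.prod_congr rfl fun k hk => ?_
      rw [Function.comp_apply, Function.comp_apply, hρ _ _ (Finset.ne_of_mem_erase hk),
        hρ _ _ (Finset.ne_of_mem_erase hk)]
    rw [hprod c c3, hprod (c * c) (fun k a hk => by rw [Perm.mul_apply, c3 k a hk, c3 k a hk])]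
    simp only [Function.comp_apply, Perm.mul_apply, c0, c1, c2, c4]
    linear_combination ((∏ k ∈ Finset.univ.erase i, B x (w (.inl (k, 0))).1 (w (.inl (k, 1))).1) *
      (h x.2 * δ (fun j => (w (.inr j.succ)).2))) *
      hBM (w (.inr 0)).1 (w (.inl (i, 0))).1 (w (.inl (i, 1))).1
  -- With the arguments of the factors `B` held fixed, the coefficient of `δ` is a holomorphic
  -- function of `y`, so its derivative is complex linear and alternating over the `n + 1` slots of
  -- `EY` alone already gives zero.
  have hY : altSum (fun w' : (Fin m × Fin 2) ⊕ Fin (n + 1) → EM × EY => D (0, (w' (.inr 0)).2)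
      (Sum.elim (fun p => w' (.inl p)) (fun j => w' (.inr j.succ)))) v' = 0 := by
    refine altSum_eq_zero_of_block _ (fun u w => ?_) v'
    have hprod : DifferentiableAt ℂ
        (fun y => (∏ i, B (x.1, y) (u (i, 0)).1 (u (i, 1)).1) * h y) x.2 :=
      (hasFDerivAt_prod fun i _ => (hBY _ _).hasFDerivAt).differentiableAt.mul hh
    have hval : ∀ w' : Fin (n + 1) → EM × EY, D (0, (w' 0).2)
        (Sum.elim (fun p => u p) (fun j => w' j.succ)) =
        (fderiv ℂ (fun y => (∏ i, B (x.1, y) (u (i, 0)).1 (u (i, 1)).1) * h y) x.2) (w' 0).2 *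
          δ (fun j => (w' j.succ).2) := by
      intro w'
      have h1 := (hdiff (Sum.elim (fun p => u p) (fun j => w' j.succ))).hasFDerivAt
      have h2 := HasFDerivAt.comp (f := fun y : EY => (x.1, y)) (x.2 : EY) h1
        ((hasFDerivAt_const (x.1 : EM) (x.2 : EY)).prodMk (hasFDerivAt_id (x.2 : EY)))
      have h3 := (hprod.hasFDerivAt.restrictScalars ℝ).mul_const (δ (fun j => (w' j.succ).2))
      have h4 : (fun y => blockMul (B y) (h y.2 • δ) (Sum.elim (fun p => u p)
          (fun j => w' j.succ))) ∘ (fun y : EY => (x.1, y)) =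
          fun y => (∏ i, B (x.1, y) (u (i, 0)).1 (u (i, 1)).1) * h y *
            δ (fun j => (w' j.succ).2) := by
        ext y
        simp [blockMul_apply, mul_assoc]
      have h5 := congrArg (fun L => L (w' 0).2) (h2.unique (h4 ▸ h3))
      simpa [hD, mul_comm] using h5
    have := altSum_smul_eq_zero δ hδ hn
      (fderiv ℂ (fun y => (∏ i, B (x.1, y) (u (i, 0)).1 (u (i, 1)).1) * h y) x.2)
      (fun j => (w j).2)
    simp only [Sum.elim_inl, Sum.elim_inr, hval]
    exact this
  rw [hM, hY, add_zero]

end Closed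

/-! ### Holomorphic functions of several variables are smooth -/

section Osgood

open Metric MeasureTheory

variable {E : Type*} [NormedAddCommGroup E] [NormedSpace ℂ E]

/-- The derivative of a holomorphic function is locally bounded. -/
theorem exists_fderiv_bound {f : E → ℂ} {U : Set E} (hU : IsOpen U)
    (hf : DifferentiableOn ℂ f U) {x₀ : E} (hx₀ : x₀ ∈ U) :
    ∃ r > 0, ball x₀ r ⊆ U ∧ ∃ C, ∀ x ∈ ball x₀ r, ‖fderiv ℂ f x‖ ≤ C := by
  have hc : ContinuousAt f x₀ := (hf.differentiableAt (hU.mem_nhds hx₀)).continuousAt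
  have h1 : ∀ᶠ x in 𝓝 x₀, x ∈ U ∧ f x ∈ ball (f x₀) 1 :=
    Filter.Eventually.and (hU.mem_nhds hx₀) (hc (ball_mem_nhds _ one_pos))
  obtain ⟨r, hr, hb⟩ := Metric.eventually_nhds_iff_ball.mp h1
  refine ⟨r / 2, half_pos hr, fun x hx => (hb x (ball_subset_ball (by linarith) hx)).1,
    2 / (r / 2), fun x hx => ?_⟩
  have hsub : ball x (r / 2) ⊆ ball x₀ r := by
    intro y hy
    rw [mem_ball] at *
    linarith [dist_triangle y x x₀]
  -- Cauchy's estimate on a ball of radius `r / 2`. Its points and its centre all have values within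
  -- `1` of `f x₀`, hence within `2` of each other.
  refine Complex.norm_fderiv_le_div_of_mapsTo_ball (R₂ := 2)
    (hf.mono fun y hy => (hb y (hsub hy)).1) (fun y hy => ?_) (half_pos hr)
  have h2 := (hb y (hsub hy)).2
  have h3 := (hb x (hsub (mem_ball_self (half_pos hr)))).2
  rw [mem_ball] at h2 h3
  rw [mem_closedBall]
  linarith [dist_triangle_right (f y) (f x) (f x₀)]

variable [FiniteDimensional ℂ E]

/-- The directional derivative is a Cauchy integral of `f` over a circle in the complex line through
`x` in the direction `v`. The circle has a fixed radius for `x` near `x₀`, so the integral can be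
differentiated under the integral sign, with domination by `exists_fderiv_bound`. -/
theorem differentiableOn_fderiv_apply {f : E → ℂ} {U : Set E} (hU : IsOpen U)
    (hf : DifferentiableOn ℂ f U) (v : E) :
    DifferentiableOn ℂ (fun x => fderiv ℂ f x v) U := by
  intro x₀ hx₀
  apply DifferentiableAt.differentiableWithinAt
  have : ProperSpace E := FiniteDimensional.proper ℂ E
  borelize E
  obtain ⟨r, hr, hrU, C, hC⟩ := exists_fderiv_bound hU hf hx₀
  -- The circle is small enough for the lines through points of the half ball to stay in the ball of
  -- radius `r`. The `+ 1` in the denominator covers `v = 0`.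
  obtain ⟨ρ, hρ, hρv⟩ : ∃ ρ > 0, ρ * ‖v‖ < r / 2 := by
    refine ⟨r / 2 / (‖v‖ + 1), by positivity, ?_⟩
    rw [div_mul_eq_mul_div, div_lt_iff₀ (by positivity)]
    nlinarith [norm_nonneg v]
  have hmem : ∀ x ∈ ball x₀ (r / 2), ∀ z : ℂ, ‖z‖ ≤ ρ → x + z • v ∈ ball x₀ r := by
    intro x hx z hz
    rw [mem_ball, dist_eq_norm] at *
    have h1 : ‖z • v‖ ≤ ρ * ‖v‖ := by
      rw [norm_smul]
      exact mul_le_mul_of_nonneg_right hz (norm_nonneg v)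
    calc ‖x + z • v - x₀‖ = ‖(x - x₀) + z • v‖ := by congr 1; abel
      _ ≤ ‖x - x₀‖ + ‖z • v‖ := norm_add_le _ _
      _ < r := by linarith
  have hint : ∀ x ∈ ball x₀ (r / 2), fderiv ℂ f x v = (2 * Real.pi * Complex.I : ℂ)⁻¹ •
      ∮ z in C(0, ρ), ((z - 0) ^ 2)⁻¹ • f (x + z • v) := by
    intro x hx
    have hline : ∀ z : ℂ, HasDerivAt (fun z : ℂ => x + z • v) v z := fun z => by
      simpa using ((hasDerivAt_id z).smul_const v).const_add x
    have hopen : IsOpen {z : ℂ | x + z • v ∈ U} := hU.preimage (by fun_prop)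
    rw [Complex.two_pi_I_inv_smul_circleIntegral_sub_sq_inv_smul_of_differentiable hopen
      (f := fun z => f (x + z • v)) (w₀ := 0)]
    · have h1 : HasFDerivAt f (fderiv ℂ f x) (x + (0 : ℂ) • v) := by
        rw [zero_smul, add_zero]
        exact (hf.differentiableAt (hU.mem_nhds
          (hrU (ball_subset_ball (by linarith) hx)))).hasFDerivAt
      exact ((h1.comp_hasDerivAt (0 : ℂ) (hline 0)).deriv).symm
    · intro z hz
      exact hrU (hmem x hx z (by simpa using hz))
    · intro z hz
      exact ((hf.differentiableAt (hU.mem_nhds hz)).comp z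
        (hline z).differentiableAt).differentiableWithinAt
    · exact mem_ball_self hρ
  have hx₀' : ball x₀ (r / 2) ∈ 𝓝 x₀ := ball_mem_nhds _ (half_pos hr)
  suffices h : DifferentiableAt ℂ (fun x => ∮ z in C(0, ρ), ((z - 0) ^ 2)⁻¹ • f (x + z • v)) x₀ by
    refine (h.const_smul (2 * Real.pi * Complex.I : ℂ)⁻¹).congr_of_eventuallyEq ?_
    filter_upwards [hx₀'] with x hx using hint x hx
  have hnorm : ∀ θ, ‖circleMap 0 ρ θ‖ ≤ ρ := fun θ => by
    simp [abs_of_pos hρ]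
  have hk : Continuous fun θ : ℝ => deriv (circleMap 0 ρ) θ * ((circleMap 0 ρ θ - 0) ^ 2)⁻¹ := by
    simp only [deriv_circleMap, sub_zero]
    refine Continuous.mul (by fun_prop) (Continuous.inv₀ (by fun_prop) fun θ => ?_)
    exact pow_ne_zero 2 (circleMap_ne_center hρ.ne')
  have hcont : ∀ x ∈ ball x₀ (r / 2), Continuous fun θ : ℝ => f (x + circleMap 0 ρ θ • v) := by
    intro x hx
    refine (hf.continuousOn.mono hrU).comp_continuous (by fun_prop) fun θ => hmem x hx _ (hnorm θ)
  simp only [circleIntegral, smul_eq_mul, ← mul_assoc]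
  refine (intervalIntegral.hasFDerivAt_integral_of_dominated_of_fderiv_le (μ := volume)
    (F := fun x θ => deriv (circleMap 0 ρ) θ * ((circleMap 0 ρ θ - 0) ^ 2)⁻¹ *
      f (x + circleMap 0 ρ θ • v))
    (F' := fun x θ => (deriv (circleMap 0 ρ) θ * ((circleMap 0 ρ θ - 0) ^ 2)⁻¹) •
      fderiv ℂ f (x + circleMap 0 ρ θ • v))
    (bound := fun θ => ‖deriv (circleMap 0 ρ) θ * ((circleMap 0 ρ θ - 0) ^ 2)⁻¹‖ * C)
    hx₀' ?_ ?_ ?_ ?_ ?_ ?_).differentiableAt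
  · filter_upwards [hx₀'] with x hx
    exact (hk.mul (hcont x hx)).aestronglyMeasurable
  · exact (hk.mul (hcont x₀ (mem_ball_self (half_pos hr)))).intervalIntegrable _ _
  -- Continuity of the derivative is not available at this stage; its measurability is enough.
  · refine hk.aestronglyMeasurable.smul (Measurable.aestronglyMeasurable ?_)
    exact (measurable_fderiv ℂ f).comp (Continuous.measurable (by fun_prop))
  · refine Filter.Eventually.of_forall fun θ _ x hx => ?_
    rw [norm_smul]
    exact mul_le_mul_of_nonneg_left (hC _ (hmem x hx _ (hnorm θ))) (norm_nonneg _)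
  · exact (hk.norm.mul continuous_const).intervalIntegrable _ _
  · refine Filter.Eventually.of_forall fun θ _ x hx => ?_
    have h1 : HasFDerivAt f (fderiv ℂ f (x + circleMap 0 ρ θ • v)) (x + circleMap 0 ρ θ • v) :=
      (hf.differentiableAt (hU.mem_nhds (hrU (hmem x hx _ (hnorm θ))))).hasFDerivAt
    have h2 : HasFDerivAt (fun y : E => y + circleMap 0 ρ θ • v) (ContinuousLinearMap.id ℂ E) x :=
      (hasFDerivAt_id x).add_const _
    exact (h1.comp x h2).const_mul _

/-- A holomorphic function on an open subset of a finite dimensional complex space is smooth. -/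
theorem contDiffOn_of_differentiableOn {f : E → ℂ} {U : Set E} (hU : IsOpen U)
    (hf : DifferentiableOn ℂ f U) : ContDiffOn ℂ ∞ f U := by
  rw [contDiffOn_infty]
  intro k
  induction k generalizing f with
  | zero => exact contDiffOn_zero.2 hf.continuousOn
  | succ k ih =>
    have := (contDiffOn_succ_iff_fderiv_of_isOpen (𝕜 := ℂ) (f := f) (n := k) hU).2
      ⟨hf, by simp, contDiffOn_clm_apply.2 fun v => ih (differentiableOn_fderiv_apply hU hf v)⟩
    exact_mod_cast this

end Osgood

/-! ### Tensors in the preferred charts of a manifold without boundary -/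

section Charts

variable {E : Type*} [NormedAddCommGroup E] [NormedSpace ℝ E]
  {H : Type*} [TopologicalSpace H] (I : ModelWithCorners ℝ E H)
  {X : Type*} [TopologicalSpace X] [ChartedSpace H X]

/-- The derivative of the preferred chart at `x₀`. -/
def chartDeriv (x₀ x : X) : TangentSpace I x →L[ℝ] E :=
  mfderiv I 𝓘(ℝ, E) (extChartAt I x₀) x

/-- The derivative of the inverse of the preferred chart at `x₀`. -/
def chartSymmDeriv (x₀ : X) (e : E) : E →L[ℝ] TangentSpace I ((extChartAt I x₀).symm e) :=
  mfderiv 𝓘(ℝ, E) I (extChartAt I x₀).symm e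

variable {I}

section

variable [IsManifold I 1 X] [I.Boundaryless]

theorem chartDeriv_chartSymmDeriv {x₀ : X} {e : E} (he : e ∈ (extChartAt I x₀).target) (v : E) :
    chartDeriv I x₀ ((extChartAt I x₀).symm e) (chartSymmDeriv I x₀ e v) = v := by
  have h := mfderiv_extChartAt_comp_mfderivWithin_extChartAt_symm (I := I) he
  rw [I.range_eq_univ, mfderivWithin_univ] at h
  exact congrArg (fun L : E →L[ℝ] E => L v) h

theorem chartSymmDeriv_chartDeriv {x₀ : X} {e : E} (he : e ∈ (extChartAt I x₀).target)
    (v : TangentSpace I ((extChartAt I x₀).symm e)) :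
    chartSymmDeriv I x₀ e (chartDeriv I x₀ ((extChartAt I x₀).symm e) v) = v := by
  have h := mfderivWithin_extChartAt_symm_comp_mfderiv_extChartAt (I := I) he
  rw [I.range_eq_univ, mfderivWithin_univ] at h
  exact congrArg (fun L : TangentSpace I ((extChartAt I x₀).symm e) →L[ℝ]
    TangentSpace I ((extChartAt I x₀).symm e) => L v) h

theorem chartDeriv_self (x₀ : X) : chartDeriv I x₀ x₀ = ContinuousLinearMap.id ℝ E :=
  mfderiv_extChartAt_self

theorem chartSymmDeriv_self (x₀ : X) :
    (chartSymmDeriv I x₀ (extChartAt I x₀ x₀) : E →L[ℝ] E) = ContinuousLinearMap.id ℝ E := by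
  have h := mfderivWithin_range_extChartAt_symm (I := I) (x := x₀)
  rw [I.range_eq_univ, mfderivWithin_univ] at h
  exact h

theorem chartSymmDeriv_inverse {x₀ : X} {e : E} (he : e ∈ (extChartAt I x₀).target) :
    (chartSymmDeriv I x₀ e).inverse = chartDeriv I x₀ ((extChartAt I x₀).symm e) :=
  ContinuousLinearMap.inverse_eq (ContinuousLinearMap.ext (chartSymmDeriv_chartDeriv he))
    (ContinuousLinearMap.ext (chartDeriv_chartSymmDeriv he))

variable (I) in
/-- A field of endomorphisms of the tangent spaces, in the preferred chart at `x₀`. -/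
def endInChart (A : ∀ x : X, TangentSpace I x →L[ℝ] TangentSpace I x) (x₀ : X) (e : E) :
    E →L[ℝ] E :=
  (chartDeriv I x₀ ((extChartAt I x₀).symm e)).comp
    ((A ((extChartAt I x₀).symm e)).comp (chartSymmDeriv I x₀ e))

theorem endInChart_apply (A : ∀ x : X, TangentSpace I x →L[ℝ] TangentSpace I x) (x₀ : X) (e : E)
    (v : E) : endInChart I A x₀ e v = chartDeriv I x₀ ((extChartAt I x₀).symm e)
      (A ((extChartAt I x₀).symm e) (chartSymmDeriv I x₀ e v)) := rfl

theorem chartSymmDeriv_endInChart (A : ∀ x : X, TangentSpace I x →L[ℝ] TangentSpace I x)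
    {x₀ : X} {e : E} (he : e ∈ (extChartAt I x₀).target) (v : E) :
    chartSymmDeriv I x₀ e (endInChart I A x₀ e v) =
      A ((extChartAt I x₀).symm e) (chartSymmDeriv I x₀ e v) :=
  chartSymmDeriv_chartDeriv he _

theorem endInChart_self (A : ∀ x : X, TangentSpace I x →L[ℝ] TangentSpace I x) (x₀ : X) :
    endInChart I A x₀ (extChartAt I x₀ x₀) = (A x₀ : E →L[ℝ] E) := by
  -- The base point `(extChartAt I x₀).symm (extChartAt I x₀ x₀)` equals `x₀` only propositionally,
  -- so the claim is first stated at a variable point that can be substituted.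
  have key : ∀ x : X, x = x₀ → ∀ S : E →L[ℝ] TangentSpace I x,
      (S : E →L[ℝ] E) = ContinuousLinearMap.id ℝ E →
      ((chartDeriv I x₀ x).comp ((A x).comp S) : E →L[ℝ] E) = (A x₀ : E →L[ℝ] E) := by
    rintro x rfl S hS
    have hS' : S = (ContinuousLinearMap.id ℝ E : E →L[ℝ] TangentSpace I x) := hS
    rw [hS', chartDeriv_self]
    rfl
  exact key _ (extChartAt_to_inv x₀) _ (chartSymmDeriv_self x₀)

/-- The tangent bundle is trivialized near `x₀` by the derivative of the preferred chart. This links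
smoothness in the sense of bundles to plain smoothness of `endInChart`. -/
theorem inCoordinates_tangent (A : ∀ x : X, TangentSpace I x →L[ℝ] TangentSpace I x) {x₀ x : X}
    (hx : x ∈ (extChartAt I x₀).source) :
    ContinuousLinearMap.inCoordinates E (TangentSpace I) E (TangentSpace I) x₀ x x₀ x (A x) =
      endInChart I A x₀ (extChartAt I x₀ x) := by
  have hx' : x ∈ (chartAt H x₀).source := by rwa [extChartAt_source] at hx
  have key : ∀ x' : X, x' = x → ∀ S' : E →L[ℝ] TangentSpace I x', ∀ S : E →L[ℝ] TangentSpace I x,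
      HEq S' S → ((chartDeriv I x₀ x').comp ((A x').comp S') : E →L[ℝ] E) =
        (chartDeriv I x₀ x).comp ((A x).comp S) := by
    rintro x' rfl S' S h
    rw [eq_of_heq h]
  rw [ContinuousLinearMap.inCoordinates, TangentBundle.continuousLinearMapAt_trivializationAt hx',
    TangentBundle.symmL_trivializationAt hx', I.range_eq_univ, mfderivWithin_univ]
  exact (key _ ((extChartAt I x₀).left_inv hx) (chartSymmDeriv I x₀ (extChartAt I x₀ x)) _
    HEq.rfl).symm

end

theorem contMDiffAt_iff_contDiffAt_chart [I.Boundaryless] [IsManifold I ∞ X] {F : Type*}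
    [NormedAddCommGroup F] [NormedSpace ℝ F] {f : X → F} {x₀ : X} :
    ContMDiffAt I 𝓘(ℝ, F) ∞ f x₀ ↔
      ContDiffAt ℝ ∞ (fun e => f ((extChartAt I x₀).symm e)) (extChartAt I x₀ x₀) := by
  constructor
  · intro h
    have := (contMDiffAt_iff.mp h).2
    rw [I.range_eq_univ, contDiffWithinAt_univ] at this
    exact this
  · intro h
    have h1 : ContMDiffAt I 𝓘(ℝ, F) ∞
        ((fun e => f ((extChartAt I x₀).symm e)) ∘ extChartAt I x₀) x₀ :=
      h.contMDiffAt.comp x₀ contMDiffAt_extChartAt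
    refine h1.congr_of_eventuallyEq ?_
    filter_upwards [extChartAt_source_mem_nhds (I := I) x₀] with x hx
    simp only [Function.comp_apply]
    rw [(extChartAt I x₀).left_inv hx]

theorem dFun_eq_fderiv [I.Boundaryless] {f : X → ℂ} {x₀ : X}
    (hf : MDifferentiableAt I 𝓘(ℝ, ℂ) f x₀) (v : E) :
    dFun I f x₀ v = fderiv ℝ (fun e => f ((extChartAt I x₀).symm e)) (extChartAt I x₀ x₀) v := by
  have h : (mfderiv I 𝓘(ℝ, ℂ) f x₀ : E →L[ℝ] ℂ) =
      fderiv ℝ (fun e => f ((extChartAt I x₀).symm e)) (extChartAt I x₀ x₀) := by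
    rw [hf.mfderiv, I.range_eq_univ, fderivWithin_univ]
    rfl
  exact congrArg (fun L : E →L[ℝ] ℂ => L v) h

variable [IsManifold I ∞ X] [I.Boundaryless]

/-- A field of endomorphisms is smooth if it is so in the preferred charts. -/
theorem contMDiffAt_endomorphism_iff [IsManifold I 1 X]
    (A : ∀ x : X, TangentSpace I x →L[ℝ] TangentSpace I x) (x₀ : X) :
    ContMDiffAt I (I.prod 𝓘(ℝ, E →L[ℝ] E)) ∞
      (fun x => TotalSpace.mk' (E →L[ℝ] E)
        (E := fun x : X => TangentSpace I x →L[ℝ] TangentSpace I x) x (A x)) x₀ ↔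
      ContDiffAt ℝ ∞ (endInChart I A x₀) (extChartAt I x₀ x₀) := by
  rw [contMDiffAt_hom_bundle, contMDiffAt_iff_contDiffAt_chart]
  have heq : (fun e => ContinuousLinearMap.inCoordinates E (TangentSpace I) E (TangentSpace I)
      x₀ ((extChartAt I x₀).symm e) x₀ ((extChartAt I x₀).symm e)
        (A ((extChartAt I x₀).symm e))) =ᶠ[𝓝 (extChartAt I x₀ x₀)] endInChart I A x₀ := by
    filter_upwards [extChartAt_target_mem_nhds (I := I) x₀] with e he
    rw [inCoordinates_tangent A ((extChartAt I x₀).map_target he), (extChartAt I x₀).right_inv he]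
  constructor
  · rintro ⟨_, h⟩
    exact h.congr_of_eventuallyEq heq.symm
  · intro h
    exact ⟨contMDiffAt_id, h.congr_of_eventuallyEq heq⟩

end Charts

/-! ### The Nijenhuis tensor in charts -/

section Nijenhuis

variable {E : Type*} [NormedAddCommGroup E] [NormedSpace ℝ E]
  {H : Type*} [TopologicalSpace H] {I : ModelWithCorners ℝ E H}
  {X : Type*} [TopologicalSpace X] [ChartedSpace H X] [IsManifold I 1 X] [I.Boundaryless]

variable (I) in
/-- A vector field in the preferred chart at `x₀`. -/
def vecInChart (V : ∀ x : X, TangentSpace I x) (x₀ : X) (e : E) : E :=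
  chartDeriv I x₀ ((extChartAt I x₀).symm e) (V ((extChartAt I x₀).symm e))

theorem vecInChart_end (A : ∀ x : X, TangentSpace I x →L[ℝ] TangentSpace I x)
    (V : ∀ x : X, TangentSpace I x) {x₀ : X} {e : E} (he : e ∈ (extChartAt I x₀).target) :
    vecInChart I (fun x => A x (V x)) x₀ e = endInChart I A x₀ e (vecInChart I V x₀ e) := by
  rw [vecInChart, vecInChart, endInChart_apply, chartSymmDeriv_chartDeriv he]

/-- The bracket on a manifold is defined by transport to the preferred chart, whose derivative at
its own base point is the identity, so no correction factor remains. -/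
theorem mlieBracket_eq_chart (V W : ∀ x : X, TangentSpace I x) (x₀ : X) :
    VectorField.mlieBracket I V W x₀ =
      (VectorField.lieBracket ℝ (vecInChart I V x₀) (vecInChart I W x₀) (extChartAt I x₀ x₀) :
          E) := by
  have hpull : ∀ V : ∀ x : X, TangentSpace I x,
      (VectorField.mpullbackWithin 𝓘(ℝ, E) I (extChartAt I x₀).symm V (range I) : E → E)
        =ᶠ[𝓝 (extChartAt I x₀ x₀)] vecInChart I V x₀ := by
    intro V
    filter_upwards [extChartAt_target_mem_nhds (I := I) x₀] with e he
    have h := chartSymmDeriv_inverse (I := I) he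
    rw [VectorField.mpullbackWithin_apply, I.range_eq_univ, mfderivWithin_univ]
    exact congrArg (fun L : TangentSpace I ((extChartAt I x₀).symm e) →L[ℝ] E =>
      L (V ((extChartAt I x₀).symm e))) h
  rw [← VectorField.mlieBracketWithin_univ, VectorField.mlieBracketWithin_apply,
    mfderiv_extChartAt_self]
  have h1 : ((extChartAt I x₀).symm ⁻¹' univ ∩ range I) = univ := by simp [I.range_eq_univ]
  rw [h1]
  have h2 := Filter.EventuallyEq.lieBracket_vectorField_eq (𝕜 := ℝ) (hpull V) (hpull W)
  have h3 : ∀ z : E, (ContinuousLinearMap.id ℝ E).inverse z = z := by simp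
  exact (h3 _).trans ((congrFun VectorField.lieBracketWithin_univ _).trans h2)

theorem differentiableAt_vecInChart [IsManifold I ∞ X] [CompleteSpace E]
    {V : ∀ x : X, TangentSpace I x} {x₀ : X}
    (hV : ContMDiffAt I I.tangent ∞ (fun y => (⟨y, V y⟩ : TangentBundle I X)) x₀) :
    DifferentiableAt ℝ (vecInChart I V x₀) (extChartAt I x₀ x₀) := by
  have h1 := (contMDiffAt_totalSpace.mp hV).2
  rw [contMDiffAt_iff_contDiffAt_chart] at h1
  refine (h1.differentiableAt (by simp)).congr_of_eventuallyEq ?_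
  filter_upwards [extChartAt_target_mem_nhds (I := I) x₀] with e he
  have hx : (extChartAt I x₀).symm e ∈ (chartAt H x₀).source := by
    rw [← extChartAt_source (I := I)]
    exact (extChartAt I x₀).map_target he
  have h2 := TangentBundle.continuousLinearMapAt_trivializationAt (I := I) hx
  have h3 : ((trivializationAt E (TangentSpace I) x₀).continuousLinearMapAt ℝ
      ((extChartAt I x₀).symm e)) (V ((extChartAt I x₀).symm e)) = vecInChart I V x₀ e :=
    congrArg (fun L : TangentSpace I ((extChartAt I x₀).symm e) →L[ℝ] E =>
      L (V ((extChartAt I x₀).symm e))) h2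
  rw [← h3, Trivialization.continuousLinearMapAt_apply,
    Trivialization.coe_linearMapAt_of_mem _ (by simpa using hx)]

/-- The Nijenhuis tensor vanishes if it does so when computed from the derivatives of the coordinate
expressions of the almost complex structure. -/
theorem nijenhuisVanishes_of_chart [IsManifold I ∞ X] [CompleteSpace E]
    (A : ∀ x : X, TangentSpace I x →L[ℝ] TangentSpace I x)
    (hsq : ∀ (x : X) (v : TangentSpace I x), A x (A x v) = -v)
    (hA : ∀ x₀, DifferentiableAt ℝ (endInChart I A x₀) (extChartAt I x₀ x₀))
    (hN : ∀ (x₀ : X) (J : E →L[ℝ] E), J = endInChart I A x₀ (extChartAt I x₀ x₀) → ∀ v w : E,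
      fderiv ℝ (endInChart I A x₀) (extChartAt I x₀ x₀) (J v) w
        - fderiv ℝ (endInChart I A x₀) (extChartAt I x₀ x₀) (J w) v
        + J (fderiv ℝ (endInChart I A x₀) (extChartAt I x₀ x₀) w v)
        - J (fderiv ℝ (endInChart I A x₀) (extChartAt I x₀ x₀) v w) = 0) :
    NijenhuisVanishes I A := by
  intro V W x₀ hV hW
  have hV' := differentiableAt_vecInChart hV
  have hW' := differentiableAt_vecInChart hW
  set e₀ := extChartAt I x₀ x₀ with he₀
  set J : E →L[ℝ] E := A x₀ with hJ
  have hJ' : J = endInChart I A x₀ e₀ := (endInChart_self A x₀).symm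
  have hJsq : ∀ u : E, J (J u) = -u := hsq x₀
  have hfd : ∀ V : ∀ x : X, TangentSpace I x, DifferentiableAt ℝ (vecInChart I V x₀) e₀ →
      ∀ u : E, fderiv ℝ (vecInChart I (fun x => A x (V x)) x₀) e₀ u =
        fderiv ℝ (endInChart I A x₀) e₀ u (vecInChart I V x₀ e₀) +
          J (fderiv ℝ (vecInChart I V x₀) e₀ u) := by
    intro V hV u
    have h1 : vecInChart I (fun x => A x (V x)) x₀ =ᶠ[𝓝 e₀]
        fun e => endInChart I A x₀ e (vecInChart I V x₀ e) := by
      filter_upwards [extChartAt_target_mem_nhds (I := I) x₀] with e he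
      exact vecInChart_end A V he
    rw [h1.fderiv_eq, fderiv_clm_apply (hA x₀) hV, ← hJ']
    exact add_comm _ _
  have hval : ∀ V : ∀ x : X, TangentSpace I x,
      vecInChart I (fun x => A x (V x)) x₀ e₀ = J (vecInChart I V x₀ e₀) := by
    intro V
    rw [vecInChart_end A V (mem_extChartAt_target x₀), ← hJ']
  have hgoal : VectorField.lieBracket ℝ (vecInChart I (fun y => A y (V y)) x₀)
        (vecInChart I (fun y => A y (W y)) x₀) e₀
      - J (VectorField.lieBracket ℝ (vecInChart I (fun y => A y (V y)) x₀) (vecInChart I W x₀) e₀)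
      - J (VectorField.lieBracket ℝ (vecInChart I V x₀) (vecInChart I (fun y => A y (W y)) x₀) e₀)
      - VectorField.lieBracket ℝ (vecInChart I V x₀) (vecInChart I W x₀) e₀ = 0 := by
    -- By the product rule the derivatives of `V` and `W` cancel because `J² = -1`; what remains is
    -- tensorial and is the expression in `hN`.
    simp only [VectorField.lieBracket, hfd V hV', hfd W hW', hval, map_sub, map_add, hJsq]
    have := hN x₀ J hJ' (vecInChart I V x₀ e₀) (vecInChart I W x₀ e₀)
    rw [← this]
    abel
  rw [mlieBracket_eq_chart, mlieBracket_eq_chart, mlieBracket_eq_chart, mlieBracket_eq_chart]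
  exact hgoal

end Nijenhuis

/-! ### Two-forms defined by a Riemannian metric, in charts -/

section Kaehler

variable {E : Type*} [NormedAddCommGroup E] [NormedSpace ℝ E]
  {M : Type*} [TopologicalSpace M] [ChartedSpace E M] [IsManifold 𝓘(ℝ, E) ∞ M]

/-- The bilinear form `g(A ·, ·)` in the preferred chart at `x₀`. -/
def formOfEnd (g : ContMDiffRiemannianMetric 𝓘(ℝ, E) ∞ E (fun x : M => TangentSpace 𝓘(ℝ, E) x))
    (A : ∀ x : M, TangentSpace 𝓘(ℝ, E) x →L[ℝ] TangentSpace 𝓘(ℝ, E) x) (x₀ : M) (e : E) :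
    E →L[ℝ] E →L[ℝ] ℝ :=
  ContinuousLinearMap.bilinearComp (E := E) (F := E) (E' := E) (F' := E)
    (g.inner ((extChartAt 𝓘(ℝ, E) x₀).symm e))
    ((A ((extChartAt 𝓘(ℝ, E) x₀).symm e)).comp (chartSymmDeriv 𝓘(ℝ, E) x₀ e))
    (chartSymmDeriv 𝓘(ℝ, E) x₀ e)

theorem formOfEnd_apply
    (g : ContMDiffRiemannianMetric 𝓘(ℝ, E) ∞ E (fun x : M => TangentSpace 𝓘(ℝ, E) x))
    (A : ∀ x : M, TangentSpace 𝓘(ℝ, E) x →L[ℝ] TangentSpace 𝓘(ℝ, E) x) (x₀ : M) (e v w : E) :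
    formOfEnd g A x₀ e v w = g.inner ((extChartAt 𝓘(ℝ, E) x₀).symm e)
      (A ((extChartAt 𝓘(ℝ, E) x₀).symm e) (chartSymmDeriv 𝓘(ℝ, E) x₀ e v))
      (chartSymmDeriv 𝓘(ℝ, E) x₀ e w) := rfl

variable [FiniteDimensional ℝ E]

theorem contDiffAt_clm_of_apply {F G : Type*} [NormedAddCommGroup F] [NormedSpace ℝ F]
    [NormedAddCommGroup G] [NormedSpace ℝ G] {n : WithTop ℕ∞} {f : G → E →L[ℝ] F} {x : G}
    (h : ∀ v, ContDiffAt ℝ n (fun y => f y v) x) : ContDiffAt ℝ n f x := by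
  have hd : Module.finrank ℝ E = Module.finrank ℝ (Fin (Module.finrank ℝ E) → ℝ) :=
    (Module.finrank_fin_fun ℝ).symm
  let e₁ := ContinuousLinearEquiv.ofFinrankEq hd
  let e₂ := (e₁.arrowCongr (1 : F ≃L[ℝ] F)).trans
    (ContinuousLinearEquiv.piRing (Fin (Module.finrank ℝ E)))
  rw [← Function.id_comp f, ← e₂.symm_comp_self]
  exact e₂.symm.contDiff.contDiffAt.comp x (contDiffAt_pi.2 fun i => h _)

theorem contMDiffAt_chart_vector (x₀ : M) (v : E) :
    ContMDiffAt 𝓘(ℝ, E) 𝓘(ℝ, E).tangent ∞ (fun x => (⟨x,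
      (trivializationAt E (TangentSpace 𝓘(ℝ, E)) x₀).symmL ℝ x v⟩ : TangentBundle 𝓘(ℝ, E) M)) x₀ :=
          by
  rw [contMDiffAt_totalSpace]
  refine ⟨contMDiffAt_id, ?_⟩
  refine (contMDiffAt_const (c := v)).congr_of_eventuallyEq ?_
  have hb : (trivializationAt E (TangentSpace 𝓘(ℝ, E)) x₀).baseSet ∈ 𝓝 x₀ :=
    (trivializationAt E (TangentSpace 𝓘(ℝ, E)) x₀).open_baseSet.mem_nhds
      (FiberBundle.mem_baseSet_trivializationAt' x₀)
  filter_upwards [hb] with x hx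
  rw [Trivialization.symmL_apply _ hx]
  rw [Trivialization.apply_mk_symm _ hx]

/-- Smoothness may be tested on pairs of constant coordinate fields, and on these the form is built
from the metric and `A` by smooth bundle operations. -/
theorem contDiffAt_formOfEnd
    (g : ContMDiffRiemannianMetric 𝓘(ℝ, E) ∞ E (fun x : M => TangentSpace 𝓘(ℝ, E) x))
    (A : ∀ x : M, TangentSpace 𝓘(ℝ, E) x →L[ℝ] TangentSpace 𝓘(ℝ, E) x) (x₀ : M)
    (hA : ContMDiffAt 𝓘(ℝ, E) (𝓘(ℝ, E).prod 𝓘(ℝ, E →L[ℝ] E)) ∞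
      (fun x => TotalSpace.mk' (E →L[ℝ] E)
        (E := fun x : M => TangentSpace 𝓘(ℝ, E) x →L[ℝ] TangentSpace 𝓘(ℝ, E) x) x (A x)) x₀) :
    ContDiffAt ℝ ∞ (formOfEnd g A x₀) (extChartAt 𝓘(ℝ, E) x₀ x₀) := by
  refine contDiffAt_clm_of_apply fun v => contDiffAt_clm_of_apply fun w => ?_
  set t := trivializationAt E (TangentSpace 𝓘(ℝ, E) : M → Type _) x₀
  have hv := contMDiffAt_chart_vector x₀ v
  have hw := contMDiffAt_chart_vector x₀ w
  have hAv : ContMDiffAt 𝓘(ℝ, E) 𝓘(ℝ, E).tangent ∞ (fun x => (⟨x, A x (t.symmL ℝ x v)⟩ :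
      TangentBundle 𝓘(ℝ, E) M)) x₀ := ContMDiffAt.clm_bundle_apply hA hv
  have h1 : ContMDiffAt 𝓘(ℝ, E) (𝓘(ℝ, E).prod 𝓘(ℝ)) ∞
      (fun x => TotalSpace.mk' ℝ (E := Bundle.Trivial M ℝ) x
        (g.inner x (A x (t.symmL ℝ x v)) (t.symmL ℝ x w))) x₀ := by
    apply ContMDiffAt.clm_bundle_apply₂ (F₁ := E) (F₂ := E)
    · exact g.contMDiff.contMDiffAt
    · exact hAv
    · exact hw
  have h2 := (contMDiffAt_totalSpace.mp h1).2
  rw [contMDiffAt_iff_contDiffAt_chart] at h2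
  refine h2.congr_of_eventuallyEq ?_
  filter_upwards [extChartAt_target_mem_nhds (I := 𝓘(ℝ, E)) x₀] with e he
  have hx : (extChartAt 𝓘(ℝ, E) x₀).symm e ∈ (chartAt E x₀).source := by
    rw [← extChartAt_source (I := 𝓘(ℝ, E))]
    exact (extChartAt 𝓘(ℝ, E) x₀).map_target he
  have h3 : t.symmL ℝ ((extChartAt 𝓘(ℝ, E) x₀).symm e) = chartSymmDeriv 𝓘(ℝ, E) x₀ e := by
    rw [TangentBundle.symmL_trivializationAt hx, ModelWithCorners.range_eq_univ,
      mfderivWithin_univ, (extChartAt 𝓘(ℝ, E) x₀).right_inv he]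
    rfl
  rw [formOfEnd_apply, ← h3]
  rfl

/-- Closedness of the Kähler form, in the preferred chart. -/
theorem formOfEnd_closed
    (g : ContMDiffRiemannianMetric 𝓘(ℝ, E) ∞ E (fun x : M => TangentSpace 𝓘(ℝ, E) x))
    (A : ∀ x : M, TangentSpace 𝓘(ℝ, E) x →L[ℝ] TangentSpace 𝓘(ℝ, E) x) (hA : IsKahler g A)
    (x₀ : M) (u v w : E) :
    fderiv ℝ (formOfEnd g A x₀) (extChartAt 𝓘(ℝ, E) x₀ x₀) u v w +
      fderiv ℝ (formOfEnd g A x₀) (extChartAt 𝓘(ℝ, E) x₀ x₀) v w u +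
      fderiv ℝ (formOfEnd g A x₀) (extChartAt 𝓘(ℝ, E) x₀ x₀) w u v = 0 := by
  obtain ⟨hcs, -, θ, hθ, hθ0⟩ := hA
  set e₀ := extChartAt 𝓘(ℝ, E) x₀ x₀
  -- The form `θ` comes without a smoothness condition of its own; it inherits one from `g` and `A`,
  -- through which it is determined.
  have hsm := contDiffAt_formOfEnd g A x₀ hcs.smooth.contMDiffAt
  have hd : DifferentiableAt ℝ (formOfEnd g A x₀) e₀ := hsm.differentiableAt (by simp)
  have heq : ∀ (e : E) (z : Fin 2 → E),
      formInChart 𝓘(ℝ, E) θ x₀ e z = formOfEnd g A x₀ e (z 0) (z 1) := by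
    intro e z
    rw [formOfEnd_apply, ← hθ]
    have : (fun i => chartSymmDeriv 𝓘(ℝ, E) x₀ e (z i)) =
        ![chartSymmDeriv 𝓘(ℝ, E) x₀ e (z 0), chartSymmDeriv 𝓘(ℝ, E) x₀ e (z 1)] := by
      ext i
      fin_cases i <;> rfl
    rw [← this]
    rfl
  have hdz : ∀ a b : E, HasFDerivAt (fun e => formOfEnd g A x₀ e a b)
      (((fderiv ℝ (formOfEnd g A x₀) e₀).flip a).flip b) e₀ := by
    intro a b
    have h1 := (hd.hasFDerivAt.clm_apply (hasFDerivAt_const a e₀)).clm_apply (hasFDerivAt_const b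
        e₀)
    refine h1.congr_fderiv ?_
    ext y
    simp
  have hdiff : DifferentiableAt ℝ (formInChart 𝓘(ℝ, E) θ x₀) e₀ := by
    refine differentiableAt_alternating fun z => ?_
    simp only [heq]
    exact (hdz _ _).differentiableAt
  -- The exterior derivative is a sum with signs over removed slots. Antisymmetry of the
  -- differentiated form turns it into the cyclic sum.
  have hanti : ∀ a b y : E, fderiv ℝ (formOfEnd g A x₀) e₀ y a b =
      -fderiv ℝ (formOfEnd g A x₀) e₀ y b a := by
    intro a b y
    have h1 : (fun e => formOfEnd g A x₀ e a b) = fun e => -formOfEnd g A x₀ e b a := by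
      ext e
      have h2 : formInChart 𝓘(ℝ, E) θ x₀ e (![b, a] ∘ Equiv.swap 0 1) =
          -formInChart 𝓘(ℝ, E) θ x₀ e ![b, a] :=
        (formInChart 𝓘(ℝ, E) θ x₀ e).toAlternatingMap.map_swap ![b, a] (i := 0) (j := 1) (by simp)
      rw [heq, heq] at h2
      simpa using h2
    have h4 : HasFDerivAt (fun e => formOfEnd g A x₀ e a b)
        (-((fderiv ℝ (formOfEnd g A x₀) e₀).flip b).flip a) e₀ := by
      rw [h1]
      exact (hdz b a).neg
    have h3 := (hdz a b).unique h4
    simpa using congrArg (fun L => L y) h3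
  have hext := congrArg (fun α : E [⋀^Fin 3]→L[ℝ] ℝ => α ![u, v, w]) (hθ0 x₀)
  have hext' : extDeriv (formInChart 𝓘(ℝ, E) θ x₀) e₀ ![u, v, w] = 0 := hext
  rw [extDeriv_apply hdiff, Fin.sum_univ_three] at hext'
  simp only [heq, (hdz _ _).fderiv] at hext'
  simp [Fin.removeNth, Fin.succAbove] at hext'
  rw [hanti w u v] 
  have := hanti u w v
  linarith

end Kaehler

/-! ### Charts of products and of complex manifolds -/

section ProductCharts

variable {E : Type*} [NormedAddCommGroup E] [NormedSpace ℝ E]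
  {H : Type*} [TopologicalSpace H] {I : ModelWithCorners ℝ E H}
  {X : Type*} [TopologicalSpace X] [ChartedSpace H X] [IsManifold I 1 X] [I.Boundaryless]
  {E' : Type*} [NormedAddCommGroup E'] [NormedSpace ℝ E']
  {H' : Type*} [TopologicalSpace H'] {I' : ModelWithCorners ℝ E' H'}
  {X' : Type*} [TopologicalSpace X'] [ChartedSpace H' X'] [IsManifold I' 1 X'] [I'.Boundaryless]

variable (I) in
/-- The derivative of the preferred chart at `x₀`, as an endomorphism of the model space. -/
def chartJac (x₀ x : X) : E →L[ℝ] E := chartDeriv I x₀ x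

variable (I) in
/-- The derivative of the inverse of the preferred chart at `x₀`, as an endomorphism of the model
space. -/
def chartSymmJac (x₀ : X) (e : E) : E →L[ℝ] E := chartSymmDeriv I x₀ e

theorem chartJac_chartSymmJac {x₀ : X} {e : E} (he : e ∈ (extChartAt I x₀).target) (v : E) :
    chartJac I x₀ ((extChartAt I x₀).symm e) (chartSymmJac I x₀ e v) = v :=
  chartDeriv_chartSymmDeriv he v

theorem chartSymmJac_chartJac {x₀ : X} {e : E} (he : e ∈ (extChartAt I x₀).target) (v : E) :
    chartSymmJac I x₀ e (chartJac I x₀ ((extChartAt I x₀).symm e) v) = v :=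
  chartSymmDeriv_chartDeriv he v

/-- The tangent space at `x` is read in the preferred chart at `x`, so this derivative is that of a
coordinate change. Properties of coordinate changes, such as being a product or being holomorphic,
thus pass to `chartJac`. -/
theorem chartJac_hasFDerivAt {x₀ x : X} (hx : x ∈ (extChartAt I x₀).source) :
    HasFDerivAt (fun e => extChartAt I x₀ ((extChartAt I x).symm e)) (chartJac I x₀ x)
      (extChartAt I x x) := by
  have hd : MDifferentiableAt I 𝓘(ℝ, E) (extChartAt I x₀) x :=
    mdifferentiableAt_extChartAt (by rwa [extChartAt_source] at hx)
  have h := hd.hasMFDerivAt.2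
  rw [I.range_eq_univ] at h
  exact HasFDerivWithinAt.hasFDerivAt_of_univ h

theorem chartJac_prod {x₀ x : X × X'} (hx : x ∈ (extChartAt (I.prod I') x₀).source) :
    chartJac (I.prod I') x₀ x = (chartJac I x₀.1 x.1).prodMap (chartJac I' x₀.2 x.2) := by
  have h := chartJac_hasFDerivAt hx
  rw [extChartAt_prod] at hx
  have h' := HasFDerivAt.prodMap (extChartAt I x.1 x.1, extChartAt I' x.2 x.2)
    (chartJac_hasFDerivAt hx.1) (chartJac_hasFDerivAt hx.2)
  exact h.unique h'

theorem chartSymmJac_prod {x₀ : X × X'} {e : E × E'}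
    (he : e ∈ (extChartAt (I.prod I') x₀).target) :
    chartSymmJac (I.prod I') x₀ e =
      (chartSymmJac I x₀.1 e.1).prodMap (chartSymmJac I' x₀.2 e.2) := by
  have he' := he
  rw [extChartAt_prod] at he'
  refine ContinuousLinearMap.ext fun v => ?_
  have h1 : chartJac (I.prod I') x₀ ((extChartAt (I.prod I') x₀).symm e)
      ((chartSymmJac I x₀.1 e.1).prodMap (chartSymmJac I' x₀.2 e.2) v) = v := by
    rw [chartJac_prod ((extChartAt (I.prod I') x₀).map_target he)]
    exact Prod.ext (chartJac_chartSymmJac he'.1 v.1) (chartJac_chartSymmJac he'.2 v.2)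
  have h2 := chartSymmJac_chartJac he ((chartSymmJac I x₀.1 e.1).prodMap (chartSymmJac I' x₀.2 e.2)
      v)
  rw [h1] at h2
  exact h2

end ProductCharts

/-! ### Holomorphic coordinate changes and complex linearity of chart derivatives -/

section ComplexCharts

variable {E : Type*} [NormedAddCommGroup E] [NormedSpace ℂ E]
  {Y : Type*} [TopologicalSpace Y] [ChartedSpace E Y]

theorem isOpen_coordChange_source (y₀ y₁ : Y) :
    IsOpen ((extChartAt 𝓘(ℝ, E) y₁).target ∩
        (extChartAt 𝓘(ℝ, E) y₁).symm ⁻¹' (extChartAt 𝓘(ℝ, E) y₀).source) :=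
  (continuousOn_extChartAt_symm y₁).isOpen_inter_preimage (isOpen_extChartAt_target y₁)
    (isOpen_extChartAt_source y₀)

variable [IsManifold 𝓘(ℂ, E) ω Y]

/-- Coordinate changes of a complex manifold are holomorphic. -/
theorem contDiffOn_coordChange (y₀ y₁ : Y) :
    ContDiffOn ℂ ω (fun e => extChartAt 𝓘(ℝ, E) y₀ ((extChartAt 𝓘(ℝ, E) y₁).symm e))
      ((extChartAt 𝓘(ℝ, E) y₁).target ∩
        (extChartAt 𝓘(ℝ, E) y₁).symm ⁻¹' (extChartAt 𝓘(ℝ, E) y₀).source) := by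
  have h := HasGroupoid.compatible (G := contDiffGroupoid ω 𝓘(ℂ, E)) (chart_mem_atlas E y₁)
    (chart_mem_atlas E y₀)
  rw [contDiffGroupoid, mem_groupoid_of_pregroupoid] at h
  refine h.1.congr_mono (fun e _ => rfl) ?_
  intro e he
  simpa using he

/-- The coordinate change is holomorphic, and by uniqueness its real derivative is the restriction
of scalars of the complex one. -/
theorem chartJac_complex {y₀ y : Y} (hy : y ∈ (extChartAt 𝓘(ℝ, E) y₀).source) (v : E) :
    chartJac 𝓘(ℝ, E) y₀ y (Complex.I • v) = Complex.I • chartJac 𝓘(ℝ, E) y₀ y v := by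
  have h1 := chartJac_hasFDerivAt hy
  have hmem : extChartAt 𝓘(ℝ, E) y y ∈ ((extChartAt 𝓘(ℝ, E) y).target ∩
        (extChartAt 𝓘(ℝ, E) y).symm ⁻¹' (extChartAt 𝓘(ℝ, E) y₀).source) :=
    ⟨mem_extChartAt_target y, by rw [mem_preimage, extChartAt_to_inv]; exact hy⟩
  have h2 := ((contDiffOn_coordChange y₀ y).differentiableOn (by simp)).differentiableAt
    ((isOpen_coordChange_source y₀ y).mem_nhds hmem)
  rw [h1.unique (h2.hasFDerivAt.restrictScalars ℝ)]
  simp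

theorem chartSymmJac_complex {y₀ : Y} {e : E} (he : e ∈ (extChartAt 𝓘(ℝ, E) y₀).target) (v : E) :
    chartSymmJac 𝓘(ℝ, E) y₀ e (Complex.I • v) = Complex.I • chartSymmJac 𝓘(ℝ, E) y₀ e v := by
  rw [← chartSymmJac_chartJac he (Complex.I • chartSymmJac 𝓘(ℝ, E) y₀ e v),
    chartJac_complex ((extChartAt 𝓘(ℝ, E) y₀).map_target he), chartJac_chartSymmJac he]

theorem endInChart_complexMul {y₀ : Y} {e : E} (he : e ∈ (extChartAt 𝓘(ℝ, E) y₀).target) (v : E) :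
    endInChart 𝓘(ℝ, E) (complexMul (E := E) (Y := Y)) y₀ e v = Complex.I • v := by
  have h1 := chartJac_complex ((extChartAt 𝓘(ℝ, E) y₀).map_target he)
    (chartSymmJac 𝓘(ℝ, E) y₀ e v)
  rw [chartJac_chartSymmJac he] at h1
  exact h1

/-- A holomorphic map in the preferred chart. -/
theorem differentiableAt_chart_of_mdifferentiableOn {F : Type*} [NormedAddCommGroup F]
    [NormedSpace ℂ F] {f : Y → F} {U : Set Y} (hU : IsOpen U)
    (hf : MDifferentiableOn 𝓘(ℂ, E) 𝓘(ℂ, F) f U) (y₀ : Y) {e : E}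
    (he : e ∈ (extChartAt 𝓘(ℝ, E) y₀).target) (heU : (extChartAt 𝓘(ℝ, E) y₀).symm e ∈ U) :
    DifferentiableAt ℂ (fun e => f ((extChartAt 𝓘(ℝ, E) y₀).symm e)) e := by
  have hM : IsManifold 𝓘(ℂ, E) 1 Y := IsManifold.of_le (n := ω) le_top
  have he' : e ∈ (extChartAt 𝓘(ℂ, E) y₀).target := he
  have h1 : MDifferentiableAt 𝓘(ℂ, E) 𝓘(ℂ, E) (extChartAt 𝓘(ℂ, E) y₀).symm e :=
    ((contMDiffOn_extChartAt_symm (n := 1) y₀).mdifferentiableOn (by simp) e he').mdifferentiableAt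
      ((isOpen_extChartAt_target y₀).mem_nhds he')
  have h2 : MDifferentiableAt 𝓘(ℂ, E) 𝓘(ℂ, F) f ((extChartAt 𝓘(ℂ, E) y₀).symm e) :=
    (hf _ heU).mdifferentiableAt (hU.mem_nhds heU)
  exact (h2.comp e h1).differentiableAt

end ComplexCharts

/-! ### The twisted structure in a product chart -/

section TwistedCharts

variable {EM : Type*} [NormedAddCommGroup EM] [NormedSpace ℝ EM]
  {M : Type*} [TopologicalSpace M] [ChartedSpace EM M] [IsManifold 𝓘(ℝ, EM) ∞ M]
  {EY : Type*} [NormedAddCommGroup EY] [NormedSpace ℂ EY]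
  {Y : Type*} [TopologicalSpace Y] [ChartedSpace EY Y] [IsManifold 𝓘(ℂ, EY) ω Y]

theorem endInChart_twistedStructure (h : HyperkahlerStructure EM M) (φ : Y → CP1) {x₀ : M × Y}
    {e : EM × EY} (he : e ∈ (extChartAt (𝓘(ℝ, EM).prod 𝓘(ℝ, EY)) x₀).target) :
    endInChart (𝓘(ℝ, EM).prod 𝓘(ℝ, EY)) (twistedStructure (EY := EY) h φ) x₀ e =
      ContinuousLinearMap.prodMap
        (toSphere (φ ((extChartAt 𝓘(ℝ, EY) x₀.2).symm e.2)) 0 • endInChart 𝓘(ℝ, EM) h.I x₀.1 e.1 +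
          toSphere (φ ((extChartAt 𝓘(ℝ, EY) x₀.2).symm e.2)) 1 • endInChart 𝓘(ℝ, EM) h.J x₀.1 e.1 +
          toSphere (φ ((extChartAt 𝓘(ℝ, EY) x₀.2).symm e.2)) 2 • endInChart 𝓘(ℝ, EM) h.K x₀.1 e.1)
        ((Complex.I • ContinuousLinearMap.id ℂ EY).restrictScalars ℝ) := by
  have he' := he
  rw [extChartAt_prod] at he'
  refine ContinuousLinearMap.ext fun v => ?_
  have h1 : endInChart (𝓘(ℝ, EM).prod 𝓘(ℝ, EY)) (twistedStructure (EY := EY) h φ) x₀ e v =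
      chartJac (𝓘(ℝ, EM).prod 𝓘(ℝ, EY)) x₀ ((extChartAt (𝓘(ℝ, EM).prod 𝓘(ℝ, EY)) x₀).symm e)
        (twistedStructure (EY := EY) h φ ((extChartAt (𝓘(ℝ, EM).prod 𝓘(ℝ, EY)) x₀).symm e)
          (chartSymmJac (𝓘(ℝ, EM).prod 𝓘(ℝ, EY)) x₀ e v)) := rfl
  rw [h1, chartJac_prod ((extChartAt (𝓘(ℝ, EM).prod 𝓘(ℝ, EY)) x₀).map_target he),
    chartSymmJac_prod he]
  refine Prod.ext ?_ (endInChart_complexMul he'.2 v.2)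
  set c := toSphere (φ ((extChartAt 𝓘(ℝ, EY) x₀.2).symm e.2))
  -- Stated for plain endomorphisms of the model space, so that linearity can be used without the
  -- dependent types of the tangent spaces.
  have key : ∀ D A₀ A₁ A₂ S : EM →L[ℝ] EM, D ((c 0 • A₀ + c 1 • A₁ + c 2 • A₂) (S v.1)) =
      c 0 • D (A₀ (S v.1)) + c 1 • D (A₁ (S v.1)) + c 2 • D (A₂ (S v.1)) := by
    intro D A₀ A₁ A₂ S
    simp
  exact key _ _ _ _ _

end TwistedCharts

/-! ### Linear algebra of hyperkähler structures -/

section Quaternionic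

variable {E : Type*} [NormedAddCommGroup E] [NormedSpace ℝ E]

/-- The linear algebra of a hyperkähler structure at a point. -/
structure IsQuaternionic (g : E →L[ℝ] E →L[ℝ] ℝ) (I J K : E →L[ℝ] E) : Prop where
  symm : ∀ v w, g v w = g w v
  pos : ∀ v, v ≠ 0 → 0 < g v v
  sqI : ∀ v, I (I v) = -v
  sqJ : ∀ v, J (J v) = -v
  sqK : ∀ v, K (K v) = -v
  mul : ∀ v, I (J (K v)) = -v
  invI : ∀ v w, g (I v) (I w) = g v w
  invJ : ∀ v w, g (J v) (J w) = g v w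
  invK : ∀ v w, g (K v) (K w) = g v w

namespace IsQuaternionic

variable {g : E →L[ℝ] E →L[ℝ] ℝ} {I J K : E →L[ℝ] E} (q : IsQuaternionic g I J K)
include q

theorem JK (v : E) : J (K v) = I v := by
  have := congrArg I (q.mul v)
  rw [q.sqI, map_neg] at this
  exact neg_injective this

theorem IJ (v : E) : I (J v) = K v := by
  have := q.mul (K v)
  rw [q.sqK, map_neg, map_neg] at this
  exact neg_injective this

theorem KI (v : E) : K (I v) = J v := by
  have := congrArg J (q.JK (I v))
  rw [q.sqJ, q.sqI, map_neg] at this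
  exact neg_injective this

theorem KJ (v : E) : K (J v) = -I v := by rw [← q.IJ, q.sqJ, map_neg]

theorem JI (v : E) : J (I v) = -K v := by rw [← q.KI, q.sqI, map_neg]

theorem IK (v : E) : I (K v) = -J v := by rw [← q.JK, q.sqK, map_neg]

theorem skewI (v w : E) : g (I v) w = -g (I w) v := by
  rw [← q.invI, q.sqI, map_neg, neg_apply, q.symm]

theorem skewJ (v w : E) : g (J v) w = -g (J w) v := by
  rw [← q.invJ, q.sqJ, map_neg, neg_apply, q.symm]

theorem skewK (v w : E) : g (K v) w = -g (K w) v := by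
  rw [← q.invK, q.sqK, map_neg, neg_apply, q.symm]

/-- A product of imaginary quaternions `s` and `t` is `-⟨s, t⟩ + s × t`; orthogonality leaves the
cross product. -/
theorem mul_combination (s t : Fin 3 → ℝ) (h : s 0 * t 0 + s 1 * t 1 + s 2 * t 2 = 0) (v : E) :
    (s 0 • I + s 1 • J + s 2 • K) ((t 0 • I + t 1 • J + t 2 • K) v) =
      ((s 1 * t 2 - s 2 * t 1) • I + (s 2 * t 0 - s 0 * t 2) • J + (s 0 * t 1 - s 1 * t 0) • K) v
          := by
  have h0 : s 0 * t 0 = -(s 1 * t 1 + s 2 * t 2) := by linarith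
  simp only [add_apply, smul_apply, map_add, map_smul, q.sqI, q.sqJ, q.sqK, q.IJ, q.JI, q.JK,
    q.KJ, q.KI, q.IK]
  have : (s 0 * t 0) • v + (s 1 * t 1) • v + (s 2 * t 2) • v = 0 := by
    rw [← add_smul, ← add_smul, h, zero_smul]
  linear_combination (norm := module) (-1 : ℝ) • this

theorem sq_combination (s : Fin 3 → ℝ) (h : s 0 ^ 2 + s 1 ^ 2 + s 2 ^ 2 = 1) (v : E) :
    (s 0 • I + s 1 • J + s 2 • K) ((s 0 • I + s 1 • J + s 2 • K) v) = -v := by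
  simp only [add_apply, smul_apply, map_add, map_smul, q.sqI, q.sqJ, q.sqK, q.IJ, q.JI, q.JK,
    q.KJ, q.KI, q.IK]
  have : (s 0 ^ 2) • v + (s 1 ^ 2) • v + (s 2 ^ 2) • v = v := by
    rw [← add_smul, ← add_smul, h, one_smul]
  linear_combination (norm := module) (-1 : ℝ) • this

end IsQuaternionic

/-- Extension of scalars for the values of a bilinear form. -/
def complexify : (E →L[ℝ] E →L[ℝ] ℝ) →L[ℝ] (E →L[ℝ] E →L[ℝ] ℂ) :=
  ContinuousLinearMap.compL ℝ E (E →L[ℝ] ℝ) (E →L[ℝ] ℂ)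
    (ContinuousLinearMap.compL ℝ E ℝ ℂ Complex.ofRealCLM)

/-- The holomorphic symplectic form `z₀² (ω_J + i ω_K) - 2 z₀ z₁ ω_I - z₁² (ω_J - i ω_K)` attached
to `z ∈ ℂ²`, where `a`, `b`, `c` are the Kähler forms `ω_I`, `ω_J`, `ω_K`. -/
def omega (z : Fin 2 → ℂ) (a b c : E →L[ℝ] E →L[ℝ] ℝ) : E →L[ℝ] E →L[ℝ] ℂ :=
  (z 0 ^ 2 - z 1 ^ 2) • complexify b + (Complex.I * (z 0 ^ 2 + z 1 ^ 2)) • complexify c -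
    (2 * z 0 * z 1) • complexify a

theorem omega_apply (z : Fin 2 → ℂ) (a b c : E →L[ℝ] E →L[ℝ] ℝ) (v w : E) :
    omega z a b c v w = (z 0 ^ 2 - z 1 ^ 2) * b v w + Complex.I * (z 0 ^ 2 + z 1 ^ 2) * c v w -
      2 * z 0 * z 1 * a v w := rfl

theorem omega_smul (r : ℂ) (z : Fin 2 → ℂ) (a b c : E →L[ℝ] E →L[ℝ] ℝ) :
    omega (r • z) a b c = r ^ 2 • omega z a b c := by
  ext v w
  simp only [omega_apply, smul_apply, Pi.smul_apply, smul_eq_mul]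
  ring

/-- The sphere coordinates with denominators cleared, as polynomials in `z` and its conjugate. In
this form the type of `Ω_z` becomes a polynomial identity. -/
theorem sphereCoord_complex {z : Fin 2 → ℂ} (hz : z ≠ 0) :
    z 0 * starRingEnd ℂ (z 0) + z 1 * starRingEnd ℂ (z 1) ≠ 0 ∧
    (z 0 * starRingEnd ℂ (z 0) + z 1 * starRingEnd ℂ (z 1)) * sphereCoord z 0 =
      z 0 * starRingEnd ℂ (z 0) - z 1 * starRingEnd ℂ (z 1) ∧
    (z 0 * starRingEnd ℂ (z 0) + z 1 * starRingEnd ℂ (z 1)) * sphereCoord z 1 =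
      starRingEnd ℂ (z 0) * z 1 + z 0 * starRingEnd ℂ (z 1) ∧
    (z 0 * starRingEnd ℂ (z 0) + z 1 * starRingEnd ℂ (z 1)) * sphereCoord z 2 =
      -Complex.I * (starRingEnd ℂ (z 0) * z 1 - z 0 * starRingEnd ℂ (z 1)) := by
  have hn : z 0 * starRingEnd ℂ (z 0) + z 1 * starRingEnd ℂ (z 1) =
      ((Complex.normSq (z 0) + Complex.normSq (z 1) : ℝ) : ℂ) := by
    rw [Complex.mul_conj, Complex.mul_conj]; push_cast; ring
  have hpos : Complex.normSq (z 0) + Complex.normSq (z 1) ≠ 0 := by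
    intro h0
    have h1 := Complex.normSq_nonneg (z 0)
    have h2 := Complex.normSq_nonneg (z 1)
    apply hz
    funext i
    fin_cases i
    · exact Complex.normSq_eq_zero.mp (show Complex.normSq (z 0) = 0 by linarith)
    · exact Complex.normSq_eq_zero.mp (show Complex.normSq (z 1) = 0 by linarith)
  have hre : ∀ w : ℂ, ((2 * w.re : ℝ) : ℂ) = w + starRingEnd ℂ w := fun w => by
    rw [Complex.add_conj]
  have him : ∀ w : ℂ, ((2 * w.im : ℝ) : ℂ) = -Complex.I * (w - starRingEnd ℂ w) := fun w => by
    rw [Complex.sub_conj]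
    linear_combination ((2 * w.im : ℝ) : ℂ) * Complex.I_mul_I
  rw [hn]
  refine ⟨by exact_mod_cast hpos, ?_, ?_, ?_⟩
  · rw [Complex.mul_conj, Complex.mul_conj, ← Complex.ofReal_mul, ← Complex.ofReal_sub]
    congr 1
    simp only [sphereCoord, Matrix.cons_val]
    field_simp
  · rw [← Complex.ofReal_mul, show (Complex.normSq (z 0) + Complex.normSq (z 1)) * sphereCoord z 1 =
      2 * (starRingEnd ℂ (z 0) * z 1).re by
        simp only [sphereCoord, Matrix.cons_val]
        field_simp, hre]
    simp
  · rw [← Complex.ofReal_mul, show (Complex.normSq (z 0) + Complex.normSq (z 1)) * sphereCoord z 2 =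
      2 * (starRingEnd ℂ (z 0) * z 1).im by
        simp only [sphereCoord, Matrix.cons_val]
        field_simp, him]
    simp

namespace IsQuaternionic

variable {g : E →L[ℝ] E →L[ℝ] ℝ} {I J K : E →L[ℝ] E} (q : IsQuaternionic g I J K)
include q

theorem omega_skew (z : Fin 2 → ℂ) (v w : E) :
    omega z (g.comp I) (g.comp J) (g.comp K) v w = -omega z (g.comp I) (g.comp J) (g.comp K) w v :=
        by
  simp only [omega_apply, ContinuousLinearMap.comp_apply, q.skewI v w, q.skewJ v w, q.skewK v w]
  push_cast
  ring

/-- `Ω_z` is of type `(2, 0)` for the complex structure attached to `[z]`. -/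
theorem omega_left {z : Fin 2 → ℂ} (hz : z ≠ 0) (v w : E) :
    omega z (g.comp I) (g.comp J) (g.comp K)
      ((sphereCoord z 0 • I + sphereCoord z 1 • J + sphereCoord z 2 • K) v) w =
      Complex.I * omega z (g.comp I) (g.comp J) (g.comp K) v w := by
  obtain ⟨hn, h0, h1, h2⟩ := sphereCoord_complex hz
  simp only [omega_apply, ContinuousLinearMap.comp_apply, add_apply, smul_apply, map_add, map_smul,
    q.sqI, q.sqJ, q.sqK, q.IJ, q.JI, q.JK, q.KJ, q.KI, q.IK, map_neg, neg_apply, Complex.real_smul]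
  push_cast
  refine mul_left_cancel₀ hn ?_
  generalize (g v w : ℂ) = G
  generalize (g (I v) w : ℂ) = a
  generalize (g (J v) w : ℂ) = b
  generalize (g (K v) w : ℂ) = c
  -- The identity holds with the conjugates as independent variables. The coefficients of `h0`,
  -- `h1`, `h2` below are the values of `Ω_z` at `(I v, w)`, `(J v, w)` and `(K v, w)`.
  generalize starRingEnd ℂ (z 0) = y0 at *
  generalize starRingEnd ℂ (z 1) = y1 at *
  linear_combination
    (-(z 0 ^ 2 - z 1 ^ 2) * c + Complex.I * (z 0 ^ 2 + z 1 ^ 2) * b + 2 * z 0 * z 1 * G) * h0 +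
    (-(z 0 ^ 2 - z 1 ^ 2) * G - Complex.I * (z 0 ^ 2 + z 1 ^ 2) * a - 2 * z 0 * z 1 * c) * h1 +
    ((z 0 ^ 2 - z 1 ^ 2) * a - Complex.I * (z 0 ^ 2 + z 1 ^ 2) * G + 2 * z 0 * z 1 * b) * h2 +
    ((z 0 ^ 2 + z 1 ^ 2) * G * (y0 * z 1 - z 0 * y1) -
      (z 0 * y0 + z 1 * y1) * (z 0 ^ 2 + z 1 ^ 2) * c) * Complex.I_mul_I

/-- The vectors `I v`, `J v`, `K v` are mutually orthogonal and as long as `v`. Testing against `J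
v` and `K v` gives `z₀² - z₁² = 0` and `z₀² + z₁² = 0` unless `v = 0`. -/
theorem omega_nondegenerate {z : Fin 2 → ℂ} (hz : z ≠ 0) {v : E}
    (h : ∀ w, omega z (g.comp I) (g.comp J) (g.comp K) v w = 0) : v = 0 := by
  by_contra hv
  have hpos : (g v v : ℂ) ≠ 0 := by exact_mod_cast (q.pos v hv).ne'
  have hself : ∀ u, g (I u) u = 0 ∧ g (J u) u = 0 ∧ g (K u) u = 0 := fun u =>
    ⟨by linarith [q.skewI u u], by linarith [q.skewJ u u], by linarith [q.skewK u u]⟩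
  have hJ := h (J v)
  have hK := h (K v)
  have e1 : g (I v) (J v) = 0 := by
    rw [q.skewI, q.IJ, (hself v).2.2, neg_zero]
  have e2 : g (K v) (J v) = 0 := by
    rw [q.skewK, q.KJ, map_neg, neg_apply, (hself v).1, neg_zero, neg_zero]
  have e3 : g (I v) (K v) = 0 := by
    rw [q.skewI, q.IK, map_neg, neg_apply, (hself v).2.1, neg_zero, neg_zero]
  have e4 : g (J v) (K v) = 0 := by
    rw [q.skewJ, q.JK, (hself v).1, neg_zero]
  simp only [omega_apply, ContinuousLinearMap.comp_apply, e1, e2, e3, e4, q.invJ, q.invK,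
    Complex.ofReal_zero, mul_zero, add_zero, zero_add, sub_zero] at hJ hK
  have hJ' := (mul_eq_zero.1 hJ).resolve_right hpos
  have hK' := ((mul_eq_zero.1 hK).resolve_right hpos)
  have hK'' := (mul_eq_zero.1 hK').resolve_left Complex.I_ne_zero
  have z0 : z 0 ^ 2 = 0 := by linear_combination (hJ' + hK'') / 2
  have z1 : z 1 ^ 2 = 0 := by linear_combination (hK'' - hJ') / 2
  apply hz
  funext i
  fin_cases i
  · exact pow_eq_zero_iff (two_ne_zero) |>.1 z0
  · exact pow_eq_zero_iff (two_ne_zero) |>.1 z1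

end IsQuaternionic

/-- A symplectic basis for a complex symplectic form. -/
theorem exists_symplectic [FiniteDimensional ℝ E] {m : ℕ} (hm : Module.finrank ℝ E = 4 * m)
    (A : E →L[ℝ] E) (B : E →L[ℝ] E →L[ℝ] ℂ) (hA : ∀ v w, B v (A w) = Complex.I * B v w)
    (hB : ∀ v w, B v w = -B w v) (hnd : ∀ v, (∀ w, B v w = 0) → v = 0) :
    ∃ b : Fin m × Fin 2 → E, ∀ p q, B (b p) (b q) =
      if p.1 = q.1 then ((q.2 : ℕ) : ℂ) - ((p.2 : ℕ) : ℂ) else 0 := by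
  -- Complex scalars act on vectors through `A`.
  have hsmul : ∀ (c : ℂ) (v w : E), B v (c.re • w + c.im • A w) = c * B v w := by
    intro c v w
    rw [map_add, map_smul, map_smul, hA, Complex.real_smul, Complex.real_smul]
    linear_combination (B v w) * Complex.re_add_im c
  have hself : ∀ v, B v v = 0 := fun v => by
    have := hB v v
    exact self_eq_neg.mp this
  -- Symplectic Gram-Schmidt: the pairs are built one at a time.
  suffices h : ∀ k, k ≤ m → ∃ b : Fin k × Fin 2 → E, ∀ p q, B (b p) (b q) =
      if p.1 = q.1 then ((q.2 : ℕ) : ℂ) - ((p.2 : ℕ) : ℂ) else 0 from h m le_rfl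
  intro k
  induction k with
  | zero => exact fun _ => ⟨fun p => p.1.elim0, fun p => p.1.elim0⟩
  | succ k ih =>
    intro hk
    obtain ⟨b, hb⟩ := ih (by omega)
    let T : E →ₗ[ℝ] (Fin k × Fin 2 → ℂ) :=
      LinearMap.pi fun p => (B (b p) : E →L[ℝ] ℂ).toLinearMap
    -- The orthogonality conditions to `k` pairs take values in a space of real dimension `4 k`,
    -- less than `4 m`, so a nonzero vector `u` orthogonal to all earlier pairs exists.
    have hker : T.ker ≠ ⊥ := by
      apply LinearMap.ker_ne_bot_of_finrank_lt
      rw [hm, Module.finrank_pi_fintype]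
      simp [Complex.finrank_real_complex]
      omega
    obtain ⟨u, hu, hu0⟩ := (Submodule.ne_bot_iff _).1 hker
    have hbu : ∀ p, B (b p) u = 0 := fun p => congrFun hu p
    obtain ⟨w₀, hw₀⟩ : ∃ w, B u w ≠ 0 := by
      by_contra! h
      exact hu0 (hnd u h)
    -- The partner `w₀` of `u` is made orthogonal to the earlier pairs. This does not change `B u
    -- w₀`, as `u` is orthogonal to them; `w₂` is then rescaled so that `B u w₂ = 1`.
    let w₁ : E := w₀ - ∑ i, (((B (b (i, 0)) w₀).re • b (i, 1) + (B (b (i, 0)) w₀).im • A (b (i,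
        1))) -
      ((B (b (i, 1)) w₀).re • b (i, 0) + (B (b (i, 1)) w₀).im • A (b (i, 0))))
    have hw₁ : ∀ v, B v w₁ = B v w₀ - ∑ i, (B (b (i, 0)) w₀ * B v (b (i, 1)) -
        B (b (i, 1)) w₀ * B v (b (i, 0))) := by
      intro v
      simp only [w₁, map_sub, map_sum, hsmul]
    have hbw : ∀ p, B (b p) w₁ = 0 := by
      rintro ⟨i, a⟩
      rw [hw₁, Finset.sum_eq_single i]
      · simp only [hb]
        fin_cases a <;> simp
      · intro j _ hj
        simp [hb, hj.symm]
      · simp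
    have huw : B u w₁ = B u w₀ := by
      rw [hw₁]
      have : ∀ p, B u (b p) = 0 := fun p => by rw [hB, hbu, neg_zero]
      simp [this]
    let w₂ : E := ((B u w₀)⁻¹).re • w₁ + ((B u w₀)⁻¹).im • A w₁
    have huw2 : B u w₂ = 1 := by
      simp only [w₂, hsmul, huw]
      exact inv_mul_cancel₀ hw₀
    have hbw2 : ∀ p, B (b p) w₂ = 0 := fun p => by simp only [w₂, hsmul, hbw, mul_zero]
    refine ⟨fun p => Fin.lastCases (motive := fun _ => E) (if p.2 = 0 then u else w₂) (fun i =>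
        b (i, p.2)) p.1, ?_⟩
    rintro ⟨i, a⟩ ⟨j, c⟩
    induction i using Fin.lastCases with
    | last =>
      induction j using Fin.lastCases with
      | last =>
        fin_cases a <;> fin_cases c <;> simp [hself, huw2, hB w₂ u]
      | cast j =>
        fin_cases a <;> simp [hB _ (b _), hbu, hbw2, (Fin.castSucc_lt_last j).ne']
    | cast i =>
      induction j using Fin.lastCases with
      | last =>
        fin_cases c <;> simp [hbu, hbw2, (Fin.castSucc_lt_last i).ne]
      | cast j => simp [hb]

end Quaternionic

/-! ### Holomorphy of the identification of the projective line with the sphere -/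

section Sphere

variable {E : Type*} [NormedAddCommGroup E] [NormedSpace ℂ E]

theorem normSq_add_pos {z : Fin 2 → ℂ} (hz : z ≠ 0) :
    0 < Complex.normSq (z 0) + Complex.normSq (z 1) := by
  refine lt_of_le_of_ne (add_nonneg (Complex.normSq_nonneg _) (Complex.normSq_nonneg _)) ?_
  intro h0
  have h1 := Complex.normSq_nonneg (z 0)
  have h2 := Complex.normSq_nonneg (z 1)
  apply hz
  funext i
  fin_cases i
  · exact Complex.normSq_eq_zero.mp (show Complex.normSq (z 0) = 0 by linarith)
  · exact Complex.normSq_eq_zero.mp (show Complex.normSq (z 1) = 0 by linarith)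

theorem contDiffAt_sphereCoord {z : Fin 2 → ℂ} (hz : z ≠ 0) (k : Fin 3) :
    ContDiffAt ℝ ∞ (fun z => sphereCoord z k) z := by
  have hre : ∀ i : Fin 2, ContDiff ℝ ∞ (fun z : Fin 2 → ℂ => (z i).re) := fun i =>
    Complex.reCLM.contDiff.comp (contDiff_apply ℝ ℂ i)
  have him : ∀ i : Fin 2, ContDiff ℝ ∞ (fun z : Fin 2 → ℂ => (z i).im) := fun i =>
    Complex.imCLM.contDiff.comp (contDiff_apply ℝ ℂ i)
  have hsq : ∀ i : Fin 2, ContDiff ℝ ∞ (fun z : Fin 2 → ℂ => Complex.normSq (z i)) := fun i => by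
    simp only [Complex.normSq_apply]
    exact ((hre i).mul (hre i)).add ((him i).mul (him i))
  have hn := ((hsq 0).add (hsq 1)).contDiffAt (x := z)
  fin_cases k
  · exact ((hsq 0).sub (hsq 1)).contDiffAt.div hn (normSq_add_pos hz).ne'
  · refine ContDiffAt.div (ContDiff.contDiffAt ?_) hn (normSq_add_pos hz).ne'
    simp only [Complex.mul_re, Complex.conj_re, Complex.conj_im]
    exact contDiff_const.mul (((hre 0).mul (hre 1)).sub ((him 0).neg.mul (him 1)))
  · refine ContDiffAt.div (ContDiff.contDiffAt ?_) hn (normSq_add_pos hz).ne'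
    simp only [Complex.mul_im, Complex.conj_re, Complex.conj_im]
    exact contDiff_const.mul (((hre 0).mul (him 1)).add ((him 0).neg.mul (hre 1)))

/-- The map `ℂ² ∖ 0 → S²` is holomorphic for the complex structure `v ↦ u × v` of the sphere. -/
theorem fderiv_sphereCoord {f : E → Fin 2 → ℂ} {x : E} (hf : DifferentiableAt ℂ f x) (hx : f x ≠ 0)
    (v : E) :
    (sphereCoord (f x) 0 * fderiv ℝ (fun e => sphereCoord (f e) 0) x v +
      sphereCoord (f x) 1 * fderiv ℝ (fun e => sphereCoord (f e) 1) x v +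
      sphereCoord (f x) 2 * fderiv ℝ (fun e => sphereCoord (f e) 2) x v = 0) ∧
    fderiv ℝ (fun e => sphereCoord (f e) 0) x (Complex.I • v) =
      sphereCoord (f x) 1 * fderiv ℝ (fun e => sphereCoord (f e) 2) x v -
      sphereCoord (f x) 2 * fderiv ℝ (fun e => sphereCoord (f e) 1) x v ∧
    fderiv ℝ (fun e => sphereCoord (f e) 1) x (Complex.I • v) =
      sphereCoord (f x) 2 * fderiv ℝ (fun e => sphereCoord (f e) 0) x v -
      sphereCoord (f x) 0 * fderiv ℝ (fun e => sphereCoord (f e) 2) x v ∧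
    fderiv ℝ (fun e => sphereCoord (f e) 2) x (Complex.I • v) =
      sphereCoord (f x) 0 * fderiv ℝ (fun e => sphereCoord (f e) 1) x v -
      sphereCoord (f x) 1 * fderiv ℝ (fun e => sphereCoord (f e) 0) x v := by
  have hpos := normSq_add_pos hx
  have hd : ∀ k, DifferentiableAt ℝ (fun e => sphereCoord (f e) k) x := fun k =>
    ((contDiffAt_sphereCoord hx k).differentiableAt (by simp)).comp x (hf.restrictScalars ℝ)
  have hfi : ∀ i, HasFDerivAt (fun e => f e i)
      (((ContinuousLinearMap.proj i : (Fin 2 → ℂ) →L[ℂ] ℂ).comp (fderiv ℂ f x)).restrictScalars ℝ)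
          x :=
    fun i => (((ContinuousLinearMap.proj i : (Fin 2 → ℂ) →L[ℂ] ℂ).hasFDerivAt.comp x
      hf.hasFDerivAt)).restrictScalars ℝ
  have hre : ∀ i, HasFDerivAt (fun e => (f e i).re) _ x := fun i =>
    Complex.reCLM.hasFDerivAt.comp x (hfi i)
  have him : ∀ i, HasFDerivAt (fun e => (f e i).im) _ x := fun i =>
    Complex.imCLM.hasFDerivAt.comp x (hfi i)
  have hne : ∀ᶠ e in 𝓝 x, f e ≠ 0 := hf.continuousAt.eventually_ne hx
  -- Instead of differentiating quotients, differentiate the identities `|f|² s_k = P_k`, where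
  -- `P_k` is a real quadratic polynomial in the coordinates of `f`, and compare the derivatives.
  have hn := ((((hre 0).mul (hre 0)).add ((him 0).mul (him 0))).add
    (((hre 1).mul (hre 1)).add ((him 1).mul (him 1))))
  have hP0 := ((((hre 0).mul (hre 0)).add ((him 0).mul (him 0))).sub
    (((hre 1).mul (hre 1)).add ((him 1).mul (him 1))))
  have hP1 := (((hre 0).mul (hre 1)).add ((him 0).mul (him 1))).const_mul 2
  have hP2 := (((hre 0).mul (him 1)).sub ((him 0).mul (hre 1))).const_mul 2
  have h0 : HasFDerivAt _ _ x := (hn.mul (hd 0).hasFDerivAt)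
  have h1 : HasFDerivAt _ _ x := (hn.mul (hd 1).hasFDerivAt)
  have h2 : HasFDerivAt _ _ x := (hn.mul (hd 2).hasFDerivAt)
  have e0 := h0.unique (hP0.congr_of_eventuallyEq (by
    filter_upwards [hne] with e he
    have := normSq_add_pos he
    simp only [sphereCoord, Matrix.cons_val, Complex.normSq_apply, Pi.mul_apply, Pi.add_apply,
        Pi.sub_apply] at this ⊢
    exact (mul_div_cancel₀ _ this.ne').trans (by ring)))
  have e1 := h1.unique (hP1.congr_of_eventuallyEq (by
    filter_upwards [hne] with e he
    have := normSq_add_pos he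
    simp only [sphereCoord, Matrix.cons_val, Complex.normSq_apply, Complex.mul_re, Complex.conj_re,
      Complex.conj_im, Pi.mul_apply, Pi.add_apply, Pi.sub_apply] at this ⊢
    exact (mul_div_cancel₀ _ this.ne').trans (by ring)))
  have e2 := h2.unique (hP2.congr_of_eventuallyEq (by
    filter_upwards [hne] with e he
    have := normSq_add_pos he
    simp only [sphereCoord, Matrix.cons_val, Complex.normSq_apply, Complex.mul_im, Complex.conj_re,
      Complex.conj_im, Pi.mul_apply, Pi.add_apply, Pi.sub_apply] at this ⊢
    exact (mul_div_cancel₀ _ this.ne').trans (by ring)))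
  have key0 := fun u => congrArg (fun L : E →L[ℝ] ℝ => L u) e0
  have key1 := fun u => congrArg (fun L : E →L[ℝ] ℝ => L u) e1
  have key2 := fun u => congrArg (fun L : E →L[ℝ] ℝ => L u) e2
  clear e0 e1 e2 h0 h1 h2 hP0 hP1 hP2 hn hd hfi hre him hne
  generalize fderiv ℝ (fun e => sphereCoord (f e) 0) x = D0 at *
  generalize fderiv ℝ (fun e => sphereCoord (f e) 1) x = D1 at *
  generalize fderiv ℝ (fun e => sphereCoord (f e) 2) x = D2 at *
  simp only [Pi.add_apply, Pi.mul_apply, add_apply, sub_apply, smul_apply,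
    ContinuousLinearMap.comp_apply, ContinuousLinearMap.coe_restrictScalars',
    ContinuousLinearMap.proj_apply, Complex.reCLM_apply, Complex.imCLM_apply,
        smul_eq_mul] at key0 key1 key2
  have a0 := key0 (Complex.I • v)
  have a1 := key1 (Complex.I • v)
  have a2 := key2 (Complex.I • v)
  have b0 := key0 v
  have b1 := key1 v
  have b2 := key2 v
  clear key0 key1 key2
  simp only [map_smul, Pi.smul_apply, smul_eq_mul, Complex.mul_re, Complex.mul_im, Complex.I_re,
    Complex.I_im, zero_mul, one_mul, zero_sub, zero_add] at a0 a1 a2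
  generalize fderiv ℂ f x v = L at *
  generalize D0 (Complex.I • v) = A0 at *
  generalize D1 (Complex.I • v) = A1 at *
  generalize D2 (Complex.I • v) = A2 at *
  generalize D0 v = B0 at *
  generalize D1 v = B1 at *
  generalize D2 v = B2 at *
  simp only [sphereCoord, Matrix.cons_val, Complex.normSq_apply, Complex.mul_re, Complex.mul_im,
    Complex.conj_re, Complex.conj_im] at *
  clear hf hx D0 D1 D2
  -- What remains is a family of rational identities in the real and imaginary parts of `f x` and of
  -- its derivative along `v`. The six derivatives of the sphere coordinates are solved for and
  -- eliminated.
  generalize (f x 0).re = p at *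
  generalize (f x 0).im = q at *
  generalize (f x 1).re = r at *
  generalize (f x 1).im = t at *
  generalize (L 0).re = p' at *
  generalize (L 0).im = q' at *
  generalize (L 1).re = r' at *
  generalize (L 1).im = t' at *
  generalize hN : p * p + q * q + (r * r + t * t) = n at *
  have hn := hpos.ne'
  have ha0 := eq_div_of_mul_eq hn ((mul_comm _ _).trans (eq_sub_of_add_eq a0))
  have ha1 := eq_div_of_mul_eq hn ((mul_comm _ _).trans (eq_sub_of_add_eq a1))
  have ha2 := eq_div_of_mul_eq hn ((mul_comm _ _).trans (eq_sub_of_add_eq a2))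
  have hb0 := eq_div_of_mul_eq hn ((mul_comm _ _).trans (eq_sub_of_add_eq b0))
  have hb1 := eq_div_of_mul_eq hn ((mul_comm _ _).trans (eq_sub_of_add_eq b1))
  have hb2 := eq_div_of_mul_eq hn ((mul_comm _ _).trans (eq_sub_of_add_eq b2))
  rw [ha0, ha1, ha2, hb0, hb1, hb2]
  refine ⟨?_, ?_, ?_, ?_⟩ <;> field_simp <;> rw [← hN] <;> ring

end Sphere

/-! ### Derivatives of the symplectic forms -/

section Omega

variable {E : Type*} [NormedAddCommGroup E] [NormedSpace ℝ E]
  {G : Type*} [NormedAddCommGroup G] [NormedSpace ℝ G]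

theorem hasFDerivAt_bilin_apply {F : Type*} [NormedAddCommGroup F] [NormedSpace ℝ F]
    {B : G → E →L[ℝ] E →L[ℝ] F} {x : G} (hB : DifferentiableAt ℝ B x) (v w : E) :
    HasFDerivAt (fun y => B y v w) (((fderiv ℝ B x).flip v).flip w) x := by
  have h1 := (hB.hasFDerivAt.clm_apply (hasFDerivAt_const v x)).clm_apply (hasFDerivAt_const w x)
  refine h1.congr_fderiv ?_
  ext y
  simp

variable [FiniteDimensional ℝ E]

theorem contDiffAt_omega {z : G → Fin 2 → ℂ} {a b c : G → E →L[ℝ] E →L[ℝ] ℝ} {x : G}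
    (hz : ContDiffAt ℝ ∞ z x) (ha : ContDiffAt ℝ ∞ a x) (hb : ContDiffAt ℝ ∞ b x)
    (hc : ContDiffAt ℝ ∞ c x) :
    ContDiffAt ℝ ∞ (fun y => omega (z y) (a y) (b y) (c y)) x := by
  refine contDiffAt_clm_of_apply fun v => contDiffAt_clm_of_apply fun w => ?_
  simp only [omega_apply]
  have h0 : ContDiffAt ℝ ∞ (fun y => z y 0) x := (contDiff_apply ℝ ℂ 0).contDiffAt.comp x hz
  have h1 : ContDiffAt ℝ ∞ (fun y => z y 1) x := (contDiff_apply ℝ ℂ 1).contDiffAt.comp x hz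
  have hcx : ∀ a : G → E →L[ℝ] E →L[ℝ] ℝ, ContDiffAt ℝ ∞ a x →
      ContDiffAt ℝ ∞ (fun y => (a y v w : ℂ)) x := fun a ha =>
    Complex.ofRealCLM.contDiff.contDiffAt.comp x
      ((ha.clm_apply contDiffAt_const).clm_apply contDiffAt_const)
  exact ((((h0.pow 2).sub (h1.pow 2)).mul (hcx b hb)).add
    ((contDiffAt_const.mul ((h0.pow 2).add (h1.pow 2))).mul (hcx c hc))).sub
      (((contDiffAt_const.mul h0).mul h1).mul (hcx a ha))

/-- With `z` fixed, `Ω_z` is a combination of three closed forms with constant complex coefficients.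
-/
theorem fderiv_omega_closed (z : Fin 2 → ℂ) {a b c : E → E →L[ℝ] E →L[ℝ] ℝ} {x : E}
    (ha : ContDiffAt ℝ ∞ a x) (hb : ContDiffAt ℝ ∞ b x) (hc : ContDiffAt ℝ ∞ c x)
    (ha' : ∀ u v w, fderiv ℝ a x u v w + fderiv ℝ a x v w u + fderiv ℝ a x w u v = 0)
    (hb' : ∀ u v w, fderiv ℝ b x u v w + fderiv ℝ b x v w u + fderiv ℝ b x w u v = 0)
    (hc' : ∀ u v w, fderiv ℝ c x u v w + fderiv ℝ c x v w u + fderiv ℝ c x w u v = 0) (u v w : E) :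
    fderiv ℝ (fun e => omega z (a e) (b e) (c e)) x u v w +
      fderiv ℝ (fun e => omega z (a e) (b e) (c e)) x v w u +
      fderiv ℝ (fun e => omega z (a e) (b e) (c e)) x w u v = 0 := by
  have hd : ∀ a : E → E →L[ℝ] E →L[ℝ] ℝ, ContDiffAt ℝ ∞ a x → ∀ v w,
      HasFDerivAt (fun e => (a e v w : ℂ))
        (Complex.ofRealCLM.comp (((fderiv ℝ a x).flip v).flip w)) x := fun a ha v w =>
    Complex.ofRealCLM.hasFDerivAt.comp _
      (hasFDerivAt_bilin_apply (ha.differentiableAt (by simp)) v w)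
  have hom := (contDiffAt_omega (contDiffAt_const (c := z)) ha hb hc).differentiableAt (by simp)
  have h' : ∀ u v w, fderiv ℝ (fun e => omega z (a e) (b e) (c e)) x u v w =
      (z 0 ^ 2 - z 1 ^ 2) * fderiv ℝ b x u v w +
      Complex.I * (z 0 ^ 2 + z 1 ^ 2) * fderiv ℝ c x u v w - 2 * z 0 * z 1 * fderiv ℝ a x u v w :=
          by
    intro u v w
    have h1 := (((hd _ hb v w).const_mul (z 0 ^ 2 - z 1 ^ 2)).add
      ((hd _ hc v w).const_mul (Complex.I * (z 0 ^ 2 + z 1 ^ 2)))).sub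
      ((hd _ ha v w).const_mul (2 * z 0 * z 1))
    exact congrArg (fun L : E →L[ℝ] ℂ => L u) ((hasFDerivAt_bilin_apply hom v w).unique h1)
  have ea := congrArg Complex.ofReal (ha' u v w)
  have eb := congrArg Complex.ofReal (hb' u v w)
  have ec := congrArg Complex.ofReal (hc' u v w)
  push_cast at ea eb ec
  simp only [h']
  linear_combination (z 0 ^ 2 - z 1 ^ 2) * eb + (Complex.I * (z 0 ^ 2 + z 1 ^ 2)) * ec -
    (2 * z 0 * z 1) * ea

end Omega

/-! ### Hyperkähler structures in charts -/

section HyperkahlerCharts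

variable {EM : Type*} [NormedAddCommGroup EM] [NormedSpace ℝ EM]
  {M : Type*} [TopologicalSpace M] [ChartedSpace EM M] [IsManifold 𝓘(ℝ, EM) ∞ M]

theorem HyperkahlerStructure.isQuaternionic (h : HyperkahlerStructure EM M) (p : M) :
    IsQuaternionic (E := EM) (h.g.inner p) (h.I p) (h.J p) (h.K p) where
  symm := h.g.symm p
  pos := h.g.pos p
  sqI := h.kahler_I.1.sq_eq p
  sqJ := h.kahler_J.1.sq_eq p
  sqK := h.kahler_K.1.sq_eq p
  mul := h.quaternion p
  invI := h.kahler_I.2.1 p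
  invJ := h.kahler_J.2.1 p
  invK := h.kahler_K.2.1 p

/-- A Riemannian metric in the preferred chart at `x₀`. -/
def metricInChart (g : ContMDiffRiemannianMetric 𝓘(ℝ, EM) ∞ EM (fun x : M => TangentSpace 𝓘(ℝ,
    EM) x))
    (x₀ : M) (e : EM) : EM →L[ℝ] EM →L[ℝ] ℝ :=
  ContinuousLinearMap.bilinearComp (E := EM) (F := EM) (E' := EM) (F' := EM)
    (g.inner ((extChartAt 𝓘(ℝ, EM) x₀).symm e))
    (chartSymmJac 𝓘(ℝ, EM) x₀ e) (chartSymmJac 𝓘(ℝ, EM) x₀ e)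

/-- Conjugation by chart derivatives makes the pointwise algebra available at every point of a
chart, and not only at its centre. -/
theorem IsQuaternionic.conj {g : EM →L[ℝ] EM →L[ℝ] ℝ} {I J K : EM →L[ℝ] EM}
    (q : IsQuaternionic g I J K) {S D : EM →L[ℝ] EM} (hSD : ∀ v, S (D v) = v)
    (hDS : ∀ v, D (S v) = v) :
    IsQuaternionic (g.bilinearComp S S) (D.comp (I.comp S)) (D.comp (J.comp S))
      (D.comp (K.comp S)) where
  symm v w := q.symm _ _
  pos v hv := q.pos _ fun h => hv (by rw [← hDS v]; exact (congrArg D h).trans (map_zero D))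
  sqI v := by simp [hSD, hDS, q.sqI]
  sqJ v := by simp [hSD, hDS, q.sqJ]
  sqK v := by simp [hSD, hDS, q.sqK]
  mul v := by simp [hSD, hDS, q.mul]
  invI v w := by simp [hSD, q.invI]
  invJ v w := by simp [hSD, q.invJ]
  invK v w := by simp [hSD, q.invK]

theorem HyperkahlerStructure.isQuaternionic_chart (h : HyperkahlerStructure EM M) {p : M} {e : EM}
    (he : e ∈ (extChartAt 𝓘(ℝ, EM) p).target) :
    IsQuaternionic (metricInChart h.g p e) (endInChart 𝓘(ℝ, EM) h.I p e)
      (endInChart 𝓘(ℝ, EM) h.J p e) (endInChart 𝓘(ℝ, EM) h.K p e) :=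
  (h.isQuaternionic ((extChartAt 𝓘(ℝ, EM) p).symm e)).conj
    (S := chartSymmJac 𝓘(ℝ, EM) p e) (D := chartJac 𝓘(ℝ, EM) p ((extChartAt 𝓘(ℝ, EM) p).symm e))
    (chartSymmJac_chartJac he) (chartJac_chartSymmJac he)

theorem formOfEnd_eq (g : ContMDiffRiemannianMetric 𝓘(ℝ, EM) ∞ EM
    (fun x : M => TangentSpace 𝓘(ℝ, EM) x))
    (A : ∀ x : M, TangentSpace 𝓘(ℝ, EM) x →L[ℝ] TangentSpace 𝓘(ℝ, EM) x) {p : M} {e : EM}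
    (he : e ∈ (extChartAt 𝓘(ℝ, EM) p).target) :
    formOfEnd g A p e = (metricInChart g p e).comp (endInChart 𝓘(ℝ, EM) A p e) := by
  refine ContinuousLinearMap.ext fun v => ContinuousLinearMap.ext fun w => ?_
  exact congrArg (fun u : EM => (g.inner ((extChartAt 𝓘(ℝ, EM) p).symm e) : EM →L[ℝ] EM →L[ℝ] ℝ) u
    (chartSymmJac 𝓘(ℝ, EM) p e w)) (chartSymmDeriv_endInChart A he v).symm

/-- The form `Ω_z` of a hyperkähler manifold at a point. -/
def HyperkahlerStructure.form (h : HyperkahlerStructure EM M) (z : Fin 2 → ℂ) (p : M) :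
    EM →L[ℝ] EM →L[ℝ] ℂ :=
  omega z (ContinuousLinearMap.comp (h.g.inner p : EM →L[ℝ] EM →L[ℝ] ℝ) (h.I p : EM →L[ℝ] EM))
    (ContinuousLinearMap.comp (h.g.inner p : EM →L[ℝ] EM →L[ℝ] ℝ) (h.J p : EM →L[ℝ] EM))
    (ContinuousLinearMap.comp (h.g.inner p : EM →L[ℝ] EM →L[ℝ] ℝ) (h.K p : EM →L[ℝ] EM))

/-- The form `Ω_z` of a hyperkähler manifold in the preferred chart at `p`. -/
def HyperkahlerStructure.formChart (h : HyperkahlerStructure EM M) (z : Fin 2 → ℂ) (p : M) (e :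
    EM) :
    EM →L[ℝ] EM →L[ℝ] ℂ :=
  omega z (formOfEnd h.g h.I p e) (formOfEnd h.g h.J p e) (formOfEnd h.g h.K p e)

theorem HyperkahlerStructure.formChart_eq_bilinearComp (h : HyperkahlerStructure EM M)
    (z : Fin 2 → ℂ) (p : M) (e : EM) :
    h.formChart z p e = (h.form z ((extChartAt 𝓘(ℝ, EM) p).symm e)).bilinearComp
      (chartSymmJac 𝓘(ℝ, EM) p e) (chartSymmJac 𝓘(ℝ, EM) p e) := rfl

theorem HyperkahlerStructure.formChart_eq (h : HyperkahlerStructure EM M)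
    (z : Fin 2 → ℂ) {p : M} {e : EM} (he : e ∈ (extChartAt 𝓘(ℝ, EM) p).target) :
    h.formChart z p e = omega z ((metricInChart h.g p e).comp (endInChart 𝓘(ℝ, EM) h.I p e))
      ((metricInChart h.g p e).comp (endInChart 𝓘(ℝ, EM) h.J p e))
      ((metricInChart h.g p e).comp (endInChart 𝓘(ℝ, EM) h.K p e)) := by
  rw [HyperkahlerStructure.formChart, formOfEnd_eq _ _ he, formOfEnd_eq _ _ he, formOfEnd_eq _ _ he]

variable [FiniteDimensional ℝ EM]

theorem HyperkahlerStructure.contDiffAt_formOfEnd (h : HyperkahlerStructure EM M) (p : M) :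
    ContDiffAt ℝ ∞ (formOfEnd h.g h.I p) (extChartAt 𝓘(ℝ, EM) p p) ∧
    ContDiffAt ℝ ∞ (formOfEnd h.g h.J p) (extChartAt 𝓘(ℝ, EM) p p) ∧
    ContDiffAt ℝ ∞ (formOfEnd h.g h.K p) (extChartAt 𝓘(ℝ, EM) p p) :=
  ⟨CalabiGray.contDiffAt_formOfEnd h.g h.I p h.kahler_I.1.smooth.contMDiffAt,
    CalabiGray.contDiffAt_formOfEnd h.g h.J p h.kahler_J.1.smooth.contMDiffAt,
    CalabiGray.contDiffAt_formOfEnd h.g h.K p h.kahler_K.1.smooth.contMDiffAt⟩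

theorem HyperkahlerStructure.differentiableAt_formChart (h : HyperkahlerStructure EM M)
    (z : Fin 2 → ℂ) (p : M) :
    DifferentiableAt ℝ (h.formChart z p) (extChartAt 𝓘(ℝ, EM) p p) := by
  obtain ⟨hI, hJ, hK⟩ := h.contDiffAt_formOfEnd p
  exact (contDiffAt_omega contDiffAt_const hI hJ hK).differentiableAt (by simp)

theorem HyperkahlerStructure.formChart_closed (h : HyperkahlerStructure EM M)
    (z : Fin 2 → ℂ) (p : M) (u v w : EM) :
    fderiv ℝ (h.formChart z p) (extChartAt 𝓘(ℝ, EM) p p) u v w +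
      fderiv ℝ (h.formChart z p) (extChartAt 𝓘(ℝ, EM) p p) v w u +
      fderiv ℝ (h.formChart z p) (extChartAt 𝓘(ℝ, EM) p p) w u v = 0 := by
  obtain ⟨hI, hJ, hK⟩ := h.contDiffAt_formOfEnd p
  exact fderiv_omega_closed z hI hJ hK (fun u v w => formOfEnd_closed h.g h.I h.kahler_I p u v w)
    (fun u v w => formOfEnd_closed h.g h.J h.kahler_J p u v w)
    (fun u v w => formOfEnd_closed h.g h.K h.kahler_K p u v w) u v w

end HyperkahlerCharts

/-! ### Integrability -/

section Integrability

variable {E : Type*} [NormedAddCommGroup E] [NormedSpace ℝ E]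

/-- An almost complex structure with a closed nondegenerate form of type `(2, 0)` is integrable. -/
theorem nijenhuis_eq_zero_of_form {B : E → E →L[ℝ] E →L[ℝ] ℂ} {J : E → E →L[ℝ] E} {x : E}
    (hB : DifferentiableAt ℝ B x) (hJ : DifferentiableAt ℝ J x)
    (hskew : ∀ᶠ e in 𝓝 x, ∀ v w, B e v w = -B e w v)
    (htype : ∀ᶠ e in 𝓝 x, ∀ v w, B e (J e v) w = Complex.I * B e v w)
    (hclosed : ∀ u v w, fderiv ℝ B x u v w + fderiv ℝ B x v w u + fderiv ℝ B x w u v = 0)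
    (hnd : ∀ v, (∀ w, B x v w = 0) → v = 0) (v w : E) :
    fderiv ℝ J x (J x v) w - fderiv ℝ J x (J x w) v + J x (fderiv ℝ J x w v) -
      J x (fderiv ℝ J x v w) = 0 := by
  have hBd := hasFDerivAt_bilin_apply hB
  have hJd : ∀ a : E, HasFDerivAt (fun e => J e a) ((fderiv ℝ J x).flip a) x := by
    intro a
    have h1 := hJ.hasFDerivAt.clm_apply (hasFDerivAt_const a x)
    refine h1.congr_fderiv ?_
    ext y
    simp
  have hanti : ∀ y a b, fderiv ℝ B x y a b = -fderiv ℝ B x y b a := by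
    intro y a b
    have h1 := (hBd a b).unique ((hBd b a).neg.congr_of_eventuallyEq
      (hskew.mono fun e he => he a b))
    simpa using congrArg (fun L => L y) h1
  -- Differentiating `Ω(J a, b) = i Ω(a, b)` expresses the derivative of `J`, paired by `Ω`, through
  -- derivatives of `Ω` alone.
  have htype' : ∀ y a b, B x (fderiv ℝ J x y a) b =
      Complex.I * fderiv ℝ B x y a b - fderiv ℝ B x y (J x a) b := by
    intro y a b
    have h1 := (hB.hasFDerivAt.clm_apply (hJd a)).clm_apply (hasFDerivAt_const b x)
    have h2 := h1.unique (((hBd a b).const_smul Complex.I).congr_of_eventuallyEq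
      (htype.mono fun e he => he a b))
    have h3 := congrArg (fun L => L y) h2
    simp at h3
    linear_combination h3
  have hl : ∀ a b, B x (J x a) b = Complex.I * B x a b := htype.self_of_nhds
  have hr : ∀ a b, B x a (J x b) = Complex.I * B x a b := by
    intro a b
    rw [hskew.self_of_nhds, hl, hskew.self_of_nhds b a]
    ring
  -- By nondegeneracy it is enough to pair the Nijenhuis expression with `t`. The result is a
  -- combination of the closedness relations at the four triples formed from `v` or `J v`, `w` or `J
  -- w`, and `t`.
  refine hnd _ fun t => ?_
  have c1 := hclosed (J x v) (J x w) t
  have c2 := hclosed (J x v) w t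
  have c3 := hclosed v (J x w) t
  have c4 := hclosed v w t
  have t1 := htype' t v (J x w)
  have t2 := htype' t v w
  rw [hr] at t1
  simp only [map_add, map_sub, add_apply, sub_apply, hl, htype']
  have a1 := hanti (J x w) v t
  have a2 := hanti (J x w) (J x v) t
  have a3 := hanti w v t
  have a4 := hanti w (J x v) t
  linear_combination t1 - Complex.I * t2 - c1 + Complex.I * c2 + Complex.I * c3 -
    Complex.I ^ 2 * c4 - Complex.I * a1 + a2 + Complex.I ^ 2 * a3 - Complex.I * a4

end Integrability

/-! ### Derivative and Nijenhuis tensor of a block structure varying with the second factor -/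

section TwistedDerivative

variable {EM : Type*} [NormedAddCommGroup EM] [NormedSpace ℝ EM] [FiniteDimensional ℝ EM]
  {EY : Type*} [NormedAddCommGroup EY] [NormedSpace ℝ EY] [FiniteDimensional ℝ EY]
  {A₀ A₁ A₂ : EM → EM →L[ℝ] EM} {s₀ s₁ s₂ : EY → ℝ} {C : EY →L[ℝ] EY}
  {T : EM × EY → EM × EY →L[ℝ] EM × EY} {x : EM × EY}

theorem contDiffAt_twisted
    (h₀ : ContDiffAt ℝ ∞ A₀ x.1) (h₁ : ContDiffAt ℝ ∞ A₁ x.1) (h₂ : ContDiffAt ℝ ∞ A₂ x.1)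
    (k₀ : ContDiffAt ℝ ∞ s₀ x.2) (k₁ : ContDiffAt ℝ ∞ s₁ x.2) (k₂ : ContDiffAt ℝ ∞ s₂ x.2)
    (hT : T =ᶠ[𝓝 x] fun e => ContinuousLinearMap.prodMap
      (s₀ e.2 • A₀ e.1 + s₁ e.2 • A₁ e.1 + s₂ e.2 • A₂ e.1) C) : ContDiffAt ℝ ∞ T x := by
  refine ContDiffAt.congr_of_eventuallyEq ?_ hT
  refine contDiffAt_clm_of_apply fun v => ?_
  have hA : ∀ {A : EM → EM →L[ℝ] EM} {s : EY → ℝ}, ContDiffAt ℝ ∞ A x.1 → ContDiffAt ℝ ∞ s x.2 →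
      ContDiffAt ℝ ∞ (fun e : EM × EY => s e.2 • A e.1 v.1) x := fun hA hs =>
    (hs.comp x contDiffAt_snd).smul ((hA.comp x contDiffAt_fst).clm_apply contDiffAt_const)
  exact (((hA h₀ k₀).add (hA h₁ k₁)).add (hA h₂ k₂)).prodMk contDiffAt_const

/-- By the product rule the derivative along `M` sees frozen coefficients `s_k`, the derivative
along `Y` sees frozen endomorphisms `A_k`, and the constant block `C` contributes nothing. -/
theorem fderiv_twisted
    (h₀ : ContDiffAt ℝ ∞ A₀ x.1) (h₁ : ContDiffAt ℝ ∞ A₁ x.1) (h₂ : ContDiffAt ℝ ∞ A₂ x.1)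
    (k₀ : ContDiffAt ℝ ∞ s₀ x.2) (k₁ : ContDiffAt ℝ ∞ s₁ x.2) (k₂ : ContDiffAt ℝ ∞ s₂ x.2)
    (hT : T =ᶠ[𝓝 x] fun e => ContinuousLinearMap.prodMap
      (s₀ e.2 • A₀ e.1 + s₁ e.2 • A₁ e.1 + s₂ e.2 • A₂ e.1) C) (u v : EM × EY) :
    fderiv ℝ T x u v =
      (fderiv ℝ (fun e => s₀ x.2 • A₀ e + s₁ x.2 • A₁ e + s₂ x.2 • A₂ e) x.1 u.1 v.1 +
        (fderiv ℝ s₀ x.2 u.2 • A₀ x.1 + fderiv ℝ s₁ x.2 u.2 • A₁ x.1 +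
          fderiv ℝ s₂ x.2 u.2 • A₂ x.1) v.1, 0) := by
  have hTd := (contDiffAt_twisted h₀ h₁ h₂ k₀ k₁ k₂ hT).differentiableAt (by simp)
  have d₀ := (h₀.differentiableAt (by simp)).hasFDerivAt
  have d₁ := (h₁.differentiableAt (by simp)).hasFDerivAt
  have d₂ := (h₂.differentiableAt (by simp)).hasFDerivAt
  have e₀ := (k₀.differentiableAt (by simp)).hasFDerivAt
  have e₁ := (k₁.differentiableAt (by simp)).hasFDerivAt
  have e₂ := (k₂.differentiableAt (by simp)).hasFDerivAt
  have hl : HasFDerivAt (fun e => T e v) ((fderiv ℝ T x).flip v) x := by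
    refine (hTd.hasFDerivAt.clm_apply (hasFDerivAt_const v x)).congr_fderiv ?_
    ext y <;> simp
  have hA : ∀ {A : EM → EM →L[ℝ] EM} {s : EY → ℝ} {A' s'}, HasFDerivAt A A' x.1 →
      HasFDerivAt s s' x.2 → HasFDerivAt (fun e : EM × EY => s e.2 • A e.1 v.1) _ x :=
    fun hA hs => (hs.comp x hasFDerivAt_snd).smul
      ((hA.comp x hasFDerivAt_fst).clm_apply (hasFDerivAt_const v.1 x))
  have hr := ((((hA d₀ e₀).add (hA d₁ e₁)).add (hA d₂ e₂)).prodMk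
    (hasFDerivAt_const (C v.2) x)).congr_of_eventuallyEq
      (f₁ := fun e => T e v) (hT.mono fun e he => congrArg (fun L => L v) he)
  have hs := ((d₀.const_smul (s₀ x.2)).add (d₁.const_smul (s₁ x.2))).add (d₂.const_smul (s₂ x.2))
  have hs' : fderiv ℝ (fun e => s₀ x.2 • A₀ e + s₁ x.2 • A₁ e + s₂ x.2 • A₂ e) x.1 = _ := hs.fderiv
  rw [hs']
  have := congrArg (fun L => L u) (hl.unique hr)
  refine Eq.trans this ?_
  refine Prod.ext ?_ ?_
  · simp
    abel
  · simp

/-- The terms in `DJ` form the Nijenhuis tensor on `M`. The terms in `D` cancel in pairs by `hD`,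
which is the holomorphic dependence on `y`. -/
theorem nijenhuis_twisted {DT : EM × EY →L[ℝ] EM × EY →L[ℝ] EM × EY} {S : EM × EY →L[ℝ] EM × EY}
    {J : EM →L[ℝ] EM} {DJ : EM →L[ℝ] EM →L[ℝ] EM} {D : EY → EM →L[ℝ] EM}
    (hDT : ∀ u v, DT u v = (DJ u.1 v.1 + D u.2 v.1, 0)) (hS : ∀ u, S u = (J u.1, C u.2))
    (hN : ∀ v w, DJ (J v) w - DJ (J w) v + J (DJ w v) - J (DJ v w) = 0)
    (hD : ∀ u a, D (C u) a = J (D u a)) (v w : EM × EY) :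
    DT (S v) w - DT (S w) v + S (DT w v) - S (DT v w) = 0 := by
  simp only [hDT, hS, hD, map_add, map_zero]
  refine Prod.ext ?_ ?_
  · simp only [Prod.fst_sub, Prod.fst_add, Prod.fst_zero]
    rw [← hN v.1 w.1]
    abel
  · simp

end TwistedDerivative

/-! ### Local holomorphic lifts of maps to the projective line -/

section Lift

variable {E : Type*} [NormedAddCommGroup E] [NormedSpace ℂ E]
  {Y : Type*} [TopologicalSpace Y] [ChartedSpace E Y] [IsManifold 𝓘(ℂ, E) ω Y]

theorem contDiffAt_of_eventually_differentiableAt [FiniteDimensional ℂ E] {f : E → ℂ} {x : E}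
    (hf : ∀ᶠ e in 𝓝 x, DifferentiableAt ℂ f e) : ContDiffAt ℂ ∞ f x := by
  obtain ⟨U, hU, hUo, hx⟩ := eventually_nhds_iff.1 hf
  exact (contDiffOn_of_differentiableOn hUo fun e he =>
    (hU e he).differentiableWithinAt).contDiffAt (hUo.mem_nhds hx)

theorem contDiffAt_pi_of_eventually_differentiableAt [FiniteDimensional ℂ E] {f : E → Fin 2 → ℂ}
    {x : E} (hf : ∀ᶠ e in 𝓝 x, DifferentiableAt ℂ f e) : ContDiffAt ℂ ∞ f x :=
  contDiffAt_pi.2 fun i => contDiffAt_of_eventually_differentiableAt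
    (hf.mono fun _ he => differentiableAt_pi.1 he i)

theorem IsHolMapCP1.exists_lift_chart {φ : Y → CP1} (hφ : IsHolMapCP1 (E := E) φ) (y₀ : Y) :
    ∃ F : E → Fin 2 → ℂ, ∀ᶠ e in 𝓝 (extChartAt 𝓘(ℝ, E) y₀ y₀), DifferentiableAt ℂ F e ∧
      ∃ h : F e ≠ 0, φ ((extChartAt 𝓘(ℝ, E) y₀).symm e) = Projectivization.mk ℂ (F e) h := by
  obtain ⟨U, hU, hy, f, hf, hfφ⟩ := hφ y₀
  refine ⟨fun e => f ((extChartAt 𝓘(ℝ, E) y₀).symm e), ?_⟩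
  have hcont : ContinuousAt (extChartAt 𝓘(ℝ, E) y₀).symm (extChartAt 𝓘(ℝ, E) y₀ y₀) :=
    continuousAt_extChartAt_symm y₀
  have hmem : ∀ᶠ e in 𝓝 (extChartAt 𝓘(ℝ, E) y₀ y₀), (extChartAt 𝓘(ℝ, E) y₀).symm e ∈ U :=
    hcont (by rw [extChartAt_to_inv]; exact hU.mem_nhds hy)
  filter_upwards [hmem, extChartAt_target_mem_nhds (I := 𝓘(ℝ, E)) y₀] with e he he'
  exact ⟨differentiableAt_chart_of_mdifferentiableOn hU hf y₀ he' he, hfφ _ he⟩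

end Lift

/-! ### The complex structure of the total space -/

section Total

variable {EM : Type*} [NormedAddCommGroup EM] [NormedSpace ℝ EM] [FiniteDimensional ℝ EM]
  {M : Type*} [TopologicalSpace M] [ChartedSpace EM M] [IsManifold 𝓘(ℝ, EM) ∞ M]
  {EY : Type*} [NormedAddCommGroup EY] [NormedSpace ℂ EY] [FiniteDimensional ℂ EY]
  {Y : Type*} [TopologicalSpace Y] [ChartedSpace EY Y] [IsManifold 𝓘(ℂ, EY) ω Y]

theorem contDiffAt_endInChart_of_isKahler
    {g : ContMDiffRiemannianMetric 𝓘(ℝ, EM) ∞ EM (fun x : M => TangentSpace 𝓘(ℝ, EM) x)}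
    {A : ∀ x : M, TangentSpace 𝓘(ℝ, EM) x →L[ℝ] TangentSpace 𝓘(ℝ, EM) x} (hA : IsKahler g A)
    (p : M) : ContDiffAt ℝ ∞ (endInChart 𝓘(ℝ, EM) A p) (extChartAt 𝓘(ℝ, EM) p p) :=
  (contMDiffAt_endomorphism_iff A p).1 hA.1.smooth.contMDiffAt

/-- The complex structure of the total space in a chart. -/
theorem endInChart_twistedStructure_eventuallyEq (h : HyperkahlerStructure EM M) {φ : Y → CP1}
    (x₀ : M × Y) {F : EY → Fin 2 → ℂ}
    (hF : ∀ᶠ e in 𝓝 (extChartAt 𝓘(ℝ, EY) x₀.2 x₀.2), DifferentiableAt ℂ F e ∧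
      ∃ h : F e ≠ 0, φ ((extChartAt 𝓘(ℝ, EY) x₀.2).symm e) = Projectivization.mk ℂ (F e) h) :
    endInChart (𝓘(ℝ, EM).prod 𝓘(ℝ, EY)) (twistedStructure (EY := EY) h φ) x₀
      =ᶠ[𝓝 (extChartAt (𝓘(ℝ, EM).prod 𝓘(ℝ, EY)) x₀ x₀)] fun e => ContinuousLinearMap.prodMap
        (sphereCoord (F e.2) 0 • endInChart 𝓘(ℝ, EM) h.I x₀.1 e.1 +
          sphereCoord (F e.2) 1 • endInChart 𝓘(ℝ, EM) h.J x₀.1 e.1 +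
          sphereCoord (F e.2) 2 • endInChart 𝓘(ℝ, EM) h.K x₀.1 e.1)
        ((Complex.I • ContinuousLinearMap.id ℂ EY).restrictScalars ℝ) := by
  have hF' : ∀ᶠ e in 𝓝 (extChartAt (𝓘(ℝ, EM).prod 𝓘(ℝ, EY)) x₀ x₀), _ :=
    continuousAt_snd.eventually hF
  filter_upwards [hF', extChartAt_target_mem_nhds (I := 𝓘(ℝ, EM).prod 𝓘(ℝ, EY)) x₀] with e he he'
  obtain ⟨-, hz, he⟩ := he
  rw [endInChart_twistedStructure h φ he', he]
  rfl

theorem contDiffAt_sphereCoord_comp {F : EY → Fin 2 → ℂ} {x : EY}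
    (hF : ∀ᶠ e in 𝓝 x, DifferentiableAt ℂ F e) (hx : F x ≠ 0) (k : Fin 3) :
    ContDiffAt ℝ ∞ (fun e => sphereCoord (F e) k) x :=
  (contDiffAt_sphereCoord hx k).comp x
    ((contDiffAt_pi_of_eventually_differentiableAt hF).restrict_scalars ℝ)

theorem twistedStructure_sq (h : HyperkahlerStructure EM M) (φ : Y → CP1) (x : M × Y)
    (v : TangentSpace (𝓘(ℝ, EM).prod 𝓘(ℝ, EY)) x) :
    twistedStructure (EY := EY) h φ x (twistedStructure (EY := EY) h φ x v) = -v := by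
  have h1 : ∀ u : EM, _ := (h.isQuaternionic x.1).sq_combination _ (toSphere_mem (φ x.2))
  have h2 : ∀ u : EY, Complex.I • Complex.I • u = -u := fun u => by
    rw [smul_smul, Complex.I_mul_I, neg_one_smul]
  exact Prod.ext (h1 (v : EM × EY).1) (h2 (v : EM × EY).2)

theorem contDiffAt_endInChart_twistedStructure (h : HyperkahlerStructure EM M) {φ : Y → CP1}
    (hφ : IsHolMapCP1 (E := EY) φ) (x₀ : M × Y) : ContDiffAt ℝ ∞
      (endInChart (𝓘(ℝ, EM).prod 𝓘(ℝ, EY)) (twistedStructure (EY := EY) h φ) x₀)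
      (extChartAt (𝓘(ℝ, EM).prod 𝓘(ℝ, EY)) x₀ x₀) := by
  have hfd : FiniteDimensional ℝ EY := FiniteDimensional.complexToReal EY
  obtain ⟨F, hF⟩ := hφ.exists_lift_chart x₀.2
  have hFd := hF.mono fun e he => he.1
  have hF0 := hF.self_of_nhds.2.1
  exact contDiffAt_twisted (x := extChartAt (𝓘(ℝ, EM).prod 𝓘(ℝ, EY)) x₀ x₀)
    (contDiffAt_endInChart_of_isKahler h.kahler_I x₀.1)
    (contDiffAt_endInChart_of_isKahler h.kahler_J x₀.1)
    (contDiffAt_endInChart_of_isKahler h.kahler_K x₀.1)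
    (contDiffAt_sphereCoord_comp hFd hF0 0) (contDiffAt_sphereCoord_comp hFd hF0 1)
    (contDiffAt_sphereCoord_comp hFd hF0 2) (endInChart_twistedStructure_eventuallyEq h x₀ hF)

/-- The complex structures of the twistor family are integrable, in the preferred charts. -/
theorem nijenhuis_combination (h : HyperkahlerStructure EM M) {z : Fin 2 → ℂ} (hz : z ≠ 0) (p : M)
    (v w : EM) (J : EM → EM →L[ℝ] EM)
    (hJ : J = fun e => sphereCoord z 0 • endInChart 𝓘(ℝ, EM) h.I p e +
      sphereCoord z 1 • endInChart 𝓘(ℝ, EM) h.J p e + sphereCoord z 2 • endInChart 𝓘(ℝ,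
          EM) h.K p e) :
    fderiv ℝ J (extChartAt 𝓘(ℝ, EM) p p) (J (extChartAt 𝓘(ℝ, EM) p p) v) w -
      fderiv ℝ J (extChartAt 𝓘(ℝ, EM) p p) (J (extChartAt 𝓘(ℝ, EM) p p) w) v +
      J (extChartAt 𝓘(ℝ, EM) p p) (fderiv ℝ J (extChartAt 𝓘(ℝ, EM) p p) w v) -
      J (extChartAt 𝓘(ℝ, EM) p p) (fderiv ℝ J (extChartAt 𝓘(ℝ, EM) p p) v w) = 0 := by
  have htarget := extChartAt_target_mem_nhds (I := 𝓘(ℝ, EM)) p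
  -- The `(2, 0)`-form for this member of the family is `Ω_z`, with the same `z` at all points of
  -- `M`.
  refine nijenhuis_eq_zero_of_form (h.differentiableAt_formChart z p) ?_ ?_ ?_
    (h.formChart_closed z p) ?_ v w
  · have hd : ∀ {A}, IsKahler h.g A → ∀ c : ℝ, DifferentiableAt ℝ
        (fun e => c • endInChart 𝓘(ℝ, EM) A p e) (extChartAt 𝓘(ℝ, EM) p p) := fun hA c =>
      ((contDiffAt_endInChart_of_isKahler hA p).differentiableAt (by simp)).const_smul c
    rw [hJ]
    exact ((hd h.kahler_I _).add (hd h.kahler_J _)).add (hd h.kahler_K _)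
  · filter_upwards [htarget] with e he v w
    rw [h.formChart_eq _ he]
    exact (h.isQuaternionic_chart he).omega_skew _ v w
  · filter_upwards [htarget] with e he v w
    rw [h.formChart_eq _ he, hJ]
    exact (h.isQuaternionic_chart he).omega_left hz v w
  · intro v hv
    rw [h.formChart_eq _ (mem_extChartAt_target p)] at hv
    exact (h.isQuaternionic_chart (mem_extChartAt_target p)).omega_nondegenerate hz hv

theorem isComplexStructure_twistedStructure (h : HyperkahlerStructure EM M) {φ : Y → CP1}
    (hφ : IsHolMapCP1 (E := EY) φ) :
    IsComplexStructure (𝓘(ℝ, EM).prod 𝓘(ℝ, EY)) (twistedStructure (EY := EY) h φ) := by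
  have hfd : FiniteDimensional ℝ EY := FiniteDimensional.complexToReal EY
  refine ⟨fun x₀ => (contMDiffAt_endomorphism_iff _ x₀).2
    (contDiffAt_endInChart_twistedStructure h hφ x₀), twistedStructure_sq h φ, ?_⟩
  refine nijenhuisVanishes_of_chart _ (twistedStructure_sq h φ) (fun x₀ =>
    (contDiffAt_endInChart_twistedStructure h hφ x₀).differentiableAt (by simp)) ?_
  intro x₀ T hT v w
  obtain ⟨F, hF⟩ := hφ.exists_lift_chart x₀.2
  have hFd := hF.mono fun e he => he.1
  have hF0 := hF.self_of_nhds.2.1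
  have hev := endInChart_twistedStructure_eventuallyEq h x₀ hF
  have hder := fderiv_twisted (x := extChartAt (𝓘(ℝ, EM).prod 𝓘(ℝ, EY)) x₀ x₀)
    (contDiffAt_endInChart_of_isKahler h.kahler_I x₀.1)
    (contDiffAt_endInChart_of_isKahler h.kahler_J x₀.1)
    (contDiffAt_endInChart_of_isKahler h.kahler_K x₀.1)
    (contDiffAt_sphereCoord_comp hFd hF0 0) (contDiffAt_sphereCoord_comp hFd hF0 1)
    (contDiffAt_sphereCoord_comp hFd hF0 2) hev
  have hq := h.isQuaternionic_chart (mem_extChartAt_target (I := 𝓘(ℝ, EM)) x₀.1)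
  refine nijenhuis_twisted
    (C := (Complex.I • ContinuousLinearMap.id ℂ EY).restrictScalars ℝ)
    (D := fun u => fderiv ℝ (fun e => sphereCoord (F e) 0) (extChartAt 𝓘(ℝ, EY) x₀.2 x₀.2) u •
        endInChart 𝓘(ℝ, EM) h.I x₀.1 (extChartAt 𝓘(ℝ, EM) x₀.1 x₀.1) +
      fderiv ℝ (fun e => sphereCoord (F e) 1) (extChartAt 𝓘(ℝ, EY) x₀.2 x₀.2) u •
        endInChart 𝓘(ℝ, EM) h.J x₀.1 (extChartAt 𝓘(ℝ, EM) x₀.1 x₀.1) +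
      fderiv ℝ (fun e => sphereCoord (F e) 2) (extChartAt 𝓘(ℝ, EY) x₀.2 x₀.2) u •
        endInChart 𝓘(ℝ, EM) h.K x₀.1 (extChartAt 𝓘(ℝ, EM) x₀.1 x₀.1))
    hder (fun u => congrArg (fun L : EM × EY →L[ℝ] EM × EY => L u) (hT.trans hev.self_of_nhds))
    (fun v w => nijenhuis_combination h hF0 x₀.1 v w _ rfl) ?_ v w
  intro u a
  -- The derivative of the sphere point `s` along `i u` is `s × ds(u)`. Since `ds(u)` is orthogonal
  -- to `s`, this cross product is also the quaternionic product, which gives `D (i u) = J ∘ D u`.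
  obtain ⟨h0, h1, h2, h3⟩ := fderiv_sphereCoord hF.self_of_nhds.1 hF0 u
  have := hq.mul_combination (sphereCoord (F (extChartAt 𝓘(ℝ, EY) x₀.2 x₀.2)))
    (fun k => fderiv ℝ (fun e => sphereCoord (F e) k) (extChartAt 𝓘(ℝ, EY) x₀.2 x₀.2) u) h0 a
  rw [← h1, ← h2, ← h3] at this
  exact this.symm

theorem isHolMap_snd (h : HyperkahlerStructure EM M) (φ : Y → CP1) :
    IsHolMap (𝓘(ℝ, EM).prod 𝓘(ℝ, EY)) 𝓘(ℝ, EY) (twistedStructure (EY := EY) h φ) complexMul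
      (Prod.snd : M × Y → Y) := by
  refine ⟨contMDiff_snd, fun x v => ?_⟩
  rw [mfderiv_snd]
  rfl

/-- Near the slice, the defining function is the chart of `M` at `p`, recentred and moved to
Euclidean space by `L`. Along the slice the kernel of its differential is the tangent space of `Y`,
which a block diagonal structure preserves. -/
theorem isComplexSubmanifold_slice (h : HyperkahlerStructure EM M) (φ : Y → CP1) (p : M) :
    IsComplexSubmanifold (𝓘(ℝ, EM).prod 𝓘(ℝ, EY)) (twistedStructure (EY := EY) h φ)
      (({p} : Set M) ×ˢ (univ : Set Y)) := by
  intro x hx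
  have hL : Module.finrank ℝ EM = Module.finrank ℝ (EuclideanSpace ℝ (Fin (Module.finrank ℝ EM)))
      := by
    simp
  let L := ContinuousLinearEquiv.ofFinrankEq hL
  refine ⟨(extChartAt 𝓘(ℝ, EM) p).source ×ˢ univ, (isOpen_extChartAt_source p).prod isOpen_univ,
    ⟨by rw [mem_singleton_iff.1 hx.1]; exact mem_extChartAt_source p, mem_univ _⟩,
    Module.finrank ℝ EM, fun x => L (extChartAt 𝓘(ℝ, EM) p x.1 - extChartAt 𝓘(ℝ, EM) p p),
    ?_, ?_, ?_⟩
  · have h1 : ContMDiffOn (𝓘(ℝ, EM).prod 𝓘(ℝ, EY)) 𝓘(ℝ, EM) ∞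
        (fun x : M × Y => extChartAt 𝓘(ℝ, EM) p x.1) ((extChartAt 𝓘(ℝ, EM) p).source ×ˢ univ) := by
      refine (contMDiffOn_extChartAt (n := ∞) (x := p)).comp contMDiff_fst.contMDiffOn ?_
      intro y hy
      simpa using hy.1
    have h2 : ContDiff ℝ ∞ fun e : EM => L (e - extChartAt 𝓘(ℝ, EM) p p) :=
      L.contDiff.comp (contDiff_id.sub contDiff_const)
    exact h2.contMDiff.comp_contMDiffOn h1
  · ext y
    constructor
    · rintro ⟨hy, hU⟩
      refine ⟨hU, ?_⟩
      have h1 : y.1 = p := hy.1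
      change L (extChartAt 𝓘(ℝ, EM) p y.1 - extChartAt 𝓘(ℝ, EM) p p) = 0
      rw [h1, sub_self, map_zero]
    · rintro ⟨hU, hy⟩
      refine ⟨⟨?_, mem_univ _⟩, hU⟩
      have h1 := sub_eq_zero.1 ((map_eq_zero_iff L L.injective).1 hy)
      exact (extChartAt 𝓘(ℝ, EM) p).injOn hU.1 (mem_extChartAt_source p) h1
  · rintro ⟨q, b⟩ ⟨hq, -⟩
    obtain rfl : q = p := hq.1
    have h1 : HasMFDerivAt (𝓘(ℝ, EM).prod 𝓘(ℝ, EY)) 𝓘(ℝ, EM)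
        (fun x : M × Y => extChartAt 𝓘(ℝ, EM) q x.1) (q, b) _ :=
      HasMFDerivAt.comp (q, b) (mdifferentiableAt_extChartAt (mem_chart_source EM q)).hasMFDerivAt
        (hasMFDerivAt_fst (q, b))
    have h2 : HasFDerivAt (fun e : EM => L (e - extChartAt 𝓘(ℝ, EM) q q)) (L : EM →L[ℝ] _)
        (extChartAt 𝓘(ℝ, EM) q q) := L.hasFDerivAt.comp _ ((hasFDerivAt_id _).sub_const _)
    have h3 := (HasMFDerivAt.comp (q, b) h2.hasMFDerivAt h1).mfderiv
    have h4 : ∀ v : EM × EY, (mfderiv (𝓘(ℝ, EM).prod 𝓘(ℝ, EY))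
        𝓘(ℝ, EuclideanSpace ℝ (Fin (Module.finrank ℝ EM)))
        (fun x : M × Y => L (extChartAt 𝓘(ℝ, EM) q x.1 - extChartAt 𝓘(ℝ, EM) q q)) (q, b) :
          EM × EY →L[ℝ] EuclideanSpace ℝ (Fin (Module.finrank ℝ EM))) v = L v.1 := by
      intro v
      have h5 : (chartJac 𝓘(ℝ, EM) q q : EM →L[ℝ] EM) v.1 = v.1 := by
        rw [chartJac, chartDeriv_self]; rfl
      refine Eq.trans (congrArg (fun T : EM × EY →L[ℝ] EuclideanSpace ℝ (Fin (Module.finrank ℝ EM))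
          =>
        T v) h3) ?_
      exact congrArg L h5
    constructor
    · intro w
      refine ⟨((L.symm w, 0) : EM × EY), ?_⟩
      exact (h4 _).trans (L.apply_symm_apply w)
    · intro v hv
      have hv1 : (v : EM × EY).1 = 0 := (map_eq_zero_iff L L.injective).1 ((h4 v).symm.trans hv)
      refine (h4 _).trans ?_
      have h5 : ((twistedStructure (EY := EY) h φ (q, b) v : EM × EY)).1 =
        (toSphere (φ b) 0 • (h.I q : EM →L[ℝ] EM) + toSphere (φ b) 1 • (h.J q : EM →L[ℝ] EM) +
          toSphere (φ b) 2 • (h.K q : EM →L[ℝ] EM)) (v : EM × EY).1 := rfl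
      rw [h5, hv1]
      exact (congrArg L (map_zero (_ : EM →L[ℝ] EM))).trans (map_zero L)

end Total

/-! ### Forms of type `(N, 0)` -/

section TopForms

variable {E : Type*} [NormedAddCommGroup E] [NormedSpace ℝ E] {N : ℕ}

/-- The alternating form `l ∧ α` is of type `(N + 1, 0)` if `l` is complex linear and `α` is of type
`(N, 0)`, so that it vanishes if `N` is the complex dimension. -/
theorem wedge_eq_zero [FiniteDimensional ℝ E] {J : E →L[ℝ] E} (hJ : ∀ v, J (J v) = -v)
    (hN : Module.finrank ℝ E < 2 * (N + 1)) {α : E [⋀^Fin N]→L[ℝ] ℂ}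
    (hα : ∀ (v : Fin N → E) (i : Fin N), α (Function.update v i (J (v i))) = Complex.I * α v)
    {l : E →L[ℝ] ℂ} (hl : ∀ v, l (J v) = Complex.I * l v) (u : Fin (N + 1) → E) :
    ∑ i : Fin (N + 1), (-1 : ℂ) ^ (i : ℕ) * (l (u i) * α (i.removeNth u)) = 0 := by
  let f : E [⋀^Fin (N + 1)]→L[ℝ] ℂ := ContinuousAlternatingMap.alternatizeUncurryFin (l.smulRight α)
  have hf : ∀ u : Fin (N + 1) → E, f u = ∑ i : Fin (N + 1), (-1 : ℂ) ^ (i :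
      ℕ) * (l (u i) * α (i.removeNth u)) := by
    intro u
    rw [ContinuousAlternatingMap.alternatizeUncurryFin_apply]
    refine Finset.sum_congr rfl fun i _ => ?_
    rw [zsmul_eq_mul]
    push_cast
    rfl
  rw [← hf]
  refine alternating_eq_zero_of_finrank_lt (J : E →ₗ[ℝ] E) (LinearMap.ext hJ) f.toAlternatingMap ?_
    (by simpa using hN) u
  intro _ v i w
  have key : ∀ v : Fin (N + 1) → E, ∀ i, f (Function.update v i (J (v i))) = Complex.I * f v := by
    intro v i
    rw [hf, hf, Finset.mul_sum]
    refine Finset.sum_congr rfl fun k _ => ?_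
    rcases eq_or_ne k i with rfl | hk
    · have : k.removeNth (Function.update v k (J (v k))) = k.removeNth v := by
        ext j; simp [Fin.removeNth]
      rw [Function.update_self, hl, this]
      ring
    · obtain ⟨j, rfl⟩ := Fin.exists_succAbove_eq hk.symm
      have h1 : k.removeNth (Function.update v (k.succAbove j) (J (v (k.succAbove j)))) =
          Function.update (k.removeNth v) j (J (k.removeNth v j)) := by
        ext t
        rcases eq_or_ne t j with rfl | ht
        · simp [Fin.removeNth]
        · have : k.succAbove t ≠ k.succAbove j := fun h => ht (Fin.succAbove_right_injective h)
          simp [Fin.removeNth, ht, Function.update_of_ne this]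
      rw [Function.update_of_ne hk, h1, hα]
      ring
  have := key (Function.update v i w) i
  simp only [Function.update_self, Function.update_idem] at this
  convert this using 2 <;> rfl

/-- If `l ∧ α = 0` for a nonzero form `α` of type `(N, 0)` then `l` is complex linear. -/
theorem complexLinear_of_wedge {J : E →L[ℝ] E} {α : E [⋀^Fin N]→L[ℝ] ℂ}
    (hα : ∀ (v : Fin N → E) (i : Fin N), α (Function.update v i (J (v i))) = Complex.I * α v)
    {v : Fin N → E} (hv : α v ≠ 0) {l : E →L[ℝ] ℂ}
    (h : ∀ u : Fin (N + 1) → E,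
      ∑ i : Fin (N + 1), (-1 : ℂ) ^ (i : ℕ) * (l (u i) * α (i.removeNth u)) = 0) (w : E) :
    l (J w) = Complex.I * l w := by
  -- Evaluate on `(J w, v)` and on `(w, v)`. All terms in which `w` is an argument of `α` differ by
  -- the factor `i`, so the remaining terms, `l(J w) α(v)` and `i l(w) α(v)`, must agree.
  have h1 := h (Fin.cons (J w) v)
  have h2 := h (Fin.cons w v)
  rw [Fin.sum_univ_succ] at h1 h2
  simp only [Fin.cons_zero, Fin.cons_succ, Fin.removeNth_zero, Fin.tail_cons, Fin.val_zero,
      pow_zero,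
    one_mul] at h1 h2
  have h3 : ∀ i : Fin N, α (i.succ.removeNth (Fin.cons (J w) v : Fin (N + 1) → E)) =
      Complex.I * α (i.succ.removeNth (Fin.cons w v : Fin (N + 1) → E)) := by
    intro i
    obtain _ | N := N
    · exact i.elim0
    have := hα (i.succ.removeNth (Fin.cons w v : Fin (N + 2) → E)) 0
    rw [← this]
    congr 1
    ext k
    refine Fin.cases ?_ (fun k => ?_) k
    · simp [Fin.removeNth]
    · simp [Fin.removeNth]
  simp only [h3] at h1
  have h4 : (l (J w) - Complex.I * l w) * α v = 0 := by
    have : ∑ i : Fin N, (-1 : ℂ) ^ ((i.succ : Fin (N + 1)) : ℕ) * (l (v i) * (Complex.I *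
        α (i.succ.removeNth (Fin.cons w v : Fin (N + 1) → E)))) =
        Complex.I * ∑ i : Fin N, (-1 : ℂ) ^ ((i.succ : Fin (N + 1)) : ℕ) * (l (v i) *
        α (i.succ.removeNth (Fin.cons w v : Fin (N + 1) → E))) := by
      rw [Finset.mul_sum]
      exact Finset.sum_congr rfl fun i _ => by ring
    rw [this] at h1
    linear_combination h1 - Complex.I * h2
  exact sub_eq_zero.1 ((mul_eq_zero.1 h4).resolve_right hv)

theorem extDeriv_smul_apply {f : E → ℂ} {s : E → E [⋀^Fin N]→L[ℝ] ℂ} {x : E}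
    (hf : DifferentiableAt ℝ f x) (hs : DifferentiableAt ℝ s x) (u : Fin (N + 1) → E) :
    extDeriv (fun y => f y • s y) x u =
      ∑ i : Fin (N + 1), (-1 : ℂ) ^ (i : ℕ) * (fderiv ℝ f x (u i) * s x (i.removeNth u)) +
        f x * extDeriv s x u := by
  rw [extDeriv_apply (hf.fun_smul hs), extDeriv_apply hs, Finset.mul_sum, ← Finset.sum_add_distrib]
  refine Finset.sum_congr rfl fun i _ => ?_
  have hsi : DifferentiableAt ℝ (fun y => s y (i.removeNth u)) x :=
    (ContinuousAlternatingMap.apply ℝ E ℂ (i.removeNth u)).differentiableAt.comp x hs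
  simp only [ContinuousAlternatingMap.smul_apply, smul_eq_mul]
  rw [fderiv_fun_mul hf hsi, zsmul_eq_mul, zsmul_eq_mul]
  simp only [add_apply, smul_apply, smul_eq_mul]
  push_cast
  ring

end TopForms

/-! ### The canonical bundle -/

section CanonicalBundle

variable {E : Type*} [NormedAddCommGroup E] [NormedSpace ℝ E] [FiniteDimensional ℝ E]
  {H : Type*} [TopologicalSpace H] {I : ModelWithCorners ℝ E H}
  {X : Type*} [TopologicalSpace X] [ChartedSpace H X] [IsManifold I ∞ X] [I.Boundaryless]
  {J : ∀ x : X, TangentSpace I x →L[ℝ] TangentSpace I x}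

variable (I J) in
/-- The form underlying an element of a fibre of the canonical bundle. -/
def formVal (x : X) (a : (canonicalBundle I J).fiber x) :
    E [⋀^Fin (Module.finrank ℝ E / 2)]→L[ℝ] ℂ :=
  @Subtype.val _ (fun α => α ∈ holForms I J (Module.finrank ℝ E / 2) x) a

theorem formVal_type {x : X} (a : (canonicalBundle I J).fiber x)
    (v : Fin (Module.finrank ℝ E / 2) → E) (i : Fin (Module.finrank ℝ E / 2)) :
    formVal I J x a (Function.update v i ((J x : E →L[ℝ] E) (v i))) =
      Complex.I * formVal I J x a v :=
  @Subtype.property _ (fun α => α ∈ holForms I J (Module.finrank ℝ E / 2) x) a v i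

theorem formVal_injective {x : X} {a b : (canonicalBundle I J).fiber x}
    (h : formVal I J x a = formVal I J x b) : a = b :=
  @Subtype.ext _ (fun α => α ∈ holForms I J (Module.finrank ℝ E / 2) x) a b h

theorem formVal_smul {x : X} (c : ℂ) (a : (canonicalBundle I J).fiber x) :
    formVal I J x (c • a) = c • formVal I J x a := rfl

theorem formVal_zero {x : X} : formVal I J x 0 = 0 := rfl

variable (I J) in
/-- A section of the canonical bundle in the preferred chart at `x₀`. -/
def secInChart (s : ∀ x : X, (canonicalBundle I J).fiber x) (x₀ : X) (e : E) :
    E [⋀^Fin (Module.finrank ℝ E / 2)]→L[ℝ] ℂ :=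
  (formVal I J _ (s ((extChartAt I x₀).symm e))).compContinuousLinearMap (chartSymmJac I x₀ e)

variable (I J) in
/-- The holomorphy of a section of the canonical bundle at a point. -/
def IsHolFormAt (s : ∀ x : X, (canonicalBundle I J).fiber x) (x₀ : X) : Prop :=
  ContDiffAt ℝ ∞ (secInChart I J s x₀) (extChartAt I x₀ x₀) ∧
    extDeriv (secInChart I J s x₀) (extChartAt I x₀ x₀) = 0

theorem isHolFormAt_congr {s t : ∀ x : X, (canonicalBundle I J).fiber x} {x₀ : X}
    (h : ∀ᶠ x in 𝓝 x₀, s x = t x) (hs : IsHolFormAt I J s x₀) : IsHolFormAt I J t x₀ := by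
  have hcont : ContinuousAt (extChartAt I x₀).symm (extChartAt I x₀ x₀) :=
    continuousAt_extChartAt_symm x₀
  rw [ContinuousAt, extChartAt_to_inv] at hcont
  have hev : secInChart I J t x₀ =ᶠ[𝓝 (extChartAt I x₀ x₀)] secInChart I J s x₀ := by
    filter_upwards [hcont.eventually h] with e he
    simp only [secInChart, he]
  refine ⟨hs.1.congr_of_eventuallyEq hev, ?_⟩
  rw [hev.extDeriv_eq]
  exact hs.2

theorem secInChart_self (s : ∀ x : X, (canonicalBundle I J).fiber x) (x₀ : X) :
    secInChart I J s x₀ (extChartAt I x₀ x₀) = formVal I J x₀ (s x₀) := by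
  have h1 : chartSymmJac I x₀ (extChartAt I x₀ x₀) = ContinuousLinearMap.id ℝ E :=
    chartSymmDeriv_self x₀
  rw [secInChart, h1, extChartAt_to_inv]
  ext v
  rfl

variable (hJ : ∀ (x : X) (v : TangentSpace I x), J x (J x v) = -v)
  (hE : Module.finrank ℝ E = 2 * (Module.finrank ℝ E / 2))
include hJ hE

theorem holForms_proportional {x : X} {a b : (canonicalBundle I J).fiber x} (hb : b ≠ 0) :
    ∃ c : ℂ, a = c • b := by
  let A : E →L[ℝ] E := J x
  have hty' : ∀ (a : (canonicalBundle I J).fiber x) (v : Fin (Module.finrank ℝ E / 2) → E) i (w :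
      E),
      formVal I J x a (Function.update v i (A w)) =
        Complex.I * formVal I J x a (Function.update v i w) := by
    intro a v i w
    have h2 : Function.update (Function.update v i w) i (A (Function.update v i w i)) =
        Function.update v i (A w) := by
      rw [Function.update_self, Function.update_idem]
    rw [← h2]
    exact formVal_type a (Function.update v i w) i
  have hty : ∀ a : (canonicalBundle I J).fiber x,
      ∀ [DecidableEq (Fin (Module.finrank ℝ E / 2))] (v : Fin (Module.finrank ℝ E / 2) → E)
      (i : Fin (Module.finrank ℝ E / 2)) (w : E),
      formVal I J x a (Function.update v i (A w)) =
        Complex.I * formVal I J x a (Function.update v i w) := by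
    intro a _ v i w
    convert hty' a v i w
  obtain ⟨c, hc⟩ := alternating_proportional (A : E →ₗ[ℝ] E) (LinearMap.ext (hJ x))
      (formVal I J x a).toAlternatingMap (formVal I J x b).toAlternatingMap
    (hty a) (hty b) (by simpa using hE) (fun h => hb (formVal_injective (by
      ext v
      exact congrArg (fun f : E [⋀^Fin (Module.finrank ℝ E / 2)]→ₗ[ℝ] ℂ => f v) h)))
  exact ⟨c, formVal_injective (by ext v; exact hc v)⟩

theorem finrank_holForms {x : X} {b : (canonicalBundle I J).fiber x} (hb : b ≠ 0) :
    Module.finrank ℂ ((canonicalBundle I J).fiber x) = 1 :=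
  finrank_eq_one_iff'.2 ⟨b, hb, fun a => by
    obtain ⟨c, hc⟩ := holForms_proportional hJ hE (a := a) hb
    exact ⟨c, hc.symm⟩⟩

/-- Multiples of a nonvanishing holomorphic section are holomorphic if and only if the factor is. -/
theorem isHolFormAt_smul_iff {s : ∀ x : X, (canonicalBundle I J).fiber x} {x₀ : X}
    (hs : IsHolFormAt I J s x₀) (h0 : s x₀ ≠ 0) (f : X → ℂ) :
    IsHolFormAt I J (fun x => f x • s x) x₀ ↔ ContMDiffAt I 𝓘(ℝ, ℂ) ∞ f x₀ ∧
      ∀ v : TangentSpace I x₀, dFun I f x₀ (J x₀ v) = Complex.I * dFun I f x₀ v := by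
  have hsec : secInChart I J (fun x => f x • s x) x₀ =
      fun e => f ((extChartAt I x₀).symm e) • secInChart I J s x₀ e := by
    ext e v
    rfl
  obtain ⟨v, hv⟩ : ∃ v, secInChart I J s x₀ (extChartAt I x₀ x₀) v ≠ 0 := by
    by_contra! h
    rw [secInChart_self] at h
    exact h0 (formVal_injective (ContinuousAlternatingMap.ext h))
  have hty : ∀ (v : Fin (Module.finrank ℝ E / 2) → E) (i : Fin (Module.finrank ℝ E / 2)),
      secInChart I J s x₀ (extChartAt I x₀ x₀) (Function.update v i ((J x₀ : E →L[ℝ] E) (v i))) =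
        Complex.I * secInChart I J s x₀ (extChartAt I x₀ x₀) v := by
    rw [secInChart_self]
    exact formVal_type (s x₀)
  have hsm : ContDiffAt ℝ ∞ (secInChart I J (fun x => f x • s x) x₀) (extChartAt I x₀ x₀) ↔
      ContMDiffAt I 𝓘(ℝ, ℂ) ∞ f x₀ := by
    rw [contMDiffAt_iff_contDiffAt_chart, hsec]
    -- The factor `f` is recovered as the quotient of the coefficients of `f s` and `s` on vectors
    -- where the latter does not vanish.
    refine ⟨fun h => ?_, fun h => h.smul hs.1⟩
    have h1 := contDiffAt_alternating_apply h v
    have h2 := contDiffAt_alternating_apply hs.1 v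
    refine (h1.mul (h2.inv hv)).congr_of_eventuallyEq ?_
    filter_upwards [h2.continuousAt.eventually_ne hv] with e he
    exact (mul_inv_cancel_right₀ he _).symm
  rw [IsHolFormAt, hsm]
  refine and_congr_right fun hf => ?_
  have hfm : MDifferentiableAt I 𝓘(ℝ, ℂ) f x₀ := hf.mdifferentiableAt (by simp)
  have hfd : DifferentiableAt ℝ (fun e => f ((extChartAt I x₀).symm e)) (extChartAt I x₀ x₀) :=
    (contMDiffAt_iff_contDiffAt_chart.1 hf).differentiableAt (by simp)
  -- As `s` is closed at `x₀`, `d(f s)` is `df ∧ s` there. It vanishes exactly when `df` is complex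
  -- linear, by `complexLinear_of_wedge` and `wedge_eq_zero`.
  have hext : ∀ u, extDeriv (secInChart I J (fun x => f x • s x) x₀) (extChartAt I x₀ x₀) u =
      ∑ i : Fin (Module.finrank ℝ E / 2 + 1), (-1 : ℂ) ^ (i : ℕ) *
        (fderiv ℝ (fun e => f ((extChartAt I x₀).symm e)) (extChartAt I x₀ x₀) (u i) *
          secInChart I J s x₀ (extChartAt I x₀ x₀) (i.removeNth u)) := by
    intro u
    rw [hsec, extDeriv_smul_apply hfd (hs.1.differentiableAt (by simp)), hs.2]
    simp
  have hdf := dFun_eq_fderiv hfm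
  constructor
  · intro h w
    have h1 := complexLinear_of_wedge hty hv
      (l := fderiv ℝ (fun e => f ((extChartAt I x₀).symm e)) (extChartAt I x₀ x₀))
      (fun u => by rw [← hext, h]; rfl) w
    exact (hdf _).trans (h1.trans (congrArg (Complex.I * ·) (hdf w).symm))
  · intro h
    ext u
    rw [hext]
    refine wedge_eq_zero (E := E) (J := J x₀) (hJ x₀) (by omega) hty ?_ u
    intro w
    exact (hdf _).symm.trans ((h w).trans (congrArg (Complex.I * ·) (hdf w)))

/-- The fibres are lines, so a coefficient relative to `e` exists pointwise; `isHolFormAt_smul_iff`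
says when it is holomorphic. Hence any closed nowhere vanishing section is a frame. -/
theorem isHol_canonicalBundle_iff_of_frame {U V : Set X} (hU : IsOpen U) (hUV : U ⊆ V)
    {e : ∀ x : X, (canonicalBundle I J).fiber x} (he : (canonicalBundle I J).IsHol V e)
    (he0 : ∀ y ∈ V, e y ≠ 0) (s : ∀ x : X, (canonicalBundle I J).fiber x) :
    (canonicalBundle I J).IsHol U s ↔ ∃ f : X → ℂ, IsHolFun I J U f ∧ ∀ y ∈ U, s y = f y • e y := by
  constructor
  · intro hs
    have hprop : ∀ y, ∃ c : ℂ, y ∈ U → s y = c • e y := fun y => by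
      by_cases hy : y ∈ U
      · obtain ⟨c, hc⟩ := holForms_proportional hJ hE (a := s y) (he0 y (hUV hy))
        exact ⟨c, fun _ => hc⟩
      · exact ⟨0, fun h => absurd h hy⟩
    choose f hf using hprop
    refine ⟨f, fun x hx => ?_, hf⟩
    refine (isHolFormAt_smul_iff hJ hE (he x (hUV hx)) (he0 x (hUV hx)) f).1 ?_
    exact isHolFormAt_congr (Filter.eventually_of_mem (hU.mem_nhds hx) hf) (hs x hx)
  · rintro ⟨f, hf, hs⟩ x hx
    exact isHolFormAt_congr (Filter.eventually_of_mem (hU.mem_nhds hx) fun y hy => (hs y hy).symm)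
      ((isHolFormAt_smul_iff hJ hE (he x (hUV hx)) (he0 x (hUV hx)) f).2 (hf x hx))

theorem isHolLineBundle_canonicalBundle
    (h : ∀ x : X, ∃ V : Set X, IsOpen V ∧ x ∈ V ∧ ∃ e : ∀ x : X, (canonicalBundle I J).fiber x,
      (canonicalBundle I J).IsHol V e ∧ ∀ y ∈ V, e y ≠ 0) :
    IsHolLineBundle (IsHolFun I J) (canonicalBundle I J) := by
  constructor
  · intro x
    obtain ⟨V, -, hx, e, -, he⟩ := h x
    exact finrank_holForms hJ hE (he x hx)
  · intro x
    obtain ⟨V, hV, hx, e, he, he0⟩ := h x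
    exact ⟨V, hV, hx, e, he0, fun U hU hUV s =>
      isHol_canonicalBundle_iff_of_frame hJ hE hU hUV he he0 s⟩

end CanonicalBundle

/-! ### Holomorphic functions -/

section HolFun

variable {E : Type*} [NormedAddCommGroup E] [NormedSpace ℝ E]
  {H : Type*} [TopologicalSpace H] {I : ModelWithCorners ℝ E H}
  {X : Type*} [TopologicalSpace X] [ChartedSpace H X] [IsManifold I ∞ X] [I.Boundaryless]
  {J : ∀ x : X, TangentSpace I x →L[ℝ] TangentSpace I x}

theorem IsHolFun.mono {U V : Set X} {f : X → ℂ} (hf : IsHolFun I J V f) (h : U ⊆ V) :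
    IsHolFun I J U f := fun x hx => hf x (h hx)

theorem isHolFun_const (U : Set X) (c : ℂ) : IsHolFun I J U (fun _ => c) := by
  intro x _
  refine ⟨contMDiffAt_const, fun v => ?_⟩
  have h : dFun I (fun _ : X => c) x = 0 := mfderiv_const
  rw [h]
  simp

theorem IsHolFun.mul {U : Set X} {f g : X → ℂ} (hf : IsHolFun I J U f) (hg : IsHolFun I J U g) :
    IsHolFun I J U (fun x => f x * g x) := by
  intro x hx
  obtain ⟨hf1, hf2⟩ := hf x hx
  obtain ⟨hg1, hg2⟩ := hg x hx
  have hfg : ContMDiffAt I 𝓘(ℝ, ℂ) ∞ (fun x => f x * g x) x := by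
    rw [contMDiffAt_iff_contDiffAt_chart] at hf1 hg1 ⊢
    exact hf1.mul hg1
  refine ⟨hfg, ?_⟩
  have hm : ∀ {f : X → ℂ}, ContMDiffAt I 𝓘(ℝ, ℂ) ∞ f x → DifferentiableAt ℝ
      (fun e => f ((extChartAt I x).symm e)) (extChartAt I x x) := fun h =>
    (contMDiffAt_iff_contDiffAt_chart.1 h).differentiableAt (by simp)
  have key : ∀ w : E, dFun I (fun x => f x * g x) x w = f x * dFun I g x w + g x * dFun I f x w :=
      by
    intro w
    rw [dFun_eq_fderiv (hfg.mdifferentiableAt (by simp)),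
      dFun_eq_fderiv (hf1.mdifferentiableAt (by simp)),
      dFun_eq_fderiv (hg1.mdifferentiableAt (by simp)), fderiv_fun_mul (hm hf1) (hm hg1)]
    simp only [add_apply, smul_apply, smul_eq_mul, extChartAt_to_inv]
  intro v
  have h1 := key (J x v)
  have h2 := key v
  refine h1.trans ?_
  refine Eq.trans ?_ (congrArg (Complex.I * ·) h2).symm
  have h3 := hf2 v
  have h4 := hg2 v
  linear_combination f x * h4 + g x * h3

end HolFun

/-! ### The canonical bundle of a complex manifold -/

section ComplexManifold

variable {E : Type*} [NormedAddCommGroup E] [NormedSpace ℂ E]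

theorem differentiableAt_complex_of_real {f : E → ℂ} {x : E} (hf : DifferentiableAt ℝ f x)
    (h : ∀ v, fderiv ℝ f x (Complex.I • v) = Complex.I * fderiv ℝ f x v) :
    DifferentiableAt ℂ f x := by
  let L : E →L[ℂ] ℂ :=
    { toFun := fderiv ℝ f x
      map_add' := map_add _
      map_smul' := fun c v => by
        have hc : c • v = c.re • v + c.im • (Complex.I • v) := by
          rw [← Complex.coe_smul, ← Complex.coe_smul, smul_smul, ← add_smul, Complex.re_add_im]
        rw [hc, map_add, map_smul, map_smul, h, RingHom.id_apply, smul_eq_mul, Complex.real_smul,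
          Complex.real_smul]
        linear_combination (fderiv ℝ f x v) * Complex.re_add_im c
      cont := (fderiv ℝ f x).cont }
  exact (hasFDerivAt_of_restrictScalars ℝ hf.hasFDerivAt (f' := L)
      (ContinuousLinearMap.ext fun _ => rfl)).differentiableAt

variable [FiniteDimensional ℂ E]

variable (E) in
theorem finrank_complex : Module.finrank ℝ E = 2 * (Module.finrank ℝ E / 2) := by
  rw [finrank_real_of_complex]
  omega

variable (E) in
/-- A complex volume form. -/
theorem exists_volume : ∃ (δ : E [⋀^Fin (Module.finrank ℝ E / 2)]→L[ℝ] ℂ)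
    (d : ContinuousMultilinearMap ℂ (fun _ : Fin (Module.finrank ℝ E / 2) => E) ℂ),
    (∀ v, δ v = d v) ∧ δ ≠ 0 ∧ ∀ (v : Fin (Module.finrank ℝ E / 2) → E) (i :
        Fin (Module.finrank ℝ E / 2)),
      δ (Function.update v i (Complex.I • v i)) = Complex.I * δ v := by
  have hfd : FiniteDimensional ℝ E := FiniteDimensional.complexToReal E
  have hn : Module.finrank ℂ E = Module.finrank ℝ E / 2 := by
    rw [finrank_real_of_complex]
    omega
  let b := Module.finBasisOfFinrankEq ℂ E hn
  let d : E [⋀^Fin (Module.finrank ℝ E / 2)]→ₗ[ℂ] ℂ := b.det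
  have hcont : Continuous d := by
    have : ⇑d = fun v => (Matrix.of fun i j => b.repr (v j) i).det := by
      ext v
      exact b.det_apply v
    rw [this]
    refine Continuous.matrix_det (continuous_matrix fun i j => ?_)
    exact (LinearMap.continuous_of_finiteDimensional (b.coord i)).comp (continuous_apply j)
  let δ : E [⋀^Fin (Module.finrank ℝ E / 2)]→L[ℝ] ℂ :=
    { toFun := d
      map_update_add' := fun v i x y => d.map_update_add v i x y
      map_update_smul' := fun v i c x => by
        have := d.map_update_smul v i (c : ℂ) x
        rw [Complex.coe_smul] at this
        rw [this, Complex.real_smul, smul_eq_mul]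
      map_eq_zero_of_eq' := fun v i j h hij => d.map_eq_zero_of_eq v h hij
      cont := by
        exact hcont }
  -- The same determinant is kept both as a real form and as a complex multilinear map; the latter
  -- is what can be differentiated over `ℂ`.
  refine ⟨δ, ⟨d.toMultilinearMap, hcont⟩, fun v => rfl, fun h => ?_, fun v i => ?_⟩
  · have h1 : δ b = 1 := b.det_self
    rw [h] at h1
    simp at h1
  · have := d.map_update_smul v i Complex.I (v i)
    rw [Function.update_eq_self] at this
    exact this

omit [FiniteDimensional ℂ E]

theorem type_proportional [FiniteDimensional ℂ E] {a b : E [⋀^Fin (Module.finrank ℝ E / 2)]→L[ℝ] ℂ}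
    (ha : ∀ (v : Fin (Module.finrank ℝ E / 2) → E) (i : Fin (Module.finrank ℝ E / 2)),
      a (Function.update v i (Complex.I • v i)) = Complex.I * a v)
    (hb : ∀ (v : Fin (Module.finrank ℝ E / 2) → E) (i : Fin (Module.finrank ℝ E / 2)),
      b (Function.update v i (Complex.I • v i)) = Complex.I * b v) (hb0 : b ≠ 0) :
    ∃ c : ℂ, a = c • b := by
  have hfd : FiniteDimensional ℝ E := FiniteDimensional.complexToReal E
  let A : E →L[ℝ] E := (Complex.I • ContinuousLinearMap.id ℂ E).restrictScalars ℝ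
  have hty : ∀ a : E [⋀^Fin (Module.finrank ℝ E / 2)]→L[ℝ] ℂ, (∀ v i,
      a (Function.update v i (Complex.I • v i)) = Complex.I * a v) → ∀ v i (w : E),
      a (Function.update v i (A w)) = Complex.I * a (Function.update v i w) := by
    intro a ha v i w
    have := ha (Function.update v i w) i
    rwa [Function.update_self, Function.update_idem] at this
  obtain ⟨c, hc⟩ := alternating_proportional (A : E →ₗ[ℝ] E)
    (LinearMap.ext fun v => by
      change Complex.I • Complex.I • v = -v
      rw [smul_smul, Complex.I_mul_I, neg_one_smul])
    a.toAlternatingMap b.toAlternatingMap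
    (fun {inst} v i w => by
      obtain rfl : inst = instDecidableEqFin _ := Subsingleton.elim _ _
      exact hty a ha v i w)
    (fun {inst} v i w => by
      obtain rfl : inst = instDecidableEqFin _ := Subsingleton.elim _ _
      exact hty b hb v i w)
    (by simpa using finrank_complex E) (fun h => hb0 (by
      ext v
      exact congrArg (fun f : E [⋀^Fin (Module.finrank ℝ E / 2)]→ₗ[ℝ] ℂ => f v) h))
  exact ⟨c, by ext v; exact hc v⟩

variable {Y : Type*} [TopologicalSpace Y] [ChartedSpace E Y] [IsManifold 𝓘(ℂ, E) ω Y]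

theorem isHolFun_of_differentiableAt [FiniteDimensional ℂ E] {f : Y → ℂ} {y₀ : Y}
    (hf : ∀ᶠ e in 𝓝 (extChartAt 𝓘(ℝ, E) y₀ y₀),
      DifferentiableAt ℂ (fun e => f ((extChartAt 𝓘(ℝ, E) y₀).symm e)) e) :
    ContMDiffAt 𝓘(ℝ, E) 𝓘(ℝ, ℂ) ∞ f y₀ ∧ ∀ v : TangentSpace 𝓘(ℝ, E) y₀,
      dFun 𝓘(ℝ, E) f y₀ (complexMul y₀ v) = Complex.I * dFun 𝓘(ℝ, E) f y₀ v := by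
  have hsm : ContMDiffAt 𝓘(ℝ, E) 𝓘(ℝ, ℂ) ∞ f y₀ :=
    contMDiffAt_iff_contDiffAt_chart.2
      ((contDiffAt_of_eventually_differentiableAt hf).restrict_scalars ℝ)
  refine ⟨hsm, fun v => ?_⟩
  have key := dFun_eq_fderiv (hsm.mdifferentiableAt (by simp))
  have h1 : ∀ v : E, fderiv ℝ (fun e => f ((extChartAt 𝓘(ℝ, E) y₀).symm e))
      (extChartAt 𝓘(ℝ, E) y₀ y₀) (Complex.I • v) = Complex.I * fderiv ℝ
      (fun e => f ((extChartAt 𝓘(ℝ, E) y₀).symm e)) (extChartAt 𝓘(ℝ, E) y₀ y₀) v := by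
    intro v
    rw [hf.self_of_nhds.fderiv_restrictScalars ℝ]
    simp
  exact (key _).trans ((h1 v).trans (congrArg (Complex.I * ·) (key v)).symm)

theorem comp_type {n : ℕ} {a : E [⋀^Fin n]→L[ℝ] ℂ}
    (ha : ∀ (v : Fin n → E) (i : Fin n),
      a (Function.update v i (Complex.I • v i)) = Complex.I * a v) {S : E →L[ℝ] E}
    (hS : ∀ v, S (Complex.I • v) = Complex.I • S v) (v : Fin n → E) (i : Fin n) :
    a.compContinuousLinearMap S (Function.update v i (Complex.I • v i)) =
      Complex.I * a.compContinuousLinearMap S v := by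
  rw [ContinuousAlternatingMap.compContinuousLinearMap_apply,
    ContinuousAlternatingMap.compContinuousLinearMap_apply, ← ha (S ∘ v) i]
  congr 1
  ext j
  rcases eq_or_ne j i with rfl | hj
  · simp only [Function.comp_apply, Function.update_self, hS]
  · simp only [Function.comp_apply, Function.update_of_ne hj]

theorem secInChart_type [FiniteDimensional ℂ E]
    {s : ∀ y : Y, (canonicalBundle 𝓘(ℝ, E) (complexMul (E := E) (Y := Y))).fiber y}
    {y₀ : Y} {e : E} (he : e ∈ (extChartAt 𝓘(ℝ, E) y₀).target)
    (v : Fin (Module.finrank ℝ E / 2) → E) (i : Fin (Module.finrank ℝ E / 2)) :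
    secInChart 𝓘(ℝ, E) complexMul s y₀ e (Function.update v i (Complex.I • v i)) =
      Complex.I * secInChart 𝓘(ℝ, E) complexMul s y₀ e v :=
  have : FiniteDimensional ℝ E := FiniteDimensional.complexToReal E
  comp_type (formVal_type (s ((extChartAt 𝓘(ℝ, E) y₀).symm e))) (chartSymmJac_complex he) v i

theorem extDeriv_smul_const {n : ℕ} {h : E → ℂ} {x : E} (hh : DifferentiableAt ℝ h x)
    (δ : E [⋀^Fin n]→L[ℝ] ℂ) (u : Fin (n + 1) → E) :
    extDeriv (fun e => h e • δ) x u =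
      ∑ i : Fin (n + 1), (-1 : ℂ) ^ (i : ℕ) * (fderiv ℝ h x (u i) * δ (i.removeNth u)) := by
  rw [extDeriv_smul_apply hh (differentiableAt_const δ), extDeriv_apply (differentiableAt_const δ)]
  simp

/-- If `h` is holomorphic then `dh ∧ δ` has one complex linear slot more than the dimension, hence
vanishes. -/
theorem isHolFormAt_of_chart [FiniteDimensional ℂ E]
    {s : ∀ y : Y, (canonicalBundle 𝓘(ℝ, E) (complexMul (E := E) (Y := Y))).fiber y} {y₀ : Y}
    {δ : E [⋀^Fin (Module.finrank ℝ E / 2)]→L[ℝ] ℂ} {h : E → ℂ}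
    (hδ : ∀ (v : Fin (Module.finrank ℝ E / 2) → E) (i : Fin (Module.finrank ℝ E / 2)),
      δ (Function.update v i (Complex.I • v i)) = Complex.I * δ v)
    (hs : secInChart 𝓘(ℝ, E) complexMul s y₀ =ᶠ[𝓝 (extChartAt 𝓘(ℝ, E) y₀ y₀)] fun e => h e • δ)
    (hh : ∀ᶠ e in 𝓝 (extChartAt 𝓘(ℝ, E) y₀ y₀), DifferentiableAt ℂ h e) :
    IsHolFormAt 𝓘(ℝ, E) complexMul s y₀ := by
  have hfd : FiniteDimensional ℝ E := FiniteDimensional.complexToReal E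
  have hsm : ContDiffAt ℝ ∞ h (extChartAt 𝓘(ℝ, E) y₀ y₀) :=
    (contDiffAt_of_eventually_differentiableAt hh).restrict_scalars ℝ
  refine ⟨(hsm.smul contDiffAt_const).congr_of_eventuallyEq hs, ?_⟩
  rw [hs.extDeriv_eq]
  ext u
  rw [extDeriv_smul_const (hsm.differentiableAt (by simp))]
  refine wedge_eq_zero (J := (Complex.I • ContinuousLinearMap.id ℂ E).restrictScalars ℝ) ?_ ?_ hδ
    ?_ u
  · intro v
    change Complex.I • Complex.I • v = -v
    rw [smul_smul, Complex.I_mul_I, neg_one_smul]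
  · have := finrank_complex E
    omega
  · intro v
    rw [hh.self_of_nhds.fderiv_restrictScalars ℝ]
    simp

/-- All forms of top type are multiples of `δ`, and closedness at the centre reads `dh ∧ δ = 0`, the
Cauchy-Riemann equation for `h`. The hypothesis concerns one point only, and so does the complex
differentiability obtained. -/
theorem IsHolFormAt.exists_chart [FiniteDimensional ℂ E]
    {s : ∀ y : Y, (canonicalBundle 𝓘(ℝ, E) (complexMul (E := E) (Y := Y))).fiber y} {y₀ : Y}
    (hs : IsHolFormAt 𝓘(ℝ, E) complexMul s y₀)
    {δ : E [⋀^Fin (Module.finrank ℝ E / 2)]→L[ℝ] ℂ} (hδ0 : δ ≠ 0)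
    (hδ : ∀ (v : Fin (Module.finrank ℝ E / 2) → E) (i : Fin (Module.finrank ℝ E / 2)),
      δ (Function.update v i (Complex.I • v i)) = Complex.I * δ v) :
    ∃ h : E → ℂ, ContDiffAt ℝ ∞ h (extChartAt 𝓘(ℝ, E) y₀ y₀) ∧
      DifferentiableAt ℂ h (extChartAt 𝓘(ℝ, E) y₀ y₀) ∧
      secInChart 𝓘(ℝ, E) complexMul s y₀ =ᶠ[𝓝 (extChartAt 𝓘(ℝ, E) y₀ y₀)] fun e => h e • δ := by
  obtain ⟨v, hv⟩ : ∃ v, δ v ≠ 0 := by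
    by_contra! h
    exact hδ0 (ContinuousAlternatingMap.ext h)
  have hev : secInChart 𝓘(ℝ, E) complexMul s y₀ =ᶠ[𝓝 (extChartAt 𝓘(ℝ, E) y₀ y₀)]
      fun e => (secInChart 𝓘(ℝ, E) complexMul s y₀ e v * (δ v)⁻¹) • δ := by
    filter_upwards [extChartAt_target_mem_nhds (I := 𝓘(ℝ, E)) y₀] with e he
    obtain ⟨c, hc⟩ := type_proportional (secInChart_type (s := s) he) hδ hδ0
    rw [hc, ContinuousAlternatingMap.smul_apply, smul_eq_mul, mul_inv_cancel_right₀ hv]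
  have hsm : ContDiffAt ℝ ∞ (fun e => secInChart 𝓘(ℝ, E) complexMul s y₀ e v * (δ v)⁻¹)
      (extChartAt 𝓘(ℝ, E) y₀ y₀) :=
    (contDiffAt_alternating_apply hs.1 v).mul contDiffAt_const
  refine ⟨_, hsm, ?_, hev⟩
  have hd := hsm.differentiableAt (n := ∞) (by simp)
  refine differentiableAt_complex_of_real hd fun w => ?_
  refine complexLinear_of_wedge
    (J := (Complex.I • ContinuousLinearMap.id ℂ E).restrictScalars ℝ) hδ hv ?_ w
  intro u
  rw [← extDeriv_smul_const hd, ← hev.extDeriv_eq, hs.2]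
  rfl

open Classical in
/-- The local frame of the canonical bundle given by the complex volume form `δ` in the preferred
chart at `y₀`. -/
def volumeFrame (δ : E [⋀^Fin (Module.finrank ℝ E / 2)]→L[ℝ] ℂ)
    (hδ : ∀ (v : Fin (Module.finrank ℝ E / 2) → E) (i : Fin (Module.finrank ℝ E / 2)),
      δ (Function.update v i (Complex.I • v i)) = Complex.I * δ v) (y₀ y : Y) :
    (canonicalBundle 𝓘(ℝ, E) (complexMul (E := E) (Y := Y))).fiber y :=
  if hy : y ∈ (extChartAt 𝓘(ℝ, E) y₀).source then
    (⟨δ.compContinuousLinearMap (chartJac 𝓘(ℝ, E) y₀ y), comp_type hδ (chartJac_complex hy)⟩ :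
      holForms 𝓘(ℝ, E) complexMul (Module.finrank ℝ E / 2) y)
  else 0

section Frame

variable {δ : E [⋀^Fin (Module.finrank ℝ E / 2)]→L[ℝ] ℂ}
    (hδ : ∀ (v : Fin (Module.finrank ℝ E / 2) → E) (i : Fin (Module.finrank ℝ E / 2)),
      δ (Function.update v i (Complex.I • v i)) = Complex.I * δ v)

theorem formVal_volumeFrame {y₀ y : Y} (hy : y ∈ (extChartAt 𝓘(ℝ, E) y₀).source) :
    formVal 𝓘(ℝ, E) complexMul y (volumeFrame δ hδ y₀ y) =
      δ.compContinuousLinearMap (chartJac 𝓘(ℝ, E) y₀ y) :=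
  congrArg (formVal 𝓘(ℝ, E) complexMul y) (dif_pos hy)

theorem volumeFrame_ne_zero [FiniteDimensional ℂ E] (hδ0 : δ ≠ 0) {y₀ y : Y} (hy :
    y ∈ (extChartAt 𝓘(ℝ, E) y₀).source) :
    volumeFrame δ hδ y₀ y ≠ 0 := by
  intro h
  have hfd : FiniteDimensional ℝ E := FiniteDimensional.complexToReal E
  have h1 := formVal_volumeFrame hδ hy
  rw [h, formVal_zero] at h1
  apply hδ0
  have he : extChartAt 𝓘(ℝ, E) y₀ y ∈ (extChartAt 𝓘(ℝ, E) y₀).target :=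
    (extChartAt 𝓘(ℝ, E) y₀).map_source hy
  ext v
  have h2 := congrArg (fun f => f fun j => chartSymmJac 𝓘(ℝ, E) y₀ (extChartAt 𝓘(ℝ, E) y₀ y)
      (v j)) h1
  have h3 : ∀ w, chartJac 𝓘(ℝ, E) y₀ y (chartSymmJac 𝓘(ℝ, E) y₀ (extChartAt 𝓘(ℝ, E) y₀ y) w) = w :=
      by
    intro w
    have := chartJac_chartSymmJac he w
    rwa [(extChartAt 𝓘(ℝ, E) y₀).left_inv hy] at this
  simp only [ContinuousAlternatingMap.compContinuousLinearMap_apply, Function.comp_def, h3] at h2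
  exact h2.symm

theorem chartJac_comp_chartSymmJac {y₀ y₁ : Y} {e : E}
    (he : e ∈ (extChartAt 𝓘(ℝ, E) y₁).target ∩
        (extChartAt 𝓘(ℝ, E) y₁).symm ⁻¹' (extChartAt 𝓘(ℝ, E) y₀).source) (v : E) :
    chartJac 𝓘(ℝ, E) y₀ ((extChartAt 𝓘(ℝ, E) y₁).symm e) (chartSymmJac 𝓘(ℝ, E) y₁ e v) =
      fderiv ℂ (fun e => extChartAt 𝓘(ℝ, E) y₀ ((extChartAt 𝓘(ℝ, E) y₁).symm e)) e v := by
  have h1 : MDifferentiableAt 𝓘(ℝ, E) 𝓘(ℝ, E) (extChartAt 𝓘(ℝ, E) y₀)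
      ((extChartAt 𝓘(ℝ, E) y₁).symm e) :=
    mdifferentiableAt_extChartAt (by have := he.2; rwa [mem_preimage, extChartAt_source] at this)
  have h2 : MDifferentiableAt 𝓘(ℝ, E) 𝓘(ℝ, E) (extChartAt 𝓘(ℝ, E) y₁).symm e :=
    ((contMDiffOn_extChartAt_symm (n := ∞) y₁).mdifferentiableOn (by simp) e he.1).mdifferentiableAt
      ((isOpen_extChartAt_target y₁).mem_nhds he.1)
  have h3 := mfderiv_comp e h1 h2
  rw [mfderiv_eq_fderiv] at h3
  have h4 := ((contDiffOn_coordChange y₀ y₁).differentiableOn (by simp)).differentiableAt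
    ((isOpen_coordChange_source y₀ y₁).mem_nhds he)
  have h5 := h4.fderiv_restrictScalars ℝ
  refine Eq.trans ?_ (congrArg (fun L : E →L[ℝ] E => L v) h5)
  exact (congrArg (fun L : E →L[ℝ] E => L v) h3).symm

/-- In the chart at `y₁` the coefficient of the frame is the Jacobian determinant of a holomorphic
coordinate change. -/
theorem isHolFormAt_volumeFrame [FiniteDimensional ℂ E]
    {d : ContinuousMultilinearMap ℂ (fun _ : Fin (Module.finrank ℝ E / 2) => E) ℂ}
    (hd : ∀ v, δ v = d v) (hδ0 : δ ≠ 0) {y₀ y₁ : Y}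
    (hy : y₁ ∈ (extChartAt 𝓘(ℝ, E) y₀).source) :
    IsHolFormAt 𝓘(ℝ, E) complexMul (volumeFrame δ hδ y₀) y₁ := by
  obtain ⟨v, hv⟩ : ∃ v, δ v ≠ 0 := by
    by_contra! h
    exact hδ0 (ContinuousAlternatingMap.ext h)
  have hopen := (isOpen_coordChange_source y₀ y₁).mem_nhds
    (⟨mem_extChartAt_target y₁, by rw [mem_preimage, extChartAt_to_inv]; exact hy⟩ :
      extChartAt 𝓘(ℝ, E) y₁ y₁ ∈ (extChartAt 𝓘(ℝ, E) y₁).target ∩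
        (extChartAt 𝓘(ℝ, E) y₁).symm ⁻¹' (extChartAt 𝓘(ℝ, E) y₀).source)
  have hval : ∀ e ∈ (extChartAt 𝓘(ℝ, E) y₁).target ∩
        (extChartAt 𝓘(ℝ, E) y₁).symm ⁻¹' (extChartAt 𝓘(ℝ, E) y₀).source,
      ∀ w, secInChart 𝓘(ℝ, E) complexMul (volumeFrame δ hδ y₀) y₁ e w = δ fun j =>
        fderiv ℂ (fun e => extChartAt 𝓘(ℝ, E) y₀ ((extChartAt 𝓘(ℝ, E) y₁).symm e)) e (w j) := by
    intro e he w
    rw [secInChart, formVal_volumeFrame hδ he.2]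
    simp only [ContinuousAlternatingMap.compContinuousLinearMap_apply, Function.comp_def,
      chartJac_comp_chartSymmJac he]
  refine isHolFormAt_of_chart (h := fun e => (δ fun j =>
    fderiv ℂ (fun e => extChartAt 𝓘(ℝ, E) y₀ ((extChartAt 𝓘(ℝ, E) y₁).symm e)) e (v j)) * (δ v)⁻¹)
    hδ ?_ ?_
  · filter_upwards [hopen] with e he
    obtain ⟨c, hc⟩ := type_proportional (secInChart_type (s := volumeFrame δ hδ y₀) he.1) hδ hδ0
    rw [← hval e he v, hc, ContinuousAlternatingMap.smul_apply, smul_eq_mul,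
      mul_inv_cancel_right₀ hv]
  · filter_upwards [hopen] with e he
    simp only [hd]
    have h1 : ContDiffAt ℂ ω (fun e => extChartAt 𝓘(ℝ, E) y₀ ((extChartAt 𝓘(ℝ, E) y₁).symm e)) e :=
      (contDiffOn_coordChange y₀ y₁).contDiffAt ((isOpen_coordChange_source y₀ y₁).mem_nhds he)
    have h2 : DifferentiableAt ℂ (fderiv ℂ fun e =>
        extChartAt 𝓘(ℝ, E) y₀ ((extChartAt 𝓘(ℝ, E) y₁).symm e)) e :=
      (h1.fderiv_right (m := 1) (by simp)).differentiableAt (by simp)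
    have h3 : DifferentiableAt ℂ (fun e => fun j => fderiv ℂ (fun e =>
        extChartAt 𝓘(ℝ, E) y₀ ((extChartAt 𝓘(ℝ, E) y₁).symm e)) e (v j)) e :=
      differentiableAt_pi.2 fun j => h2.clm_apply (differentiableAt_const _)
    exact ((d.hasFDerivAt _).differentiableAt.comp e h3).mul (differentiableAt_const _)

end Frame

end ComplexManifold

/-! ### Frames of line bundles -/

section Frames

universe u v w

/-- Functions on open sets which form a sheaf of rings (as far as needed below). -/
structure IsFunctionSheaf {X : Type u} [TopologicalSpace X] (O : Set X → (X → ℂ) → Prop) :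
    Prop where
  one : ∀ U, O U fun _ => 1
  mul : ∀ {U f g}, O U f → O U g → O U fun x => f x * g x
  mono : ∀ {U V f}, IsOpen U → U ⊆ V → O V f → O U f
  of_local : ∀ {U f}, IsOpen U →
    (∀ x ∈ U, ∃ V, IsOpen V ∧ x ∈ V ∧ ∃ g, O V g ∧ ∀ y ∈ V, f y = g y) → O U f

/-- A nowhere vanishing section whose multiples by holomorphic functions are the holomorphic
sections. -/
def IsFrame {X : Type u} [TopologicalSpace X] (O : Set X → (X → ℂ) → Prop)
    (L : BundleData.{u, v} X) (V : Set X) (e : ∀ y, L.fiber y) : Prop :=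
  (∀ y ∈ V, e y ≠ 0) ∧ ∀ U : Set X, IsOpen U → U ⊆ V → ∀ s : ∀ y, L.fiber y,
    L.IsHol U s ↔ ∃ f : X → ℂ, O U f ∧ ∀ y ∈ U, s y = f y • e y

/-- Holomorphy of sections is a local condition. -/
structure IsLocalBundle {X : Type u} [TopologicalSpace X] (L : BundleData.{u, v} X) : Prop where
  mono : ∀ {U V : Set X} {s : ∀ x, L.fiber x}, IsOpen U → U ⊆ V → L.IsHol V s → L.IsHol U s
  of_local : ∀ {U : Set X} {s : ∀ x, L.fiber x}, IsOpen U →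
    (∀ x ∈ U, ∃ V, IsOpen V ∧ x ∈ V ∧ L.IsHol V s) → L.IsHol U s

variable {X : Type u} [TopologicalSpace X] {O : Set X → (X → ℂ) → Prop}
  {L : BundleData.{u, v} X}

theorem IsFrame.isHol (hO : IsFunctionSheaf O) {V : Set X} {e : ∀ y, L.fiber y}
    (he : IsFrame O L V e) {U : Set X} (hU : IsOpen U) (hUV : U ⊆ V) : L.IsHol U e :=
  (he.2 U hU hUV e).2 ⟨fun _ => 1, hO.one U, fun _ _ => (one_smul ℂ _).symm⟩

theorem IsFrame.mono {V W : Set X} {e : ∀ y, L.fiber y} (he : IsFrame O L V e) (h : W ⊆ V) :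
    IsFrame O L W e :=
  ⟨fun y hy => he.1 y (h hy), fun U hU hUW => he.2 U hU (hUW.trans h)⟩

theorem tmul_ne_zero_of_ne_zero {A : Type*} {B : Type*} [AddCommGroup A] [Module ℂ A]
    [AddCommGroup B] [Module ℂ B] {a : A} {b : B} (ha : a ≠ 0) (hb : b ≠ 0) :
    a ⊗ₜ[ℂ] b ≠ 0 := by
  intro h
  apply ha
  -- A functional `f` on the first factor sends `a ⊗ b` to `f a • b`, so `a ⊗ b = 0` would make
  -- every `f a` vanish.
  rw [← Module.forall_dual_apply_eq_zero_iff ℂ]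
  intro f
  have h1 : f a • b = 0 := by
    have h2 := congrArg (TensorProduct.lid ℂ B) (congrArg (LinearMap.rTensor B f) h)
    rwa [LinearMap.rTensor_tmul, TensorProduct.lid_tmul, map_zero, map_zero] at h2
  exact (smul_eq_zero.1 h1).resolve_right hb

/-- Holomorphic sections are locally products of sections of the factors; expanding those in the two
frames gives local holomorphic coefficients. The frame does not vanish, so the coefficients are
unique and glue. -/
theorem isFrame_tensorBundle (hO : IsFunctionSheaf O) {L' : BundleData.{u, w} X} {V : Set X}
    {e : ∀ y, L.fiber y} {e' : ∀ y, L'.fiber y} (he : IsFrame O L V e) (he' : IsFrame O L' V e') :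
    IsFrame O (tensorBundle O L L') V (fun y => e y ⊗ₜ[ℂ] e' y) := by
  have hne : ∀ y ∈ V, e y ⊗ₜ[ℂ] e' y ≠ 0 := fun y hy =>
    tmul_ne_zero_of_ne_zero (he.1 y hy) (he'.1 y hy)
  refine ⟨hne, fun U hU hUV s => ⟨fun hs => ?_, ?_⟩⟩
  · have hloc : ∀ x ∈ U, ∃ V, IsOpen V ∧ x ∈ V ∧ V ⊆ U ∧
        ∃ g, O V g ∧ ∀ y ∈ V, s y = g y • (e y ⊗ₜ[ℂ] e' y) := by
      intro x hx
      obtain ⟨V', hV', hxV', hV'U, g, a, a', hg, ha, ha', -, -, hs'⟩ := hs x hx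
      obtain ⟨f, hf, hfa⟩ := (he.2 V' hV' (hV'U.trans hUV) a).1 ha
      obtain ⟨f', hf', hfa'⟩ := (he'.2 V' hV' (hV'U.trans hUV) a').1 ha'
      refine ⟨V', hV', hxV', hV'U, _, hO.mul (hO.mul hg hf) hf', fun y hy => ?_⟩
      rw [hs' y hy, hfa y hy, hfa' y hy, TensorProduct.smul_tmul', TensorProduct.tmul_smul,
        TensorProduct.smul_tmul', smul_smul, smul_smul, TensorProduct.smul_tmul']
      congr 2
      ring
    -- The global coefficient is chosen pointwise, with the irrelevant value `0` off `U`.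
    have hex : ∀ y, ∃ c : ℂ, y ∈ U → s y = c • (e y ⊗ₜ[ℂ] e' y) := by
      intro y
      by_cases hy : y ∈ U
      · obtain ⟨V', -, hyV', -, g, -, hg⟩ := hloc y hy
        exact ⟨g y, fun _ => hg y hyV'⟩
      · exact ⟨0, fun h => (hy h).elim⟩
    choose f hf using hex
    refine ⟨f, hO.of_local hU fun x hx => ?_, fun y hy => hf y hy⟩
    obtain ⟨V', hV', hxV', hV'U, g, hg, hgs⟩ := hloc x hx
    refine ⟨V', hV', hxV', g, hg, fun y hy => ?_⟩
    exact smul_left_injective ℂ (hne y (hUV (hV'U hy))) ((hf y (hV'U hy)).symm.trans (hgs y hy))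
  · rintro ⟨f, hf, hfs⟩ x hx
    exact ⟨U, hU, hx, Subset.rfl, f, e, e', hf, he.isHol hO hU hUV, he'.isHol hO hU hUV,
      fun y hy => he.1 y (hUV hy), fun y hy => he'.1 y (hUV hy), hfs⟩

theorem isFrame_pullbackBundle (hO : IsFunctionSheaf O) {Y : Type w} [TopologicalSpace Y]
    {O' : Set Y → (Y → ℂ) → Prop} (hO' : IsFunctionSheaf O') {L : BundleData.{w, v} Y}
    (hL : IsLocalBundle L) {φ : X → Y}
    (hcomp : ∀ W f, IsOpen W → O' W f → O (φ ⁻¹' W) (f ∘ φ))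
    {W : Set Y} (hW : IsOpen W) {e : ∀ y, L.fiber y} (he : IsFrame O' L W e) :
    IsFrame O (pullbackBundle O φ L) (φ ⁻¹' W) (fun x => e (φ x)) := by
  refine ⟨fun y hy => he.1 _ hy, fun U hU hUV s => ⟨fun hs => ?_, ?_⟩⟩
  · have hloc : ∀ x ∈ U, ∃ V, IsOpen V ∧ x ∈ V ∧ V ⊆ U ∧
        ∃ g, O V g ∧ ∀ y ∈ V, s y = g y • e (φ y) := by
      intro x hx
      obtain ⟨V', hV', hxV', hV'U, W', hW', hVW', g, a, hg, ha, -, hs'⟩ := hs x hx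
      -- The section `a` lives on `W'` and the frame on `W`; they can be compared only on the
      -- intersection, which needs holomorphy to restrict.
      have hres : L.IsHol (W' ∩ W) a := hL.mono (hW'.inter hW) inter_subset_left ha
      obtain ⟨f, hf, hfa⟩ := (he.2 (W' ∩ W) (hW'.inter hW) inter_subset_right a).1 hres
      have hsub : V' ⊆ φ ⁻¹' (W' ∩ W) := fun y hy => ⟨hVW' hy, hUV (hV'U hy)⟩
      refine ⟨V', hV', hxV', hV'U, _,
        hO.mul hg (hO.mono hV' hsub (hcomp _ _ (hW'.inter hW) hf)), fun y hy => ?_⟩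
      rw [hs' y hy, hfa _ (hsub hy), smul_smul]
      rfl
    have hex : ∀ y, ∃ c : ℂ, y ∈ U → s y = c • e (φ y) := by
      intro y
      by_cases hy : y ∈ U
      · obtain ⟨V', -, hyV', -, g, -, hg⟩ := hloc y hy
        exact ⟨g y, fun _ => hg y hyV'⟩
      · exact ⟨0, fun h => (hy h).elim⟩
    choose f hf using hex
    refine ⟨f, hO.of_local hU fun x hx => ?_, fun y hy => hf y hy⟩
    obtain ⟨V', hV', hxV', hV'U, g, hg, hgs⟩ := hloc x hx
    refine ⟨V', hV', hxV', g, hg, fun y hy => ?_⟩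
    exact smul_left_injective ℂ (he.1 _ (hUV (hV'U hy))) ((hf y (hV'U hy)).symm.trans (hgs y hy))
  · rintro ⟨f, hf, hfs⟩ x hx
    exact ⟨U, hU, hx, Subset.rfl, W, hW, hUV, f, e, hf, he.isHol hO' hW Subset.rfl, he.1, hfs⟩

theorem isLocalBundle_trivialBundle (hO : IsFunctionSheaf O) :
    IsLocalBundle (trivialBundle.{u} O) where
  mono := hO.mono
  of_local := fun {_ s} hU h => hO.of_local hU fun x hx =>
    let ⟨V, hV, hxV, hs⟩ := h x hx
    ⟨V, hV, hxV, s, hs, fun _ _ => rfl⟩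

theorem isLocalBundle_tensorBundle (hO : IsFunctionSheaf O) (hL : IsLocalBundle L)
    {L' : BundleData.{u, w} X} (hL' : IsLocalBundle L') : IsLocalBundle (tensorBundle O L L') where
  mono := by
    intro U V s hU hUV hs x hx
    obtain ⟨V', hV', hxV', -, g, e, e', hg, he, he', hne, hne', hs'⟩ := hs x (hUV hx)
    have ho := hV'.inter hU
    exact ⟨V' ∩ U, ho, ⟨hxV', hx⟩, inter_subset_right, g, e, e', hO.mono ho inter_subset_left hg,
      hL.mono ho inter_subset_left he, hL'.mono ho inter_subset_left he', fun y hy => hne y hy.1,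
      fun y hy => hne' y hy.1, fun y hy => hs' y hy.1⟩
  of_local := by
    intro U s hU h x hx
    obtain ⟨V, hV, hxV, hs⟩ := h x hx
    obtain ⟨V', hV', hxV', -, g, e, e', hg, he, he', hne, hne', hs'⟩ := hs x hxV
    have ho := hV'.inter hU
    exact ⟨V' ∩ U, ho, ⟨hxV', hx⟩, inter_subset_right, g, e, e', hO.mono ho inter_subset_left hg,
      hL.mono ho inter_subset_left he, hL'.mono ho inter_subset_left he', fun y hy => hne y hy.1,
      fun y hy => hne' y hy.1, fun y hy => hs' y hy.1⟩

theorem isLocalBundle_pullbackBundle (hO : IsFunctionSheaf O) {Y : Type w} [TopologicalSpace Y]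
    (L : BundleData.{w, v} Y) (φ : X → Y) : IsLocalBundle (pullbackBundle O φ L) where
  mono := by
    intro U V s hU hUV hs x hx
    obtain ⟨V', hV', hxV', -, W, hW, hVW, g, e, hg, he, hne, hs'⟩ := hs x (hUV hx)
    have ho := hV'.inter hU
    exact ⟨V' ∩ U, ho, ⟨hxV', hx⟩, inter_subset_right, W, hW, fun y hy => hVW hy.1, g, e,
      hO.mono ho inter_subset_left hg, he, hne, fun y hy => hs' y hy.1⟩
  of_local := by
    intro U s hU h x hx
    obtain ⟨V, hV, hxV, hs⟩ := h x hx
    obtain ⟨V', hV', hxV', -, W, hW, hVW, g, e, hg, he, hne, hs'⟩ := hs x hxV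
    have ho := hV'.inter hU
    exact ⟨V' ∩ U, ho, ⟨hxV', hx⟩, inter_subset_right, W, hW, fun y hy => hVW hy.1, g, e,
      hO.mono ho inter_subset_left hg, he, hne, fun y hy => hs' y hy.1⟩

/-- Relative to frames that correspond under `T`, a section and its image have the same coefficient
function. Locality then removes the restriction to the domains of the frames. -/
theorem IsLocalBundle.isHol_iff_of_frame (hL : IsLocalBundle L)
    {L' : BundleData.{u, w} X} (hL' : IsLocalBundle L') (T : ∀ x, L.fiber x ≃ₗ[ℂ] L'.fiber x)
    (hT : ∀ x, ∃ V : Set X, IsOpen V ∧ x ∈ V ∧ ∃ (e : ∀ y, L.fiber y) (e' : ∀ y, L'.fiber y),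
      IsFrame O L V e ∧ IsFrame O L' V e' ∧ ∀ y ∈ V, T y (e y) = e' y)
    {U : Set X} (hU : IsOpen U) (s : ∀ x, L.fiber x) :
    L.IsHol U s ↔ L'.IsHol U (fun x => T x (s x)) := by
  have hkey : ∀ x ∈ U, ∃ V : Set X, IsOpen V ∧ x ∈ V ∧ V ⊆ U ∧
      (L.IsHol V s ↔ L'.IsHol V (fun x => T x (s x))) := by
    intro x hx
    obtain ⟨V, hV, hxV, e, e', he, he', hee⟩ := hT x
    have ho := hV.inter hU
    refine ⟨V ∩ U, ho, ⟨hxV, hx⟩, inter_subset_right, ?_⟩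
    rw [he.2 _ ho inter_subset_left, he'.2 _ ho inter_subset_left]
    refine exists_congr fun f => and_congr_right fun _ => forall₂_congr fun y hy => ?_
    rw [← hee y hy.1, ← map_smul]
    exact (T y).injective.eq_iff.symm
  constructor
  · intro hs
    refine hL'.of_local hU fun x hx => ?_
    obtain ⟨V, hV, hxV, hVU, hiff⟩ := hkey x hx
    exact ⟨V, hV, hxV, hiff.1 (hL.mono hV hVU hs)⟩
  · intro hs
    refine hL.of_local hU fun x hx => ?_
    obtain ⟨V, hV, hxV, hVU, hiff⟩ := hkey x hx
    exact ⟨V, hV, hxV, hiff.2 (hL'.mono hV hVU hs)⟩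

theorem exists_linearEquiv_of_finrank_eq_one {A : Type*} {B : Type*} [AddCommGroup A] [Module ℂ A]
    [AddCommGroup B] [Module ℂ B] (hA : Module.finrank ℂ A = 1) (hB : Module.finrank ℂ B = 1)
    {a : A} {b : B} (ha : a ≠ 0) (hb : b ≠ 0) : ∃ T : A ≃ₗ[ℂ] B, T a = b := by
  have : FiniteDimensional ℂ A := Module.finite_of_finrank_eq_succ hA
  have : FiniteDimensional ℂ B := Module.finite_of_finrank_eq_succ hB
  let T := LinearEquiv.ofFinrankEq A B (hA.trans hB.symm)
  obtain ⟨c, hc⟩ := exists_smul_eq_of_finrank_eq_one hB (T.map_ne_zero_iff.2 ha) b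
  have hc0 : c ≠ 0 := by
    rintro rfl
    exact hb (by rw [← hc, zero_smul])
  exact ⟨T.trans (LinearEquiv.smulOfNeZero ℂ B c hc0), hc⟩

end Frames

/-! ### Line bundles on the projective line -/

section ProjectiveLine

theorem isOpen_coneOver {U : Set CP1} (hU : IsOpen U) : IsOpen (coneOver U) := by
  have h1 : IsOpen ((fun z : {z : Fin 2 → ℂ // z ≠ 0} => Projectivization.mk ℂ z.1 z.2) ⁻¹' U) :=
    hU
  have h2 : coneOver U = Subtype.val ''
      ((fun z : {z : Fin 2 → ℂ // z ≠ 0} => Projectivization.mk ℂ z.1 z.2) ⁻¹' U) := by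
    ext z
    constructor
    · rintro ⟨hz, h⟩
      exact ⟨⟨z, hz⟩, h, rfl⟩
    · rintro ⟨w, h, rfl⟩
      exact ⟨w.2, h⟩
  rw [h2]
  exact (isOpen_ne (x := (0 : Fin 2 → ℂ))).isOpenMap_subtype_val _ h1

theorem isOpen_of_coneOver {U : Set CP1} (hU : IsOpen (coneOver U)) : IsOpen U := by
  have h1 : IsOpen ((fun z : {z : Fin 2 → ℂ // z ≠ 0} => Projectivization.mk ℂ z.1 z.2) ⁻¹' U) := by
    have h2 : (fun z : {z : Fin 2 → ℂ // z ≠ 0} => Projectivization.mk ℂ z.1 z.2) ⁻¹' U =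
        Subtype.val ⁻¹' coneOver U := by
      ext z
      exact ⟨fun h => ⟨z.2, h⟩, fun ⟨_, h⟩ => h⟩
    rw [h2]
    exact hU.preimage continuous_subtype_val
  exact h1

theorem coneOver_mono {U V : Set CP1} (h : U ⊆ V) : coneOver U ⊆ coneOver V :=
  fun _ ⟨hz, hU⟩ => ⟨hz, h hU⟩

theorem differentiableOn_coneOver_of_local {F : Type*} [NormedAddCommGroup F] [NormedSpace ℂ F]
    {U : Set CP1} {f : (Fin 2 → ℂ) → F}
    (h : ∀ l ∈ U, ∃ V, IsOpen V ∧ l ∈ V ∧ ∃ g : (Fin 2 → ℂ) → F, DifferentiableOn ℂ g (coneOver V) ∧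
      ∀ z ∈ coneOver V, f z = g z) : DifferentiableOn ℂ f (coneOver U) := by
  rintro z ⟨hz, hzU⟩
  obtain ⟨V, hV, hlV, g, hg, hfg⟩ := h _ hzU
  have hzV : z ∈ coneOver V := ⟨hz, hlV⟩
  have hn := (isOpen_coneOver hV).mem_nhds hzV
  exact ((((hg z hzV).differentiableAt hn).congr_of_eventuallyEq
    (Filter.eventually_of_mem hn hfg))).differentiableWithinAt

theorem isFunctionSheaf_isHolFunCP1 : IsFunctionSheaf IsHolFunCP1 where
  one := fun U => (differentiableOn_const (1 : ℂ)).congr fun z hz => dif_pos hz.1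
  mul := by
    intro U f g hf hg
    refine (hf.mul hg).congr fun z hz => ?_
    have hz0 : z ≠ 0 := hz.1
    simp [hz0]
  mono := fun _ h hf => DifferentiableOn.mono hf (coneOver_mono h)
  of_local := by
    intro U f _ h
    refine differentiableOn_coneOver_of_local fun l hl => ?_
    obtain ⟨V, hV, hlV, g, hg, hfg⟩ := h l hl
    refine ⟨V, hV, hlV, _, hg, fun z hz => ?_⟩
    rw [dif_pos hz.1, dif_pos hz.1]
    exact hfg _ hz.2

theorem isLocalBundle_tautologicalBundle : IsLocalBundle tautologicalBundle where
  mono := fun _ h hs => DifferentiableOn.mono hs (coneOver_mono h)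
  of_local := by
    intro U s _ h
    refine differentiableOn_coneOver_of_local fun l hl => ?_
    obtain ⟨V, hV, hlV, hs⟩ := h l hl
    exact ⟨V, hV, hlV, _, hs, fun z _ => rfl⟩

/-- The lines on which the coordinate `z i` does not vanish. -/
def affinePiece (i : Fin 2) : Set CP1 := {l | ∃ z ∈ l.submodule, z i ≠ 0}

theorem mk_mem_affinePiece {i : Fin 2} {z : Fin 2 → ℂ} (hz : z ≠ 0) :
    Projectivization.mk ℂ z hz ∈ affinePiece i ↔ z i ≠ 0 := by
  constructor
  · rintro ⟨w, hw, hwi⟩ h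
    rw [Projectivization.submodule_mk, Submodule.mem_span_singleton] at hw
    obtain ⟨c, rfl⟩ := hw
    exact hwi (by rw [Pi.smul_apply, h, smul_zero])
  · intro h
    refine ⟨z, ?_, h⟩
    rw [Projectivization.submodule_mk]
    exact Submodule.mem_span_singleton_self z

theorem isOpen_affinePiece (i : Fin 2) : IsOpen (affinePiece i) := by
  apply isOpen_of_coneOver
  have h : coneOver (affinePiece i) = {z | z i ≠ 0} := by
    ext z
    constructor
    · rintro ⟨hz, h⟩
      exact (mk_mem_affinePiece hz).1 h
    · intro h
      have hz : z ≠ 0 := by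
        rintro rfl
        exact h rfl
      exact ⟨hz, (mk_mem_affinePiece hz).2 h⟩
  rw [h]
  exact isOpen_ne_fun (continuous_apply i) continuous_const

theorem exists_mem_affinePiece (l : CP1) : ∃ i, l ∈ affinePiece i := by
  induction l using Projectivization.ind with
  | h z hz =>
    obtain ⟨i, hi⟩ := Function.ne_iff.1 hz
    exact ⟨i, (mk_mem_affinePiece hz).2 hi⟩

open Classical in
/-- The section of the tautological bundle whose coordinate `z i` is `1`. -/
def affineSection (i : Fin 2) (l : CP1) : l.submodule :=
  if h : ∃ z ∈ l.submodule, z i ≠ 0 then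
    ⟨(h.choose i)⁻¹ • h.choose, l.submodule.smul_mem _ h.choose_spec.1⟩
  else 0

theorem affineSection_apply {i : Fin 2} {l : CP1} (hl : l ∈ affinePiece i) :
    (affineSection i l : Fin 2 → ℂ) i = 1 := by
  have h : ∃ z ∈ l.submodule, z i ≠ 0 := hl
  rw [affineSection, dif_pos h]
  exact inv_mul_cancel₀ h.choose_spec.2

theorem affineSection_ne_zero {i : Fin 2} {l : CP1} (hl : l ∈ affinePiece i) :
    affineSection i l ≠ 0 := by
  intro h
  have h1 := affineSection_apply hl
  rw [h] at h1
  exact zero_ne_one h1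

theorem exists_smul_of_mem_submodule {l : CP1} {a b : l.submodule} (ha : a ≠ 0) :
    ∃ c : ℂ, c • a = b :=
  exists_smul_eq_of_finrank_eq_one l.finrank_submodule ha b

theorem eq_smul_affineSection {i : Fin 2} {l : CP1} (hl : l ∈ affinePiece i) (a : l.submodule) :
    a = (a : Fin 2 → ℂ) i • affineSection i l := by
  obtain ⟨c, rfl⟩ := exists_smul_of_mem_submodule (b := a) (affineSection_ne_zero hl)
  congr 1
  change c = c * (affineSection i l : Fin 2 → ℂ) i
  rw [affineSection_apply hl, mul_one]

theorem affineSection_mk {i : Fin 2} {z : Fin 2 → ℂ} (hz : z ≠ 0) (hi : z i ≠ 0) :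
    (affineSection i (Projectivization.mk ℂ z hz) : Fin 2 → ℂ) = (z i)⁻¹ • z := by
  have hmem : z ∈ (Projectivization.mk ℂ z hz).submodule := by
    rw [Projectivization.submodule_mk]
    exact Submodule.mem_span_singleton_self z
  have h := congrArg Subtype.val
    (eq_smul_affineSection ((mk_mem_affinePiece hz).2 hi) ⟨z, hmem⟩)
  change z = z i • (affineSection i (Projectivization.mk ℂ z hz) : Fin 2 → ℂ) at h
  rw [eq_inv_smul_iff₀ hi]
  exact h.symm

/-- Since the frame has coordinate `i` equal to `1`, the coefficient of a section is its own
coordinate `i`. Conversely the frame is `z ↦ z / z i` on the cone, which is holomorphic where `z i ≠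
0`. -/
theorem isFrame_affineSection (i : Fin 2) :
    IsFrame IsHolFunCP1 tautologicalBundle (affinePiece i) (affineSection i) := by
  refine ⟨fun l hl => affineSection_ne_zero hl, fun U _ hUV s => ⟨fun hs => ?_, ?_⟩⟩
  · refine ⟨fun l => Subtype.val (p := (· ∈ l.submodule)) (s l) i, ?_, fun l hl =>
        eq_smul_affineSection (hUV hl) (s l)⟩
    refine (differentiableOn_pi.1 hs i).congr fun z hz => ?_
    rw [dif_pos hz.1, dif_pos hz.1]
  · rintro ⟨f, hf, hs⟩
    have hd : DifferentiableOn ℂ (fun z : Fin 2 → ℂ => (z i)⁻¹ • z) (coneOver U) := by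
      rintro z ⟨hz, hzU⟩
      have hi : z i ≠ 0 := (mk_mem_affinePiece hz).1 (hUV hzU)
      have hp : DifferentiableAt ℂ (fun z : Fin 2 → ℂ => z i) z :=
        (ContinuousLinearMap.proj (R := ℂ) (φ := fun _ : Fin 2 => ℂ) i).differentiableAt
      exact ((hp.inv hi).smul differentiableAt_id).differentiableWithinAt
    refine (DifferentiableOn.smul hf hd).congr fun z hz => ?_
    have h1 : (affineSection i (Projectivization.mk ℂ z hz.1) : Fin 2 → ℂ) = (z i)⁻¹ • z :=
      affineSection_mk hz.1 ((mk_mem_affinePiece hz.1).1 (hUV hz.2))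
    rw [dif_pos hz.1]
    have hf1 : (fun z : Fin 2 → ℂ => if h : z ≠ 0 then f (Projectivization.mk ℂ z h) else 0) z =
        f (Projectivization.mk ℂ z hz.1) := dif_pos hz.1
    exact (congrArg Subtype.val (hs _ hz.2)).trans
      (congrArg₂ (fun (a : ℂ) (b : Fin 2 → ℂ) => a • b) hf1.symm h1)

/-- The tensor power of a vector in the line `l`. -/
def tensorPow (l : CP1) (t : l.submodule) : ∀ k, (bundleONeg k).fiber l
  | 0 => (1 : ℂ)
  | k + 1 => (tensorPow l t k ⊗ₜ[ℂ] t : (bundleONeg k).fiber l ⊗[ℂ] l.submodule)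

theorem tensorPow_ne_zero {l : CP1} {t : l.submodule} (ht : t ≠ 0) : ∀ k, tensorPow l t k ≠ 0
  | 0 => one_ne_zero (α := ℂ)
  | k + 1 => tmul_ne_zero_of_ne_zero (tensorPow_ne_zero ht k) ht

theorem tensorPow_smul {l : CP1} (c : ℂ) (t : l.submodule) :
    ∀ k, tensorPow l (c • t) k = c ^ k • tensorPow l t k
  | 0 => by
    rw [pow_zero, one_smul]
    rfl
  | k + 1 => by
    change (tensorPow l (c • t) k ⊗ₜ[ℂ] (c • t) : (bundleONeg k).fiber l ⊗[ℂ] l.submodule) =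
      c ^ (k + 1) • (tensorPow l t k ⊗ₜ[ℂ] t : (bundleONeg k).fiber l ⊗[ℂ] l.submodule)
    rw [tensorPow_smul c t k, TensorProduct.tmul_smul, ← TensorProduct.smul_tmul', smul_smul,
      pow_succ']

theorem finrank_bundleONeg (l : CP1) : ∀ k, Module.finrank ℂ ((bundleONeg k).fiber l) = 1
  | 0 => Module.finrank_self ℂ
  | k + 1 => by
    change Module.finrank ℂ ((bundleONeg k).fiber l ⊗[ℂ] l.submodule) = 1
    rw [Module.finrank_tensorProduct, finrank_bundleONeg l k, l.finrank_submodule]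

theorem isLocalBundle_bundleONeg : ∀ k, IsLocalBundle (bundleONeg k)
  | 0 => isLocalBundle_trivialBundle isFunctionSheaf_isHolFunCP1
  | k + 1 => isLocalBundle_tensorBundle isFunctionSheaf_isHolFunCP1 (isLocalBundle_bundleONeg k)
      isLocalBundle_tautologicalBundle

theorem isFrame_tensorPow (i : Fin 2) : ∀ k, IsFrame IsHolFunCP1 (bundleONeg k) (affinePiece i)
    fun l => tensorPow l (affineSection i l) k
  | 0 => by
    refine ⟨fun _ _ => one_ne_zero (α := ℂ), fun U hU _ s => ⟨fun hs => ?_, ?_⟩⟩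
    · exact ⟨s, hs, fun l _ => (mul_one (M := ℂ) (s l)).symm⟩
    · rintro ⟨f, hf, hs⟩
      exact isFunctionSheaf_isHolFunCP1.of_local hU fun l hl =>
        ⟨U, hU, hl, f, hf, fun y hy => (hs y hy).trans (mul_one (M := ℂ) (f y))⟩
  | k + 1 => isFrame_tensorBundle isFunctionSheaf_isHolFunCP1 (isFrame_tensorPow i k)
      (isFrame_affineSection i)

end ProjectiveLine

/-! ### Holomorphic functions and canonical sections as local data -/

section Sheaf

variable {E : Type*} [NormedAddCommGroup E] [NormedSpace ℝ E]
  {H : Type*} [TopologicalSpace H] {I : ModelWithCorners ℝ E H}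
  {X : Type*} [TopologicalSpace X] [ChartedSpace H X] [I.Boundaryless] [IsManifold I ∞ X]
  {J : ∀ x : X, TangentSpace I x →L[ℝ] TangentSpace I x}

variable (J) in
theorem isFunctionSheaf_isHolFun : IsFunctionSheaf (IsHolFun I J) where
  one U := isHolFun_const U 1
  mul hf hg := hf.mul hg
  mono _ h hf := hf.mono h
  of_local := by
    intro U f _ h x hx
    obtain ⟨V, hV, hxV, g, hg, hfg⟩ := h x hx
    obtain ⟨h1, h2⟩ := hg x hxV
    have hev : f =ᶠ[𝓝 x] g := Filter.eventually_of_mem (hV.mem_nhds hxV) hfg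
    refine ⟨h1.congr_of_eventuallyEq hev, fun v => ?_⟩
    have hd : ∀ v : TangentSpace I x, dFun I f x v = dFun I g x v := fun v =>
      congrArg (fun L : E →L[ℝ] ℂ => L v) hev.mfderiv_eq
    rw [hd, hd, h2]

variable (J) in
theorem isLocalBundle_canonicalBundle : IsLocalBundle (canonicalBundle I J) where
  mono _ h hs := fun x hx => hs x (h hx)
  of_local _ h := fun x hx =>
    let ⟨_, _, hxV, hs⟩ := h x hx
    hs x hxV

theorem IsHolFun.comp_isHolMap {E' : Type*} [NormedAddCommGroup E'] [NormedSpace ℝ E']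
    {H' : Type*} [TopologicalSpace H'] {I' : ModelWithCorners ℝ E' H'}
    {X' : Type*} [TopologicalSpace X'] [ChartedSpace H' X']
    {J' : ∀ x : X', TangentSpace I' x →L[ℝ] TangentSpace I' x} {F : X → X'}
    (hF : IsHolMap I I' J J' F) {W : Set X'} {f : X' → ℂ} (hf : IsHolFun I' J' W f) :
    IsHolFun I J (F ⁻¹' W) (f ∘ F) := by
  intro x hx
  obtain ⟨h1, h2⟩ := hf (F x) hx
  refine ⟨h1.comp x hF.1.contMDiffAt, fun v => ?_⟩
  have hd : ∀ v : TangentSpace I x, dFun I (f ∘ F) x v = dFun I' f (F x) (mfderiv I I' F x v) :=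
    fun v => congrArg (fun L : E →L[ℝ] ℂ => L v)
      (mfderiv_comp x (h1.mdifferentiableAt (by simp))
          (hF.1.contMDiffAt.mdifferentiableAt (by simp)))
  rw [hd, hd, hF.2, h2]

theorem isFrame_canonicalBundle [FiniteDimensional ℝ E]
    (hJ : ∀ (x : X) (v : TangentSpace I x), J x (J x v) = -v)
    (hE : Module.finrank ℝ E = 2 * (Module.finrank ℝ E / 2)) {V : Set X}
    {e : ∀ x : X, (canonicalBundle I J).fiber x} (he : (canonicalBundle I J).IsHol V e)
    (he0 : ∀ y ∈ V, e y ≠ 0) : IsFrame (IsHolFun I J) (canonicalBundle I J) V e :=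
  ⟨he0, fun _ hU hUV s => isHol_canonicalBundle_iff_of_frame hJ hE hU hUV he he0 s⟩

end Sheaf

/-! ### Holomorphic maps to the projective line and pullback along them -/

section ProjectiveMap

variable {E : Type*} [NormedAddCommGroup E] [NormedSpace ℂ E]
  {Y : Type*} [TopologicalSpace Y] [ChartedSpace E Y]

theorem IsHolMapCP1.continuous {φ : Y → CP1} (hφ : IsHolMapCP1 (E := E) φ) : Continuous φ := by
  refine continuous_iff_continuousAt.2 fun y => ?_
  obtain ⟨U, hU, hy, f, hf, hfφ⟩ := hφ y
  intro W hW
  obtain ⟨W', hW'W, hW', hyW'⟩ := mem_nhds_iff.1 hW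
  obtain ⟨h0, h1⟩ := hfφ y hy
  have hc : ContinuousAt f y := (hf.continuousOn.continuousAt (hU.mem_nhds hy))
  have hmem : f y ∈ coneOver W' := ⟨h0, h1 ▸ hyW'⟩
  refine Filter.mem_map.2 ?_
  filter_upwards [hc ((isOpen_coneOver hW').mem_nhds hmem), hU.mem_nhds hy] with y' hy' hyU
  obtain ⟨h2, h3⟩ := hfφ y' hyU
  obtain ⟨h4, h5⟩ := hy'
  refine hW'W ?_
  rw [h3]
  exact h5

theorem IsHolMapCP1.eventually_mem_chart {φ : Y → CP1} (hφ : IsHolMapCP1 (E := E) φ) {W : Set CP1}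
    (hW : IsOpen W) {y : Y} (hy : φ y ∈ W) :
    ∀ᶠ e in 𝓝 (extChartAt 𝓘(ℝ, E) y y), φ ((extChartAt 𝓘(ℝ, E) y).symm e) ∈ W := by
  have hcont : ContinuousAt (extChartAt 𝓘(ℝ, E) y).symm (extChartAt 𝓘(ℝ, E) y y) :=
    continuousAt_extChartAt_symm y
  rw [ContinuousAt, extChartAt_to_inv] at hcont
  exact hcont.eventually (hφ.continuous.continuousAt (hW.mem_nhds hy))

variable [IsManifold 𝓘(ℂ, E) ω Y] [FiniteDimensional ℂ E]

/-- Locally `f ∘ φ` is the function on the cone in `ℂ² ∖ 0` defined by `f`, composed with a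
holomorphic lift of `φ`. -/
theorem IsHolFunCP1.comp {φ : Y → CP1} (hφ : IsHolMapCP1 (E := E) φ) {W : Set CP1}
    (hW : IsOpen W) {f : CP1 → ℂ} (hf : IsHolFunCP1 W f) :
    IsHolFun 𝓘(ℝ, E) complexMul (φ ⁻¹' W) (f ∘ φ) := by
  intro y hy
  refine isHolFun_of_differentiableAt ?_
  obtain ⟨F, hF⟩ := hφ.exists_lift_chart y
  have hWn := hφ.eventually_mem_chart hW hy
  filter_upwards [(hF.and hWn).eventually_nhds] with e he
  obtain ⟨⟨hFe, h0, h1⟩, h2⟩ := he.self_of_nhds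
  have hmem : F e ∈ coneOver W := ⟨h0, h1 ▸ h2⟩
  have hd := (hf.differentiableAt ((isOpen_coneOver hW).mem_nhds hmem)).comp e hFe
  refine hd.congr_of_eventuallyEq ?_
  filter_upwards [he] with e' he'
  obtain ⟨⟨-, h0', h1'⟩, -⟩ := he'
  rw [Function.comp_apply, Function.comp_apply, dif_pos h0', h1']

/-- The holomorphic lift of a map to `ℂℙ¹` which is normalized by `z i = 1`. -/
theorem IsHolMapCP1.exists_affine_lift_chart {φ : Y → CP1} (hφ : IsHolMapCP1 (E := E) φ) {y : Y}
    {i : Fin 2} (hy : φ y ∈ affinePiece i) :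
    ∃ F : E → Fin 2 → ℂ, ∀ᶠ e in 𝓝 (extChartAt 𝓘(ℝ, E) y y), DifferentiableAt ℂ F e ∧
      (affineSection i (φ ((extChartAt 𝓘(ℝ, E) y).symm e)) : Fin 2 → ℂ) = F e := by
  obtain ⟨F, hF⟩ := hφ.exists_lift_chart y
  have hWn := hφ.eventually_mem_chart (isOpen_affinePiece i) hy
  refine ⟨fun e => (F e i)⁻¹ • F e, ?_⟩
  filter_upwards [hF, hWn] with e ⟨hFe, h0, h1⟩ h2
  rw [h1] at h2 ⊢
  have hi : F e i ≠ 0 := (mk_mem_affinePiece h0).1 h2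
  exact ⟨((differentiableAt_pi.1 hFe i).inv hi).smul hFe, affineSection_mk h0 hi⟩

theorem isFrame_volumeFrame {δ : E [⋀^Fin (Module.finrank ℝ E / 2)]→L[ℝ] ℂ}
    {d : ContinuousMultilinearMap ℂ (fun _ : Fin (Module.finrank ℝ E / 2) => E) ℂ}
    (hδ : ∀ (v : Fin (Module.finrank ℝ E / 2) → E) (i : Fin (Module.finrank ℝ E / 2)),
      δ (Function.update v i (Complex.I • v i)) = Complex.I * δ v)
    (hd : ∀ v, δ v = d v) (hδ0 : δ ≠ 0) (y₀ : Y) :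
    IsFrame (IsHolFun 𝓘(ℝ, E) complexMul) (canonicalBundle 𝓘(ℝ, E) (complexMul (E := E) (Y := Y)))
      (extChartAt 𝓘(ℝ, E) y₀).source (volumeFrame δ hδ y₀) := by
  have : FiniteDimensional ℝ E := FiniteDimensional.complexToReal E
  refine isFrame_canonicalBundle (fun y v => ?_) (finrank_complex E)
    (fun y hy => isHolFormAt_volumeFrame hδ hd hδ0 hy) fun y hy => volumeFrame_ne_zero hδ hδ0 hy
  have hv : ∀ v : E, Complex.I • Complex.I • v = -v := fun v => by
    rw [smul_smul, Complex.I_mul_I, neg_one_smul]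
  exact hv v

end ProjectiveMap

/-! ### Top forms on the total space -/

section TwistForm

theorem toSphere_of_mem_submodule {l : CP1} {t : Fin 2 → ℂ} (ht : t ∈ l.submodule) (h0 : t ≠ 0) :
    toSphere l = sphereCoord t := by
  induction l using Projectivization.ind with
  | h z hz =>
    rw [Projectivization.submodule_mk, Submodule.mem_span_singleton] at ht
    obtain ⟨c, rfl⟩ := ht
    have hc : c ≠ 0 := by
      rintro rfl
      exact h0 (zero_smul _ _)
    exact (sphereCoord_smul c hc z).symm

variable {EM : Type*} [NormedAddCommGroup EM] [NormedSpace ℝ EM]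
  {M : Type*} [TopologicalSpace M] [ChartedSpace EM M] [IsManifold 𝓘(ℝ, EM) ∞ M]
  {EY : Type*} [NormedAddCommGroup EY] [NormedSpace ℂ EY]
  {Y : Type*} [TopologicalSpace Y] [ChartedSpace EY Y]

/-- The complex structure `a I + b J + c K` of the twistor family at a point. -/
def HyperkahlerStructure.combination (h : HyperkahlerStructure EM M) (s : Fin 3 → ℝ) (p : M) :
    EM →L[ℝ] EM :=
  s 0 • (h.I p : EM →L[ℝ] EM) + s 1 • (h.J p : EM →L[ℝ] EM) + s 2 • (h.K p : EM →L[ℝ] EM)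

theorem HyperkahlerStructure.form_smul (h : HyperkahlerStructure EM M) (r : ℂ) (z : Fin 2 → ℂ)
    (p : M) : h.form (r • z) p = r ^ 2 • h.form z p := omega_smul _ _ _ _ _

theorem HyperkahlerStructure.form_zero (h : HyperkahlerStructure EM M) (p : M) :
    h.form 0 p = 0 := by
  refine ContinuousLinearMap.ext fun v => ContinuousLinearMap.ext fun w => ?_
  rw [HyperkahlerStructure.form, omega_apply]
  simp

theorem HyperkahlerStructure.form_left (h : HyperkahlerStructure EM M) {l : CP1}
    (t : l.submodule) (p : M) (v w : EM) :
    h.form t p (h.combination (toSphere l) p v) w = Complex.I * h.form t p v w := by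
  -- The zero vector of the line determines no point of the sphere, but there `Ω_t = 0`. Including
  -- it lets `twistForm` be defined for every `t`.
  by_cases ht : (t : Fin 2 → ℂ) = 0
  · rw [ht, h.form_zero]
    simp
  · rw [toSphere_of_mem_submodule t.2 ht]
    exact (h.isQuaternionic p).omega_left ht v w

theorem HyperkahlerStructure.form_skew (h : HyperkahlerStructure EM M) (z : Fin 2 → ℂ) (p : M)
    (v w : EM) : h.form z p v w = -h.form z p w v :=
  (h.isQuaternionic p).omega_skew z v w

theorem HyperkahlerStructure.form_right (h : HyperkahlerStructure EM M) {l : CP1}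
    (t : l.submodule) (p : M) (v w : EM) :
    h.form t p v (h.combination (toSphere l) p w) = Complex.I * h.form t p v w := by
  rw [h.form_skew, h.form_left, h.form_skew _ _ w v]
  ring

variable [FiniteDimensional ℝ EM] [FiniteDimensional ℂ EY] [IsManifold 𝓘(ℂ, EY) ω Y] {m : ℕ}
  (e : (Fin m × Fin 2) ⊕ Fin (Module.finrank ℝ EY / 2) ≃ Fin (Module.finrank ℝ (EM × EY) / 2))

/-- The form `Ω_t ^ m ∧ η` of top degree on the total space. -/
def twistForm (h : HyperkahlerStructure EM M) (φ : Y → CP1) (x : M × Y) (t : (φ x.2).submodule)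
    (η : (canonicalBundle 𝓘(ℝ, EY) (complexMul (E := EY) (Y := Y))).fiber x.2) :
    (canonicalBundle (𝓘(ℝ, EM).prod 𝓘(ℝ, EY)) (twistedStructure (EY := EY) h φ)).fiber x :=
  (⟨powWedge e (h.form t x.1) (formVal 𝓘(ℝ, EY) complexMul x.2 η), fun v i =>
    have : FiniteDimensional ℝ EY := FiniteDimensional.complexToReal EY
    powWedge_update e (h.form t x.1) (formVal 𝓘(ℝ, EY) complexMul x.2 η)
      (h.combination (toSphere (φ x.2)) x.1) (complexMul x.2 : EY →L[ℝ] EY)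
      (h.form_left t x.1) (h.form_right t x.1) (formVal_type η) v i⟩ :
    holForms (𝓘(ℝ, EM).prod 𝓘(ℝ, EY)) (twistedStructure (EY := EY) h φ)
      (Module.finrank ℝ (EM × EY) / 2) x)

theorem formVal_twistForm (h : HyperkahlerStructure EM M) (φ : Y → CP1) (x : M × Y)
    (t : (φ x.2).submodule)
    (η : (canonicalBundle 𝓘(ℝ, EY) (complexMul (E := EY) (Y := Y))).fiber x.2) :
    formVal (𝓘(ℝ, EM).prod 𝓘(ℝ, EY)) (twistedStructure (EY := EY) h φ) x (twistForm e h φ x t η) =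
      powWedge e (h.form t x.1) (formVal 𝓘(ℝ, EY) complexMul x.2 η) := rfl

theorem twistForm_smul (h : HyperkahlerStructure EM M) (φ : Y → CP1) (x : M × Y)
    (c d : ℂ) (t : (φ x.2).submodule)
    (η : (canonicalBundle 𝓘(ℝ, EY) (complexMul (E := EY) (Y := Y))).fiber x.2) :
    twistForm e h φ x (c • t) (d • η) = (c ^ (2 * m) * d) • twistForm e h φ x t η := by
  have hfd : FiniteDimensional ℝ EY := FiniteDimensional.complexToReal EY
  refine formVal_injective ?_
  rw [formVal_smul, formVal_twistForm, formVal_twistForm, formVal_smul, Submodule.coe_smul,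
    h.form_smul, powWedge_smul, pow_mul]

/-- `Ω_t` is nondegenerate and complex linear for `I_{φ(y)}`, so it has a symplectic basis of `m`
pairs, on which `powWedge_ne_zero` applies. -/
theorem twistForm_ne_zero (hm : Module.finrank ℝ EM = 4 * m) (h : HyperkahlerStructure EM M)
    (φ : Y → CP1) (x : M × Y) {t : (φ x.2).submodule} (ht : t ≠ 0)
    {η : (canonicalBundle 𝓘(ℝ, EY) (complexMul (E := EY) (Y := Y))).fiber x.2} (hη : η ≠ 0) :
    twistForm e h φ x t η ≠ 0 := by
  have hfd : FiniteDimensional ℝ EY := FiniteDimensional.complexToReal EY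
  have ht' : (t : Fin 2 → ℂ) ≠ 0 := fun h0 => ht (Subtype.ext h0)
  obtain ⟨b, hb⟩ := exists_symplectic hm (h.combination (toSphere (φ x.2)) x.1) (h.form t x.1)
    (h.form_right t x.1) (h.form_skew t x.1)
    fun v hv => (h.isQuaternionic x.1).omega_nondegenerate ht' hv
  intro h0
  have h1 := congrArg (formVal (𝓘(ℝ, EM).prod 𝓘(ℝ, EY)) (twistedStructure (EY := EY) h φ) x) h0
  rw [formVal_twistForm, formVal_zero] at h1
  refine powWedge_ne_zero e _ _ (fun h2 => hη ?_) b hb h1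
  exact formVal_injective (h2.trans formVal_zero.symm)

theorem twistedStructure_finrank (hm : Module.finrank ℝ EM = 4 * m) :
    Module.finrank ℝ (EM × EY) / 2 = 2 * m + Module.finrank ℝ EY / 2 ∧
      Module.finrank ℝ (EM × EY) = 2 * (Module.finrank ℝ (EM × EY) / 2) := by
  have hfd : FiniteDimensional ℝ EY := FiniteDimensional.complexToReal EY
  have h1 := finrank_complex EY
  rw [Module.finrank_prod, hm]
  omega

theorem contDiffAt_powWedge {N : ℕ} {n : ℕ} (e : (Fin m × Fin 2) ⊕ Fin n ≃ Fin N)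
    {G : Type*} [NormedAddCommGroup G] [NormedSpace ℝ G] {B : G → EM →L[ℝ] EM →L[ℝ] ℂ} {x : G}
    (hB : ContDiffAt ℝ ∞ B x) {g : G → ℂ} (hg : ContDiffAt ℝ ∞ g x) (δ : EY [⋀^Fin n]→L[ℝ] ℂ) :
    ContDiffAt ℝ ∞ (fun y => powWedge e (B y) (g y • δ)) x := by
  have hfd : FiniteDimensional ℝ EY := FiniteDimensional.complexToReal EY
  refine contDiffAt_alternating fun v => ?_
  simp only [powWedge_apply, altSum, blockMul_apply, ContinuousAlternatingMap.smul_apply,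
    smul_eq_mul]
  refine ContDiffAt.sum fun σ _ => contDiffAt_const.mul ?_
  refine ContDiffAt.mul ?_ (hg.mul contDiffAt_const)
  exact contDiffAt_prod fun i _ => (hB.clm_apply contDiffAt_const).clm_apply contDiffAt_const

/-- In charts the affine section becomes a holomorphic lift `F` of `φ` and `η` becomes `g δ`, so the
form is `Ω_{F(y)} ^ m ∧ g δ`, to which `extDeriv_powWedge` applies. -/
theorem isHolFormAt_twistForm (h : HyperkahlerStructure EM M)
    {φ : Y → CP1} (hφ : IsHolMapCP1 (E := EY) φ) {i : Fin 2}
    {η : ∀ y : Y, (canonicalBundle 𝓘(ℝ, EY) (complexMul (E := EY) (Y := Y))).fiber y} {x : M × Y}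
    (hx : φ x.2 ∈ affinePiece i) (hη : IsHolFormAt 𝓘(ℝ, EY) complexMul η x.2) :
    IsHolFormAt (𝓘(ℝ, EM).prod 𝓘(ℝ, EY)) (twistedStructure (EY := EY) h φ)
      (fun x => twistForm e h φ x (affineSection i (φ x.2)) (η x.2)) x := by
  have hfd : FiniteDimensional ℝ EY := FiniteDimensional.complexToReal EY
  obtain ⟨δ, -, -, hδ0, hδ⟩ := exists_volume EY
  obtain ⟨g, hg, hgd, hgs⟩ := hη.exists_chart hδ0 hδ
  obtain ⟨F, hF⟩ := hφ.exists_affine_lift_chart hx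
  obtain ⟨hI, hJ, hK⟩ := h.contDiffAt_formOfEnd x.1
  have hFc : ContDiffAt ℝ ∞ F (extChartAt 𝓘(ℝ, EY) x.2 x.2) :=
    (contDiffAt_pi_of_eventually_differentiableAt (hF.mono fun _ he => he.1)).restrict_scalars ℝ
  have hFd : DifferentiableAt ℂ F (extChartAt 𝓘(ℝ, EY) x.2 x.2) := hF.self_of_nhds.1
  set a : EM × EY := extChartAt (𝓘(ℝ, EM).prod 𝓘(ℝ, EY)) x x with ha
  have ha1 : a.1 = extChartAt 𝓘(ℝ, EM) x.1 x.1 := by rw [ha, extChartAt_prod]; rfl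
  have ha2 : a.2 = extChartAt 𝓘(ℝ, EY) x.2 x.2 := by rw [ha, extChartAt_prod]; rfl
  let B : EM × EY → EM →L[ℝ] EM →L[ℝ] ℂ := fun e => h.formChart (F e.2) x.1 e.1
  have hsec : secInChart (𝓘(ℝ, EM).prod 𝓘(ℝ, EY)) (twistedStructure (EY := EY) h φ)
      (fun x => twistForm e h φ x (affineSection i (φ x.2)) (η x.2)) x =ᶠ[𝓝 a]
      fun y => powWedge e (B y) (g y.2 • δ) := by
    have hsnd : Filter.Tendsto Prod.snd (𝓝 a) (𝓝 (extChartAt 𝓘(ℝ, EY) x.2 x.2)) :=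
      ha2 ▸ continuous_snd.continuousAt
    filter_upwards [hsnd.eventually hF, hsnd.eventually hgs,
      extChartAt_target_mem_nhds (I := 𝓘(ℝ, EM).prod 𝓘(ℝ, EY)) x] with y hy hy' hyt
    have h1 : (extChartAt (𝓘(ℝ, EM).prod 𝓘(ℝ, EY)) x).symm y =
        ((extChartAt 𝓘(ℝ, EM) x.1).symm y.1, (extChartAt 𝓘(ℝ, EY) x.2).symm y.2) := by
      rw [extChartAt_prod]
      rfl
    rw [secInChart, h1, formVal_twistForm, chartSymmJac_prod hyt, powWedge_comp]
    simp only [B]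
    rw [h.formChart_eq_bilinearComp, hy.2, ← hy']
    rfl
  have hBc : ContDiffAt ℝ ∞ B a := by
    refine contDiffAt_omega ?_ ?_ ?_ ?_
    · exact ContDiffAt.comp a (ha2 ▸ hFc) contDiffAt_snd
    · exact ContDiffAt.comp a (g := formOfEnd h.g h.I x.1) (f := Prod.fst) (ha1 ▸ hI) contDiffAt_fst
    · exact ContDiffAt.comp a (g := formOfEnd h.g h.J x.1) (f := Prod.fst) (ha1 ▸ hJ) contDiffAt_fst
    · exact ContDiffAt.comp a (g := formOfEnd h.g h.K x.1) (f := Prod.fst) (ha1 ▸ hK) contDiffAt_fst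
  have hBd : DifferentiableAt ℝ B a := hBc.differentiableAt (by simp)
  refine ⟨(contDiffAt_powWedge e hBc (ContDiffAt.comp a (ha2 ▸ hg) contDiffAt_snd)
      δ).congr_of_eventuallyEq hsec, ?_⟩
  rw [hsec.extDeriv_eq]
  refine extDeriv_powWedge e hBd ?_ ?_ (ha2 ▸ hgd) δ hδ ?_
  -- Along `M` the parameter `F(y)` is frozen, and `Ω_z` is closed for fixed `z`.
  · have hpart : ∀ u v w : EM, fderiv ℝ B a (u, 0) v w =
        fderiv ℝ (h.formChart (F a.2) x.1) (extChartAt 𝓘(ℝ, EM) x.1 x.1) u v w := by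
      intro u v w
      have hin : HasFDerivAt (fun p : EM => (p, a.2)) (ContinuousLinearMap.inl ℝ EM EY) a.1 :=
        hasFDerivAt_prodMk_left a.1 a.2
      have h1 := HasFDerivAt.comp (f := fun p : EM => (p, a.2)) a.1
        (hasFDerivAt_bilin_apply hBd v w) hin
      have h2 := hasFDerivAt_bilin_apply (h.differentiableAt_formChart (F a.2) x.1) v w
      rw [← ha1] at h2 ⊢
      exact congrArg (fun L : EM →L[ℝ] ℂ => L u) (h1.unique h2)
    intro u v w
    rw [hpart, hpart, hpart]
    exact h.formChart_closed (F a.2) x.1 u v w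
  -- With the point of `M` frozen, the values of `Ω_{F(y)}` are quadratic polynomials in the
  -- holomorphic functions `F₀`, `F₁`.
  · intro v w
    rw [← ha2] at hFd
    have h0 := differentiableAt_pi.1 hFd 0
    have h1 := differentiableAt_pi.1 hFd 1
    simp only [B, HyperkahlerStructure.formChart, omega_apply]
    fun_prop
  · have := finrank_real_of_complex EY
    omega

end TwistForm

/-! ### The canonical bundle of the total space -/

section CanonicalBundleTotal

variable {EM : Type*} [NormedAddCommGroup EM] [NormedSpace ℝ EM] [FiniteDimensional ℝ EM]
  {M : Type*} [TopologicalSpace M] [ChartedSpace EM M] [IsManifold 𝓘(ℝ, EM) ∞ M]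
  {EY : Type*} [NormedAddCommGroup EY] [NormedSpace ℂ EY] [FiniteDimensional ℂ EY]
  {Y : Type*} [TopologicalSpace Y] [ChartedSpace EY Y] [IsManifold 𝓘(ℂ, EY) ω Y] {m : ℕ}
  (e : (Fin m × Fin 2) ⊕ Fin (Module.finrank ℝ EY / 2) ≃ Fin (Module.finrank ℝ (EM × EY) / 2))

theorem complexMul_sq (y : Y) (v : TangentSpace 𝓘(ℝ, EY) y) :
    complexMul y (complexMul y v) = -v := by
  have hv : ∀ v : EY, Complex.I • Complex.I • v = -v := fun v => by
    rw [smul_smul, Complex.I_mul_I, neg_one_smul]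
  exact hv v

variable (EY Y) in
/-- Local frames of the canonical bundle of a complex manifold. -/
theorem exists_isFrame_canonicalBundle (y : Y) : ∃ V : Set Y, IsOpen V ∧ y ∈ V ∧
    ∃ η : ∀ y, (canonicalBundle 𝓘(ℝ, EY) (complexMul (E := EY) (Y := Y))).fiber y,
      IsFrame (IsHolFun 𝓘(ℝ, EY) complexMul) (canonicalBundle 𝓘(ℝ, EY) complexMul) V η := by
  obtain ⟨δ, d, hd, hδ0, hδ⟩ := exists_volume EY
  exact ⟨_, isOpen_extChartAt_source y, mem_extChartAt_source y, _,
    isFrame_volumeFrame hδ hd hδ0 y⟩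

variable (hm : Module.finrank ℝ EM = 4 * m) (h : HyperkahlerStructure EM M) {φ : Y → CP1}

include hm in
theorem isFrame_twistForm (hφ : IsHolMapCP1 (E := EY) φ) (i : Fin 2) {V : Set Y} (hV : IsOpen V)
    {η : ∀ y, (canonicalBundle 𝓘(ℝ, EY) (complexMul (E := EY) (Y := Y))).fiber y}
    (hη : IsFrame (IsHolFun 𝓘(ℝ, EY) complexMul) (canonicalBundle 𝓘(ℝ, EY) complexMul) V η) :
    IsFrame (IsHolFun (𝓘(ℝ, EM).prod 𝓘(ℝ, EY)) (twistedStructure (EY := EY) h φ))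
      (canonicalBundle (𝓘(ℝ, EM).prod 𝓘(ℝ, EY)) (twistedStructure (EY := EY) h φ))
      (Prod.snd ⁻¹' (V ∩ φ ⁻¹' affinePiece i))
      (fun x => twistForm e h φ x (affineSection i (φ x.2)) (η x.2)) := by
  have hfd : FiniteDimensional ℝ EY := FiniteDimensional.complexToReal EY
  have hηh : (canonicalBundle 𝓘(ℝ, EY) (complexMul (E := EY) (Y := Y))).IsHol V η :=
    hη.isHol (isFunctionSheaf_isHolFun _) hV Subset.rfl
  exact isFrame_canonicalBundle (twistedStructure_sq h φ) (twistedStructure_finrank hm).2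
    (fun x hx => isHolFormAt_twistForm e h hφ hx.2 (hηh x.2 hx.1))
    fun x hx => twistForm_ne_zero e hm h φ x (affineSection_ne_zero hx.2) (hη.1 x.2 hx.1)

include e hm in
theorem isHolLineBundle_canonicalBundle_twistedStructure (hφ : IsHolMapCP1 (E := EY) φ) :
    IsHolLineBundle (IsHolFun (𝓘(ℝ, EM).prod 𝓘(ℝ, EY)) (twistedStructure (EY := EY) h φ))
      (canonicalBundle (𝓘(ℝ, EM).prod 𝓘(ℝ, EY)) (twistedStructure (EY := EY) h φ)) := by
  have hfd : FiniteDimensional ℝ EY := FiniteDimensional.complexToReal EY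
  refine isHolLineBundle_canonicalBundle (twistedStructure_sq h φ)
    (twistedStructure_finrank hm).2 fun x => ?_
  obtain ⟨V, hV, hxV, η, hη⟩ := exists_isFrame_canonicalBundle EY Y x.2
  obtain ⟨i, hi⟩ := exists_mem_affinePiece (φ x.2)
  have hW : IsOpen (Prod.snd ⁻¹' (V ∩ φ ⁻¹' affinePiece i) : Set (M × Y)) :=
    (hV.inter ((isOpen_affinePiece i).preimage hφ.continuous)).preimage continuous_snd
  have hf := isFrame_twistForm e hm h hφ i hV hη
  exact ⟨_, hW, ⟨hxV, hi⟩, _, hf.isHol (isFunctionSheaf_isHolFun _) hW Subset.rfl, hf.1⟩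

include hm in
/-- The fibrewise isomorphism which takes `Ω_t ^ m ∧ η` to `η ⊗ t ^ {2m}`. -/
theorem exists_twistForm_equiv (x : M × Y) :
    ∃ T : (canonicalBundle (𝓘(ℝ, EM).prod 𝓘(ℝ, EY)) (twistedStructure (EY := EY) h φ)).fiber x ≃ₗ[ℂ]
      (canonicalBundle 𝓘(ℝ, EY) (complexMul (E := EY) (Y := Y))).fiber x.2 ⊗[ℂ]
        (bundleONeg (2 * m)).fiber (φ x.2),
      ∀ t η, T (twistForm e h φ x t η) = η ⊗ₜ[ℂ] tensorPow (φ x.2) t (2 * m) := by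
  have hfd : FiniteDimensional ℝ EY := FiniteDimensional.complexToReal EY
  obtain ⟨V, hV, hxV, η₀, hη₀⟩ := exists_isFrame_canonicalBundle EY Y x.2
  obtain ⟨i, hi⟩ := exists_mem_affinePiece (φ x.2)
  have ht0 := affineSection_ne_zero hi
  have hη0 := hη₀.1 x.2 hxV
  have hne := twistForm_ne_zero e hm h φ x ht0 hη0
  have hY : Module.finrank ℂ
      ((canonicalBundle 𝓘(ℝ, EY) (complexMul (E := EY) (Y := Y))).fiber x.2) = 1 :=
    finrank_holForms complexMul_sq (finrank_complex EY) hη0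
  obtain ⟨T, hT⟩ := exists_linearEquiv_of_finrank_eq_one
    (finrank_holForms (twistedStructure_sq h φ) (twistedStructure_finrank hm).2 hne)
    (by rw [Module.finrank_tensorProduct, hY, finrank_bundleONeg])
    hne (tmul_ne_zero_of_ne_zero hη0 (tensorPow_ne_zero ht0 (2 * m)))
  -- `T` is fixed on one pair of nonzero vectors. Both sides scale by `c ^ (2m) * d` under `(t, η) ↦
  -- (c t, d η)` and both spaces of arguments are lines, so the formula holds for all `t` and `η`.
  refine ⟨T, fun t η => ?_⟩
  obtain ⟨c, rfl⟩ := exists_smul_of_mem_submodule (b := t) ht0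
  obtain ⟨d, rfl⟩ := exists_smul_eq_of_finrank_eq_one hY hη0 η
  rw [twistForm_smul, map_smul, hT, tensorPow_smul, TensorProduct.tmul_smul,
    ← TensorProduct.smul_tmul', smul_smul]

-- Near each point take `t` the affine section and `η` a frame of `K_Y`. The frame `Ω_t ^ m ∧ η` of
-- `K_X` is carried to the frame `η ⊗ t ^ {2m}` of the pullback, and
-- `IsLocalBundle.isHol_iff_of_frame` concludes.
include e hm in
theorem nonempty_bundleIso_canonicalBundle (hφ : IsHolMapCP1 (E := EY) φ) :
    Nonempty (BundleIso
      (canonicalBundle (𝓘(ℝ, EM).prod 𝓘(ℝ, EY)) (twistedStructure (EY := EY) h φ))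
      (pullbackBundle (IsHolFun (𝓘(ℝ, EM).prod 𝓘(ℝ, EY)) (twistedStructure (EY := EY) h φ))
        (Prod.snd : M × Y → Y)
        (tensorBundle (IsHolFun 𝓘(ℝ, EY) complexMul)
          (canonicalBundle 𝓘(ℝ, EY) (complexMul (E := EY) (Y := Y)))
          (pullbackBundle (IsHolFun 𝓘(ℝ, EY) (complexMul (E := EY) (Y := Y))) φ
            (bundleONeg (2 * m)))))) := by
  choose T hT using exists_twistForm_equiv e hm h (φ := φ)
  have hOX : IsFunctionSheaf
      (IsHolFun (𝓘(ℝ, EM).prod 𝓘(ℝ, EY)) (twistedStructure (EY := EY) h φ)) :=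
    isFunctionSheaf_isHolFun _
  have hOY : IsFunctionSheaf (IsHolFun 𝓘(ℝ, EY) (complexMul (E := EY) (Y := Y))) :=
    isFunctionSheaf_isHolFun _
  have hP := isLocalBundle_pullbackBundle hOY (bundleONeg (2 * m)) φ
  have hKP := isLocalBundle_tensorBundle hOY
    (isLocalBundle_canonicalBundle (complexMul (E := EY) (Y := Y))) hP
  refine ⟨⟨T, fun U hU s => IsLocalBundle.isHol_iff_of_frame
    (O := IsHolFun (𝓘(ℝ, EM).prod 𝓘(ℝ, EY)) (twistedStructure (EY := EY) h φ))
        (isLocalBundle_canonicalBundle _)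
    (isLocalBundle_pullbackBundle hOX (tensorBundle (IsHolFun 𝓘(ℝ, EY) complexMul)
      (canonicalBundle 𝓘(ℝ, EY) (complexMul (E := EY) (Y := Y)))
      (pullbackBundle (IsHolFun 𝓘(ℝ, EY) (complexMul (E := EY) (Y := Y))) φ
        (bundleONeg (2 * m)))) Prod.snd) T (fun x => ?_) hU s⟩⟩
  obtain ⟨V, hV, hxV, η, hη⟩ := exists_isFrame_canonicalBundle EY Y x.2
  obtain ⟨i, hi⟩ := exists_mem_affinePiece (φ x.2)
  have hVi : IsOpen (V ∩ φ ⁻¹' affinePiece i) :=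
    hV.inter ((isOpen_affinePiece i).preimage hφ.continuous)
  have h1 := isFrame_pullbackBundle hOY isFunctionSheaf_isHolFunCP1
    (isLocalBundle_bundleONeg (2 * m)) (fun W f hW hf => IsHolFunCP1.comp hφ hW hf)
    (isOpen_affinePiece i) (isFrame_tensorPow i (2 * m))
  have h2 := isFrame_tensorBundle hOY (hη.mono (inter_subset_left (t := φ ⁻¹' affinePiece i)))
    (h1.mono inter_subset_right)
  have h3 := isFrame_pullbackBundle hOX hOY hKP
    (fun W f _ hf => IsHolFun.comp_isHolMap (isHolMap_snd h φ) hf) hVi h2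
  exact ⟨_, hVi.preimage continuous_snd, ⟨hxV, hi⟩, _, _, isFrame_twistForm e hm h hφ i hV hη, h3,
    fun y _ => hT y _ _⟩

end CanonicalBundleTotal

end CalabiGray

end

/-! ### The main theorem -/

theorem mainTheorem5
    {EM : Type*} [NormedAddCommGroup EM] [NormedSpace ℝ EM] [FiniteDimensional ℝ EM]
    {M : Type*} [TopologicalSpace M] [ChartedSpace EM M] [IsManifold 𝓘(ℝ, EM) ∞ M]
    [T2Space M] [CompactSpace M]
    {EY : Type*} [NormedAddCommGroup EY] [NormedSpace ℂ EY] [FiniteDimensional ℂ EY]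
    {Y : Type*} [TopologicalSpace Y] [ChartedSpace EY Y] [IsManifold 𝓘(ℂ, EY) ω Y]
    [T2Space Y] [CompactSpace Y]
    (m : ℕ) (hm : Module.finrank ℝ EM = 4 * m)
    (h : CalabiGray.HyperkahlerStructure EM M)
    (φ : Y → CalabiGray.CP1) (hφ : CalabiGray.IsHolMapCP1 (E := EY) φ)
    (hφ_nonconst : ∃ y y' : Y, φ y ≠ φ y') :
    -- the twisted structure makes `X = M × Y` a complex manifold
    CalabiGray.IsComplexStructure (𝓘(ℝ, EM).prod 𝓘(ℝ, EY))
      (CalabiGray.twistedStructure (EY := EY) h φ) ∧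
    -- the projection `p : X → Y` is holomorphic
    CalabiGray.IsHolMap (𝓘(ℝ, EM).prod 𝓘(ℝ, EY)) 𝓘(ℝ, EY)
      (CalabiGray.twistedStructure (EY := EY) h φ) CalabiGray.complexMul
      (Prod.snd : M × Y → Y) ∧
    -- the slices `{p} × Y` are complex submanifolds
    (∀ p : M, CalabiGray.IsComplexSubmanifold (𝓘(ℝ, EM).prod 𝓘(ℝ, EY))
      (CalabiGray.twistedStructure (EY := EY) h φ) (({p} : Set M) ×ˢ (Set.univ : Set Y))) ∧
    -- `K_X` is a holomorphic line bundle, isomorphic to `p^*(K_Y ⊗ φ^* 𝒪(-2m))`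
    CalabiGray.IsHolLineBundle
      (CalabiGray.IsHolFun (𝓘(ℝ, EM).prod 𝓘(ℝ, EY))
        (CalabiGray.twistedStructure (EY := EY) h φ))
      (CalabiGray.canonicalBundle (𝓘(ℝ, EM).prod 𝓘(ℝ, EY))
        (CalabiGray.twistedStructure (EY := EY) h φ)) ∧
    Nonempty (CalabiGray.BundleIso
      (CalabiGray.canonicalBundle (𝓘(ℝ, EM).prod 𝓘(ℝ, EY))
        (CalabiGray.twistedStructure (EY := EY) h φ))
      (CalabiGray.pullbackBundle
        (CalabiGray.IsHolFun (𝓘(ℝ, EM).prod 𝓘(ℝ, EY))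
          (CalabiGray.twistedStructure (EY := EY) h φ))
        (Prod.snd : M × Y → Y)
        (CalabiGray.tensorBundle
          (CalabiGray.IsHolFun 𝓘(ℝ, EY) CalabiGray.complexMul)
          (CalabiGray.canonicalBundle 𝓘(ℝ, EY) (CalabiGray.complexMul (E := EY) (Y := Y)))
          (CalabiGray.pullbackBundle
            (CalabiGray.IsHolFun 𝓘(ℝ, EY) (CalabiGray.complexMul (E := EY) (Y := Y))) φ
            (CalabiGray.bundleONeg (2 * m)))))) := by
  have hcard : Fintype.card ((Fin m × Fin 2) ⊕ Fin (Module.finrank ℝ EY / 2)) =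
      Module.finrank ℝ (EM × EY) / 2 := by
    rw [(CalabiGray.twistedStructure_finrank (EY := EY) hm).1]
    simp [mul_comm]
  -- Any enumeration of the `2m + n` slots will do; another choice changes `Ω_t ^ m ∧ η` only by a
  -- sign.
  let e := Fintype.equivFinOfCardEq hcard
  exact ⟨CalabiGray.isComplexStructure_twistedStructure h hφ, CalabiGray.isHolMap_snd h φ,
    CalabiGray.isComplexSubmanifold_slice h φ,
    CalabiGray.isHolLineBundle_canonicalBundle_twistedStructure e hm h hφ,
    CalabiGray.nonempty_bundleIso_canonicalBundle e hm h hφ⟩
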